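/- Let $\mathfrak g_0$ be a real semisimple Lie algebra, $\theta$ a Cartan involution, $\mathfrak a_0$ a maximal abelian subspace of the $(-1)$-eigenspace of $\theta$, and let $\mathfrak g,\mathfrak a$ be the complexifications. Let $\Sigma\subset\mathfrak a^*=\operatorname{Hom}_{\mathbb C}(\mathfrak a,\mathbb C)$ be the restricted root system, with root spaces $\mathfrak g_\alpha$, positive system $\Sigma^+$ and enumerated simple roots $\alpha_1,\dots,\alpha_l$; put $\mathfrak n=\bigoplus_{\alpha\in\Sigma^+}\mathfrak g_\alpha$, $\mathcal P=\{\sum_{\alpha\in\Sigma^+}n_\alpha\alpha\mid n_\alpha\in\mathbb Z\}$ and $\mathcal P^+=\{\sum_{\alpha\in\Sigma^+}n_\alpha\alpha\mid n_\alpha\in\mathbb Z_{\ge0}\}$. Order $\mathfrak a_0^*$ lexicographically with respect to the coordinates in the basis $\alpha_1,\dots,\alpha_l$. Put $\widehat{\mathcal E}(\mathfrak n)=\varprojlim_k U(\mathfrak n)/\mathfrak n^kU(\mathfrak n)$ and $\widehat{\mathcal E}(\mathfrak g,\mathfrak n)=\widehat{\mathcal E}(\mathfrak n)\otimes_{U(\mathfrak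 n)}U(\mathfrak g)$, which is an algebra under the continuous extension of the multiplication of $U(\mathfrak g)$ (it is the subalgebra $\widehat{\mathcal E}(\mathfrak n)U(\mathfrak g)$ of $\varprojlim_k U(\mathfrak g)/\mathfrak n^kU(\mathfrak g)$). Let $\Lambda$ be a subgroup of $\mathcal P$ and $\Lambda^+=\Lambda\cap\mathcal P^+$. A subscript $\Lambda$ on $U(\mathfrak g)$, $U(\mathfrak n)$, $\widehat{\mathcal E}(\mathfrak n)$ or $\widehat{\mathcal E}(\mathfrak g,\mathfrak n)$ denotes the subalgebra of elements whose $\mathfrak a$-weight components (for the adjoint action) of weight $\mu$ vanish for all $\mu\notin\Lambda$; put $(\mathfrak nU(\mathfrak n))_\Lambda=\mathfrak nU(\mathfrak n)\cap U(\mathfrak n)_\Lambda$ and $(\mathfrak n\widehat{\mathcal E}(\mathfrak n))_\Lambda=\mathfrak n\widehat{\mathcal E}(\mathfrak n)\cap\widehat{\mathcal E}(\mathfrak n)_\Lambda$. Let $U$ be a $U(\mathfrak g)_\Lambda$-module generated over $U(\mathfrak n)_\Lambda$ by $u_1,\dots,u_N$, and write $u={}^t(u_1,\dots,u_N)$, $\widehat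 U=\widehat{\mathcal E}(\mathfrak g,\mathfrak n)_\Lambda\otimes_{U(\mathfrak g)_\Lambda}U$, $\overline U=U/(\mathfrak nU(\mathfrak n))_\Lambda U$ and $\overline u=u \bmod (\mathfrak nU(\mathfrak n))_\Lambda U$. (1) $\overline U$ is finite dimensional. Let $r$ be its dimension. One can choose $\lambda_1,\dots,\lambda_r\in\mathfrak a^*$ with $\operatorname{Re}\lambda_1\ge\dots\ge\operatorname{Re}\lambda_r$ (the eigenvalues of $\mathfrak a$ on $\overline U$ with multiplicities), a basis $\overline v={}^t(\overline v_1,\dots,\overline v_r)$ of $\overline U$, a linear map $\overline Q\colon\mathfrak a\to M(r,\mathbb C)$, and matrices $\overline A\in M(N,r,\mathbb C)$, $\overline B\in M(r,N,\mathbb C)$ such that, for all $H\in\mathfrak a$: $H\overline v=\overline Q(H)\overline v$; $\overline Q(H)_{ii}=\lambda_i(H)$; $\overline Q(H)_{ij}=0$ if $i>j$ or $\lambda_i\ne\lambda_j$; $\overline v=\overline B\,\overline u$; and $\overline u=\overline A\,\overline v$. (2) For every such choice there exist matrices $A\in M(N,r,\widehat{\mathcal E}(\mathfrak n)_\Lambda)$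 and $B\in M(r,N,\widehat{\mathcal E}(\mathfrak n)_\Lambda)$ and a linear map $Q\colon\mathfrak a\to M(r,U(\mathfrak n)_\Lambda)$ such that, with $v=Bu\in\widehat U^r$: - $Hv=Q(H)v$ for all $H\in\mathfrak a$; - $Q(H)-\overline Q(H)\in M(r,(\mathfrak nU(\mathfrak n))_\Lambda)$ for all $H\in\mathfrak a$; - if $\lambda_i-\lambda_j\notin\Lambda^+$, then $Q(H)_{ij}=0$ for all $H\in\mathfrak a$; - if $\lambda_i-\lambda_j\in\Lambda^+$, then $[H',Q(H)_{ij}]=(\lambda_i-\lambda_j)(H')\,Q(H)_{ij}$ for all $H,H'\in\mathfrak a$; - $Q(H)$ is upper triangular with diagonal entries $\lambda_1(H),\dots,\lambda_r(H)$, for all $H\in\mathfrak a$; - $u=ABu$ in $\widehat U^N$; - $A-\overline A\in M(N,r,(\mathfrak n\widehat{\mathcal E}(\mathfrak n))_\Lambda)$ and $B-\overline B\in M(r,N,(\mathfrak n\widehat{\mathcal E}(\mathfrak n))_\Lambda)$. -/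

import Mathlib

open scoped TensorProduct

noncomputable section

namespace BoundaryValue

/-! ### Completion of an algebra along the right ideals `V ^ k R` -/

section Completion

variable {R : Type*} [Ring R] [Algebra ℂ R]

/-- The right ideal `V ^ k R` of an algebra `R`, for a subspace `V` of `R`. -/
def powIdeal (V : Submodule ℂ R) (k : ℕ) : Submodule ℂ R := V ^ k * ⊤

theorem mul_mem_powIdeal (V : Submodule ℂ R) (k : ℕ) {x : R} (hx : x ∈ powIdeal V k) (y : R) :
    x * y ∈ powIdeal V k := by
  have h : powIdeal V k * ⊤ ≤ powIdeal V k := by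
    rw [powIdeal, mul_assoc]
    exact mul_le_mul_right le_top _
  exact h (Submodule.mul_mem_mul hx trivial)

theorem powIdeal_zero (V : Submodule ℂ R) : powIdeal V 0 = ⊤ := by
  rw [powIdeal, pow_zero, one_mul]

theorem powIdeal_succ (V : Submodule ℂ R) (k : ℕ) : powIdeal V (k + 1) = V * powIdeal V k := by
  rw [powIdeal, pow_succ', mul_assoc, powIdeal]

theorem powIdeal_antitone (V : Submodule ℂ R) {i k : ℕ} (h : i ≤ k) :
    powIdeal V k ≤ powIdeal V i := by
  refine antitone_nat_of_succ_le (f := powIdeal V) (fun k => ?_) h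
  rw [powIdeal, pow_succ, mul_assoc]
  exact mul_le_mul_right le_top _

/-- Left multiplications are continuous for the topology defined by the right ideals `V ^ k R`.
This makes the multiplication of `R` extend to the completion. -/
class LeftContinuous (V : Submodule ℂ R) : Prop where
  cont : ∀ (p : R) (k : ℕ), ∃ b, ∀ x ∈ powIdeal V b, p * x ∈ powIdeal V k

/-- Compatible sequences `(x_k)` with `x_k ∈ R / V ^ k R`. -/
def compatible (V : Submodule ℂ R) : Submodule ℂ (∀ k, R ⧸ powIdeal V k) where
  carrier := {x | ∀ i k (h : i ≤ k), Submodule.factor (powIdeal_antitone V h) (x k) = x i}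
  add_mem' {x y} hx hy := fun i k h => by simp [hx i k h, hy i k h]
  zero_mem' := fun i k h => by simp
  smul_mem' c x hx := fun i k h => by simp [hx i k h]

/-- The inverse limit of the quotients `R / V ^ k R`. -/
def InvLim (V : Submodule ℂ R) : Type _ := ↥(compatible V)

namespace InvLim

variable {V : Submodule ℂ R}

instance : AddCommGroup (InvLim V) := inferInstanceAs (AddCommGroup ↥(compatible V))

instance : Module ℂ (InvLim V) := inferInstanceAs (Module ℂ ↥(compatible V))

/-- The `k`-th component of an element of the inverse limit. -/
def comp (k : ℕ) : InvLim V →ₗ[ℂ] R ⧸ powIdeal V k :=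
  (LinearMap.proj k).comp (compatible V).subtype

theorem ext {x y : InvLim V} (h : ∀ k, comp k x = comp k y) : x = y :=
  Subtype.ext (funext h)

/-- `p` represents `x` modulo `V ^ k R`. -/
def Rep (x : InvLim V) (k : ℕ) (p : R) : Prop := Submodule.Quotient.mk p = comp k x

theorem exists_rep (x : InvLim V) (k : ℕ) : ∃ p, Rep x k p :=
  Submodule.Quotient.mk_surjective _ (comp k x)

theorem Rep.mono {x : InvLim V} {i k : ℕ} {p : R} (h : Rep x k p) (hik : i ≤ k) : Rep x i p := by
  have h1 : Submodule.factor (powIdeal_antitone V hik) (comp k x) = comp i x := x.2 i k hik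
  rw [Rep, ← h1, ← h]
  rfl

theorem Rep.sub_mem {x : InvLim V} {k : ℕ} {p q : R} (hp : Rep x k p) (hq : Rep x k q) :
    p - q ∈ powIdeal V k :=
  (Submodule.Quotient.eq _).1 (hp.trans hq.symm)

/-- Build an element of the inverse limit from compatible representatives. -/
def ofReps (f : ℕ → R) (hf : ∀ i k, i ≤ k → f k - f i ∈ powIdeal V i) : InvLim V :=
  ⟨fun k => Submodule.Quotient.mk (f k), fun i k h => (Submodule.Quotient.eq _).2 (hf i k h)⟩

theorem rep_ofReps (f : ℕ → R) (hf : ∀ i k, i ≤ k → f k - f i ∈ powIdeal V i) (k : ℕ) :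
    Rep (ofReps f hf) k (f k) := rfl

theorem Rep.add {x y : InvLim V} {k : ℕ} {p q : R} (hp : Rep x k p) (hq : Rep y k q) :
    Rep (x + y) k (p + q) := by
  rw [Rep, map_add, ← hp, ← hq]; rfl

theorem Rep.smul {x : InvLim V} {k : ℕ} {p : R} (c : ℂ) (hp : Rep x k p) :
    Rep (c • x) k (c • p) := by
  rw [Rep, map_smul, ← hp]; rfl

theorem Rep.eq {x y : InvLim V} {k : ℕ} {p q : R} (hp : Rep x k p) (hq : Rep y k q)
    (h : p = q) :
    comp k x = comp k y := hp.symm.trans (h ▸ hq)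

instance : One (InvLim V) where
  one := ofReps (fun _ => 1) (fun i k _ => by simp)

theorem rep_one (k : ℕ) : Rep (1 : InvLim V) k 1 := rfl

theorem rep_zero (k : ℕ) : Rep (0 : InvLim V) k 0 := rfl

theorem prod_sub_mem {x y : InvLim V} {k b b' : ℕ} {p p' q q' : R}
    (hp : Rep x k p) (hp' : Rep x k p') (hb : ∀ z ∈ powIdeal V b, p * z ∈ powIdeal V k)
    (hb' : ∀ z ∈ powIdeal V b', p' * z ∈ powIdeal V k) (hq : Rep y b q) (hq' : Rep y b' q') :
    p * q - p' * q' ∈ powIdeal V k := by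
  obtain ⟨c, hc⟩ := exists_rep y (max b b')
  have h1 := hb _ (hq.sub_mem (hc.mono (le_max_left _ _)))
  have h2 := hb' _ (hq'.sub_mem (hc.mono (le_max_right _ _)))
  have h3 := mul_mem_powIdeal V k (hp.sub_mem hp') c
  have h4 := Submodule.sub_mem _ (Submodule.add_mem _ h1 h3) h2
  convert h4 using 1
  noncomm_ring

variable {R' : Type*} [Ring R'] [Algebra ℂ R'] {V' : Submodule ℂ R'}

theorem powIdeal_le_comap (φ : R →ₐ[ℂ] R') (h : ∀ x ∈ V, φ x ∈ V') (k : ℕ) :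
    powIdeal V k ≤ (powIdeal V' k).comap φ.toLinearMap := by
  rw [← Submodule.map_le_iff_le_comap, powIdeal, Submodule.map_mul, Submodule.map_pow]
  refine mul_le_mul' (pow_le_pow_left' ?_ k) le_top
  rintro _ ⟨y, hy, rfl⟩
  exact h y hy

/-- Functoriality of the completion, on underlying vector spaces: `(x_k) ↦ (φ (x_k))`. -/
def mapLin (φ : R →ₐ[ℂ] R') (h : ∀ x ∈ V, φ x ∈ V') : InvLim V →ₗ[ℂ] InvLim V' :=
  LinearMap.codRestrict (compatible V')
    (LinearMap.pi fun k => (Submodule.mapQ (powIdeal V k) (powIdeal V' k) φ.toLinearMap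
      (powIdeal_le_comap φ h k)).comp (comp k))
    (fun x i k hik => by
      obtain ⟨p, hp⟩ := exists_rep x k
      have h1 := hp.mono hik
      rw [Rep] at hp h1
      rw [LinearMap.pi_apply, LinearMap.pi_apply, LinearMap.comp_apply, LinearMap.comp_apply,
        ← hp, ← h1]
      rfl)

theorem Rep.map (φ : R →ₐ[ℂ] R') (h : ∀ x ∈ V, φ x ∈ V') {x : InvLim V} {k : ℕ} {p : R}
    (hp : Rep x k p) : Rep (mapLin φ h x) k (φ p) := by
  have h1 : comp k (mapLin φ h x) = Submodule.mapQ (powIdeal V k) (powIdeal V' k) φ.toLinearMap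
    (powIdeal_le_comap φ h k) (comp k x) := rfl
  rw [Rep] at hp
  rw [Rep, h1, ← hp]
  rfl

variable [LeftContinuous V]

/-- A modulus of continuity for left multiplication by `p`. -/
def modulus (V : Submodule ℂ R) [LeftContinuous V] (p : R) (k : ℕ) : ℕ :=
  (LeftContinuous.cont (V := V) p k).choose

theorem modulus_spec (p : R) (k : ℕ) {x : R} (hx : x ∈ powIdeal V (modulus V p k)) :
    p * x ∈ powIdeal V k :=
  (LeftContinuous.cont (V := V) p k).choose_spec x hx

/-- The product: `(x y)_k` is the class of `p q`, where `p` represents `x` modulo `V ^ k R`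
and `q` represents `y` modulo `V ^ b R` for `b` so large that `p V ^ b R ⊆ V ^ k R`
(see `Rep.mul` for the independence of the choices). -/
instance : Mul (InvLim V) where
  mul x y := ofReps
    (fun k => (exists_rep x k).choose *
      (exists_rep y (modulus V (exists_rep x k).choose k)).choose)
    (fun i k h => by
      have hx := (exists_rep x k).choose_spec
      refine prod_sub_mem (x := x) (y := y) (hx.mono h) (exists_rep x i).choose_spec
        (fun z hz => powIdeal_antitone V h (modulus_spec _ _ hz)) (fun z hz => modulus_spec _ _ hz)
        (exists_rep y _).choose_spec (exists_rep y _).choose_spec)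

theorem Rep.mul {x y : InvLim V} {k b : ℕ} {p q : R} (hp : Rep x k p)
    (hb : ∀ z ∈ powIdeal V b, p * z ∈ powIdeal V k) (hq : Rep y b q) :
    Rep (x * y) k (p * q) := by
  refine Eq.trans ?_ (rep_ofReps (V := V) (fun k => (exists_rep x k).choose *
      (exists_rep y (modulus V (exists_rep x k).choose k)).choose) _ k)
  refine (Submodule.Quotient.eq _).2 ?_
  exact prod_sub_mem hp (exists_rep x k).choose_spec hb (fun z hz => modulus_spec _ _ hz) hq
    (exists_rep y _).choose_spec

instance : Ring (InvLim V) :=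
  { (inferInstance : AddCommGroup (InvLim V)), (inferInstance : Mul (InvLim V)),
    (inferInstance : One (InvLim V)) with
    left_distrib := fun x y z => ext fun k => by
      obtain ⟨p, hp⟩ := exists_rep x k
      obtain ⟨q, hq⟩ := exists_rep y (modulus V p k)
      obtain ⟨r, hr⟩ := exists_rep z (modulus V p k)
      have h := hp.mul (fun z hz => modulus_spec _ _ hz) (hq.add hr)
      exact h.eq ((hp.mul (fun z hz => modulus_spec _ _ hz) hq).add
        (hp.mul (fun z hz => modulus_spec _ _ hz) hr)) (mul_add _ _ _)
    right_distrib := fun x y z => ext fun k => by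
      obtain ⟨p, hp⟩ := exists_rep x k
      obtain ⟨q, hq⟩ := exists_rep y k
      have hb := fun t (ht : t ∈ powIdeal V (max (modulus V p k) (modulus V q k))) =>
        modulus_spec p k (powIdeal_antitone V (le_max_left _ _) ht)
      have hb' := fun t (ht : t ∈ powIdeal V (max (modulus V p k) (modulus V q k))) =>
        modulus_spec q k (powIdeal_antitone V (le_max_right _ _) ht)
      obtain ⟨r, hr⟩ := exists_rep z (max (modulus V p k) (modulus V q k))
      have h := (hp.add hq).mul (b := max (modulus V p k) (modulus V q k))
        (fun t ht => by rw [add_mul]; exact Submodule.add_mem _ (hb t ht) (hb' t ht)) hr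
      exact h.eq ((hp.mul hb hr).add (hq.mul hb' hr)) (add_mul _ _ _)
    zero_mul := fun x => ext fun k => by
      obtain ⟨p, hp⟩ := exists_rep x 0
      have h := (rep_zero (V := V) k).mul (b := 0) (fun t _ => by simp) hp
      exact h.eq (rep_zero k) (zero_mul _)
    mul_zero := fun x => ext fun k => by
      obtain ⟨p, hp⟩ := exists_rep x k
      have h := hp.mul (fun z hz => modulus_spec _ _ hz) (rep_zero _)
      exact h.eq (rep_zero k) (mul_zero _)
    one_mul := fun x => ext fun k => by
      obtain ⟨p, hp⟩ := exists_rep x k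
      have h := (rep_one (V := V) k).mul (b := k) (fun t ht => by simpa using ht) hp
      exact h.eq hp (one_mul _)
    mul_one := fun x => ext fun k => by
      obtain ⟨p, hp⟩ := exists_rep x k
      have h := hp.mul (fun z hz => modulus_spec _ _ hz) (rep_one _)
      exact h.eq hp (mul_one _)
    mul_assoc := fun x y z => ext fun k => by
      obtain ⟨p, hp⟩ := exists_rep x k
      obtain ⟨q, hq⟩ := exists_rep y (modulus V p k)
      have hpq := hp.mul (fun z hz => modulus_spec _ _ hz) hq
      have hb := fun t (ht : t ∈ powIdeal V (modulus V q (modulus V p k))) =>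
        modulus_spec q _ ht
      obtain ⟨r, hr⟩ := exists_rep z (modulus V q (modulus V p k))
      have h := hpq.mul (fun t ht => by
        rw [mul_assoc]; exact modulus_spec p k (hb t ht)) hr
      exact h.eq (hp.mul (fun z hz => modulus_spec _ _ hz) (hq.mul hb hr)) (mul_assoc _ _ _)
    neg_add_cancel := neg_add_cancel
    zsmul := fun n x => n • x
    zsmul_zero' := fun x => zero_zsmul x
    zsmul_succ' := fun n x => SubNegMonoid.zsmul_succ' n x
    zsmul_neg' := fun n x => SubNegMonoid.zsmul_neg' n x
    nsmul := fun n x => n • x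
    nsmul_zero := fun x => zero_nsmul x
    nsmul_succ := fun n x => succ_nsmul x n }

instance : Algebra ℂ (InvLim V) :=
  Algebra.ofModule
    (fun c x y => ext fun k => by
      obtain ⟨p, hp⟩ := exists_rep x k
      obtain ⟨q, hq⟩ := exists_rep y (modulus V p k)
      have hb := fun t (ht : t ∈ powIdeal V (modulus V p k)) => modulus_spec p k ht
      have h := (hp.smul c).mul (b := modulus V p k) (fun t ht => by
        rw [smul_mul_assoc]; exact Submodule.smul_mem _ _ (hb t ht)) hq
      exact h.eq ((hp.mul hb hq).smul c) (smul_mul_assoc _ _ _))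
    (fun c x y => ext fun k => by
      obtain ⟨p, hp⟩ := exists_rep x k
      obtain ⟨q, hq⟩ := exists_rep y (modulus V p k)
      have hb := fun t (ht : t ∈ powIdeal V (modulus V p k)) => modulus_spec p k ht
      have h := hp.mul hb (hq.smul c)
      exact h.eq ((hp.mul hb hq).smul c) (mul_smul_comm _ _ _))

/-- The canonical homomorphism from `R` to its completion. -/
def of (V : Submodule ℂ R) [LeftContinuous V] : R →ₐ[ℂ] InvLim V :=
  AlgHom.ofLinearMap
    { toFun := fun p => ofReps (fun _ => p) (fun i k _ => by simp)
      map_add' := fun _ _ => rfl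
      map_smul' := fun _ _ => rfl }
    rfl
    (fun p q => ext fun k => by
      have h : Rep (ofReps (V := V) (fun _ => p) (fun i k _ => by simp) *
          ofReps (V := V) (fun _ => q) (fun i k _ => by simp)) k (p * q) :=
        Rep.mul (b := modulus V p k) rfl (fun t ht => modulus_spec p k ht) rfl
      exact h)

theorem rep_of (p : R) (k : ℕ) : Rep (of V p) k p := rfl

/-- Elements of the completion which modulo every `V ^ k R` are represented in the
subalgebra `S`: the closure of `S` in the completion. -/
def closure (V : Submodule ℂ R) [LeftContinuous V] (S : Subalgebra ℂ R) :
    Subalgebra ℂ (InvLim V) where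
  carrier := {x | ∀ k, ∃ p ∈ S, Rep x k p}
  mul_mem' {x y} hx hy := fun k => by
    obtain ⟨p, hpS, hp⟩ := hx k
    obtain ⟨q, hqS, hq⟩ := hy (modulus V p k)
    exact ⟨p * q, mul_mem hpS hqS, hp.mul (fun z hz => modulus_spec _ _ hz) hq⟩
  add_mem' {x y} hx hy := fun k => by
    obtain ⟨p, hpS, hp⟩ := hx k
    obtain ⟨q, hqS, hq⟩ := hy k
    exact ⟨p + q, add_mem hpS hqS, hp.add hq⟩
  algebraMap_mem' c := fun k =>
    ⟨algebraMap ℂ R c, S.algebraMap_mem c, by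
      rw [← AlgHom.commutes (of V) c]; exact rep_of _ _⟩


variable [LeftContinuous V']

/-- Functoriality of the completion. -/
def map (φ : R →ₐ[ℂ] R') (h : ∀ x ∈ V, φ x ∈ V') : InvLim V →ₐ[ℂ] InvLim V' :=
  AlgHom.ofLinearMap (mapLin φ h)
    (ext fun k => by
      have h1 := (rep_one (V := V) k).map φ h
      exact h1.eq (rep_one k) (map_one φ))
    (fun x y => ext fun k => by
      obtain ⟨p, hp⟩ := exists_rep x k
      obtain ⟨q, hq⟩ := exists_rep y (max (modulus V p k) (modulus V' (φ p) k))
      have h1 := (hp.mul (fun t ht => modulus_spec p k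
        (powIdeal_antitone V (le_max_left _ _) ht)) hq).map φ h
      exact h1.eq ((hp.map φ h).mul (fun t ht => modulus_spec (φ p) k
        (powIdeal_antitone V' (le_max_right _ _) ht)) (hq.map φ h)) (map_mul φ _ _))

end InvLim

end Completion

/-! ### Tensor products over noncommutative rings -/

section Balanced

variable {R S : Type*} [Ring R] [Ring S] (φ : R →+* S) (U : Type*) [AddCommGroup U] [Module R U]

/-- The relations `s φ(r) ⊗ u = s ⊗ r u` defining `S ⊗_R U`. -/
def balancedRel : Submodule S (S ⊗[ℤ] U) :=
  Submodule.span S {t | ∃ (s : S) (r : R) (u : U), t = (s * φ r) ⊗ₜ[ℤ] u - s ⊗ₜ[ℤ] (r • u)}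

/-- The left `S`-module `S ⊗_R U`, for a left `R`-module `U` and a ring homomorphism
`φ : R → S`. -/
abbrev BalancedTensor : Type _ := (S ⊗[ℤ] U) ⧸ balancedRel φ U

/-- The element `1 ⊗ u` of `S ⊗_R U`. -/
def oneTensor (u : U) : BalancedTensor φ U :=
  Submodule.Quotient.mk ((1 : S) ⊗ₜ[ℤ] u)

end Balanced

/-! ### Enveloping algebras -/

section Enveloping

variable {𝔤 : Type*} [LieRing 𝔤] [LieAlgebra ℂ 𝔤] (𝔞 𝔫 : LieSubalgebra ℂ 𝔤)

/-- The universal enveloping algebra `U(𝔤)`. -/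
abbrev UEnv (𝔤 : Type*) [LieRing 𝔤] [LieAlgebra ℂ 𝔤] : Type _ := UniversalEnvelopingAlgebra ℂ 𝔤

section Iota

attribute [local instance 100] LieRing.ofAssociativeRing

/-- The canonical map `𝔤 → U(𝔤)`. -/
def iota : 𝔤 →ₗ[ℂ] UEnv 𝔤 := (UniversalEnvelopingAlgebra.ι ℂ : 𝔤 →ₗ⁅ℂ⁆ UEnv 𝔤).toLinearMap

theorem iota_lie (X Y : 𝔤) : iota ⁅X, Y⁆ = iota X * iota Y - iota Y * iota X :=
  LieHom.map_lie (UniversalEnvelopingAlgebra.ι ℂ : 𝔤 →ₗ⁅ℂ⁆ UEnv 𝔤) X Y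

theorem adjoin_iota : Algebra.adjoin ℂ (Set.range (iota (𝔤 := 𝔤))) = ⊤ := by
  let S : Subalgebra ℂ (UEnv 𝔤) := Algebra.adjoin ℂ (Set.range (iota (𝔤 := 𝔤)))
  have h0 : ∀ X : 𝔤, iota X ∈ S := fun X => Algebra.subset_adjoin (Set.mem_range_self X)
  let f : 𝔤 →ₗ⁅ℂ⁆ ↥S :=
    { toFun := fun X => ⟨iota X, h0 X⟩
      map_add' := fun X Y => Subtype.ext (map_add _ X Y)
      map_smul' := fun c X => Subtype.ext (map_smul _ c X)
      map_lie' := fun {X Y} => Subtype.ext (iota_lie X Y) }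
  have h : S.val.comp (UniversalEnvelopingAlgebra.lift ℂ f) = AlgHom.id ℂ (UEnv 𝔤) := by
    apply UniversalEnvelopingAlgebra.hom_ext
    ext X
    change ((UniversalEnvelopingAlgebra.lift ℂ f (UniversalEnvelopingAlgebra.ι ℂ X) : S) :
      UEnv 𝔤) = UniversalEnvelopingAlgebra.ι ℂ X
    rw [UniversalEnvelopingAlgebra.lift_ι_apply]
    rfl
  refine eq_top_iff.2 fun p _ => ?_
  have hp := congrArg (fun g : UEnv 𝔤 →ₐ[ℂ] UEnv 𝔤 => g p) h
  have hp' : ((UniversalEnvelopingAlgebra.lift ℂ f p : S) : UEnv 𝔤) = p := hp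
  exact hp' ▸ (UniversalEnvelopingAlgebra.lift ℂ f p).2

end Iota

/-- The Lie subalgebra `𝔫` as a subspace of `U(𝔤)`. -/
def inUg : Submodule ℂ (UEnv 𝔤) := 𝔫.toSubmodule.map iota

/-- `U(𝔫)`, as the subalgebra of `U(𝔤)` generated by `𝔫` (by the Poincaré–Birkhoff–Witt theorem
this is the enveloping algebra of `𝔫`). -/
def Un : Subalgebra ℂ (UEnv 𝔤) := Algebra.adjoin ℂ (inUg 𝔫 : Set (UEnv 𝔤))

/-- The subspace `𝔫 U(𝔫)`. -/
def nUn : Submodule ℂ (UEnv 𝔤) := inUg 𝔫 * Subalgebra.toSubmodule (Un 𝔫)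

/-- The weight space `U(𝔤)_μ` for the action `H · P = H P - P H` of `𝔞` on `U(𝔤)`. -/
def wtUg (μ : Module.Dual ℂ 𝔞) : Submodule ℂ (UEnv 𝔤) where
  carrier := {P | ∀ H : 𝔞, iota (H : 𝔤) * P - P * iota (H : 𝔤) = μ H • P}
  add_mem' {P Q} hP hQ := fun H => by
    rw [smul_add, ← hP H, ← hQ H]; noncomm_ring
  zero_mem' := fun H => by simp
  smul_mem' c P hP := fun H => by
    rw [smul_comm, ← hP H, smul_sub, mul_smul_comm, smul_mul_assoc]

theorem one_mem_wtUg : (1 : UEnv 𝔤) ∈ wtUg 𝔞 0 := fun H => by simp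

theorem mul_mem_wtUg {μ ν : Module.Dual ℂ 𝔞} {P Q : UEnv 𝔤} (hP : P ∈ wtUg 𝔞 μ)
    (hQ : Q ∈ wtUg 𝔞 ν) : P * Q ∈ wtUg 𝔞 (μ + ν) := fun H => by
  have h1 := hP H
  have h2 := hQ H
  calc iota (H : 𝔤) * (P * Q) - P * Q * iota (H : 𝔤)
      = (iota (H : 𝔤) * P - P * iota (H : 𝔤)) * Q
        + P * (iota (H : 𝔤) * Q - Q * iota (H : 𝔤)) := by noncomm_ring
    _ = (μ + ν) H • (P * Q) := by
      rw [h1, h2, smul_mul_assoc, mul_smul_comm, LinearMap.add_apply, add_smul]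

variable (Λ : AddSubgroup (Module.Dual ℂ 𝔞))

/-- `U(𝔤)_Λ`: the elements whose weight components `P^{(μ)}` vanish for all `μ ∉ Λ`. -/
def UgΛ : Subalgebra ℂ (UEnv 𝔤) :=
  Submodule.toSubalgebra (⨆ μ : Λ, wtUg 𝔞 (μ : Module.Dual ℂ 𝔞))
    (Submodule.mem_iSup_of_mem (0 : Λ) (one_mem_wtUg 𝔞))
    (fun x y hx hy => by
      have h : (⨆ μ : Λ, wtUg 𝔞 (μ : Module.Dual ℂ 𝔞)) * (⨆ μ : Λ, wtUg 𝔞 (μ : Module.Dual ℂ 𝔞))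
          ≤ ⨆ μ : Λ, wtUg 𝔞 (μ : Module.Dual ℂ 𝔞) := by
        rw [Submodule.iSup_mul]
        refine iSup_le fun μ => ?_
        rw [Submodule.mul_iSup]
        refine iSup_le fun ν => Submodule.mul_le.2 fun P hP Q hQ => ?_
        exact Submodule.mem_iSup_of_mem (μ + ν) (mul_mem_wtUg 𝔞 hP hQ)
      exact h (Submodule.mul_mem_mul hx hy))

/-- `U(𝔫)_Λ`. -/
def UnΛ : Subalgebra ℂ (UEnv 𝔤) := Un 𝔫 ⊓ UgΛ 𝔞 Λ

theorem UnΛ_le : UnΛ 𝔞 𝔫 Λ ≤ UgΛ 𝔞 Λ := inf_le_right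

/-- `(𝔫 U(𝔫))_Λ = 𝔫 U(𝔫) ∩ U(𝔫)_Λ`. -/
def nUnΛ : Submodule ℂ (UEnv 𝔤) := nUn 𝔫 ⊓ Subalgebra.toSubmodule (UnΛ 𝔞 𝔫 Λ)

/-- Elements of an abelian `𝔞` have weight `0`, hence lie in `U(𝔤)_Λ`. -/
theorem iota_mem_UgΛ [IsLieAbelian 𝔞] (H : 𝔞) : iota (H : 𝔤) ∈ UgΛ 𝔞 Λ :=
  Submodule.mem_iSup_of_mem (0 : Λ) fun H' => by
    have h : ⁅(H' : 𝔤), (H : 𝔤)⁆ = 0 := by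
      rw [← LieSubalgebra.coe_bracket, trivial_lie_zero]; rfl
    rw [← iota_lie, h]
    simp

/-- `H ∈ 𝔞` as an element of `U(𝔤)_Λ`. -/
def aToUgΛ [IsLieAbelian 𝔞] (H : 𝔞) : UgΛ 𝔞 Λ := ⟨iota (H : 𝔤), iota_mem_UgΛ 𝔞 Λ H⟩

/-! ### Completions -/

/-- `𝔫` as a subspace of `U(𝔫)`. -/
def inUn : Submodule ℂ (Un 𝔫) := (inUg 𝔫).comap (Un 𝔫).val.toLinearMap

instance : LeftContinuous (inUn 𝔫) where
  cont := fun p k => ⟨k, by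
    obtain ⟨p, hp⟩ := p
    refine Algebra.adjoin_induction
      (p := fun p hp => ∀ x ∈ powIdeal (inUn 𝔫) k, (⟨p, hp⟩ : Un 𝔫) * x ∈ powIdeal (inUn 𝔫) k)
      ?_ ?_ ?_ ?_ hp
    · intro Y hY x hx
      refine powIdeal_antitone _ (Nat.le_succ k) ?_
      rw [powIdeal_succ]
      exact Submodule.mul_mem_mul hY hx
    · intro c x hx
      have h : (⟨algebraMap ℂ (UEnv 𝔤) c, (Un 𝔫).algebraMap_mem c⟩ : Un 𝔫) * x = c • x := by
        rw [Algebra.smul_def]; rfl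
      exact h ▸ Submodule.smul_mem _ c hx
    · intro P Q hP hQ ihP ihQ x hx
      have h : (⟨P + Q, add_mem hP hQ⟩ : Un 𝔫) * x = ⟨P, hP⟩ * x + ⟨Q, hQ⟩ * x := by
        rw [← add_mul]; rfl
      exact h ▸ add_mem (ihP x hx) (ihQ x hx)
    · intro P Q hP hQ ihP ihQ x hx
      have h : (⟨P * Q, mul_mem hP hQ⟩ : Un 𝔫) * x = ⟨P, hP⟩ * (⟨Q, hQ⟩ * x) := by
        rw [← mul_assoc]; rfl
      exact h ▸ ihP _ (ihQ x hx)⟩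

/-- `X` is annihilated by every `d`-fold bracket with elements of `𝔫`. -/
def NilDepth : ℕ → 𝔤 → Prop
  | 0, X => X = 0
  | d + 1, X => ∀ Y ∈ 𝔫, NilDepth d ⁅Y, X⁆

theorem NilDepth.zero : ∀ d : ℕ, NilDepth 𝔫 d 0
  | 0 => rfl
  | d + 1 => fun Y _ => by rw [lie_zero]; exact NilDepth.zero d

theorem NilDepth.add : ∀ {d : ℕ} {X X' : 𝔤}, NilDepth 𝔫 d X → NilDepth 𝔫 d X' →
    NilDepth 𝔫 d (X + X')
  | 0, X, X', h, h' => by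
    rw [NilDepth] at h h' ⊢
    rw [h, h', add_zero]
  | d + 1, X, X', h, h' => fun Y hY => by
    rw [lie_add]; exact NilDepth.add (h Y hY) (h' Y hY)

theorem NilDepth.succ : ∀ {d : ℕ} {X : 𝔤}, NilDepth 𝔫 d X → NilDepth 𝔫 (d + 1) X
  | 0, X, h => fun Y _ => by
    rw [NilDepth] at h
    rw [h, lie_zero]; exact NilDepth.zero 𝔫 0
  | d + 1, X, h => fun Y hY => NilDepth.succ (h Y hY)

theorem NilDepth.mono {d d' : ℕ} {X : 𝔤} (h : NilDepth 𝔫 d X) (hd : d ≤ d') :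
    NilDepth 𝔫 d' X := by
  induction hd with
  | refl => exact h
  | step _ ih => exact NilDepth.succ 𝔫 ih

/-- The adjoint action of `𝔫` on `𝔤` is locally nilpotent. -/
class AdNilpotent : Prop where
  exists_depth : ∀ X : 𝔤, ∃ d, NilDepth 𝔫 d X

theorem NilDepth.mul_mem : ∀ (d : ℕ) (X : 𝔤), NilDepth 𝔫 d X → ∀ (k : ℕ),
    ∀ x ∈ powIdeal (inUg 𝔫) (k + d), iota X * x ∈ powIdeal (inUg 𝔫) k
  | 0, X, hX, k => fun x hx => by
    rw [NilDepth] at hX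
    subst hX
    simp
  | d + 1, X, hX, 0 => fun x hx => by rw [powIdeal_zero]; trivial
  | d + 1, X, hX, k + 1 => fun x hx => by
    have h1 : k + 1 + (d + 1) = (k + (d + 1)) + 1 := by omega
    rw [h1, powIdeal_succ] at hx
    refine Submodule.mul_induction_on hx ?_ ?_
    · rintro _ ⟨Y, hY, rfl⟩ z hz
      have h2 := NilDepth.mul_mem (d + 1) X hX k z hz
      have h3 := NilDepth.mul_mem d _ (hX Y hY) (k + 1) z
        (powIdeal_antitone _ (by omega) hz)
      have h4 : iota X * (iota Y * z) = iota Y * (iota X * z) - iota ⁅Y, X⁆ * z := by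
        have h5 : iota ⁅Y, X⁆ = iota Y * iota X - iota X * iota Y := iota_lie Y X
        rw [h5]; noncomm_ring
      have h6 : iota X * (iota Y * z) ∈ powIdeal (inUg 𝔫) (k + 1) := by
        rw [h4]
        refine sub_mem ?_ h3
        rw [powIdeal_succ]
        exact Submodule.mul_mem_mul ⟨Y, hY, rfl⟩ h2
      exact h6
    · intro x y hx hy
      rw [mul_add]
      exact add_mem hx hy

instance [AdNilpotent 𝔫] : LeftContinuous (inUg 𝔫) where
  cont := fun p => by
    have hp : p ∈ Algebra.adjoin ℂ (Set.range (iota (𝔤 := 𝔤))) := by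
      rw [adjoin_iota]; exact Algebra.mem_top
    refine Algebra.adjoin_induction
      (p := fun p _ => ∀ k, ∃ b, ∀ x ∈ powIdeal (inUg 𝔫) b, p * x ∈ powIdeal (inUg 𝔫) k)
      ?_ ?_ ?_ ?_ hp
    · rintro _ ⟨X, rfl⟩ k
      obtain ⟨d, hd⟩ := AdNilpotent.exists_depth (𝔫 := 𝔫) X
      exact ⟨k + d, NilDepth.mul_mem 𝔫 d X hd k⟩
    · intro c k
      refine ⟨k, fun x hx => ?_⟩
      rw [← Algebra.smul_def]
      exact Submodule.smul_mem _ c hx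
    · intro P Q _ _ ihP ihQ k
      obtain ⟨b, hb⟩ := ihP k
      obtain ⟨b', hb'⟩ := ihQ k
      refine ⟨max b b', fun x hx => ?_⟩
      rw [add_mul]
      exact add_mem (hb x (powIdeal_antitone _ (le_max_left _ _) hx))
        (hb' x (powIdeal_antitone _ (le_max_right _ _) hx))
    · intro P Q _ _ ihP ihQ k
      obtain ⟨b, hb⟩ := ihP k
      obtain ⟨b', hb'⟩ := ihQ b
      refine ⟨b', fun x hx => ?_⟩
      rw [mul_assoc]
      exact hb _ (hb' x hx)

/-- `Ê(𝔫) = lim U(𝔫) / 𝔫 ^ k U(𝔫)`. -/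
abbrev En : Type _ := InvLim (inUn 𝔫)

/-- The right ideal `𝔫 Ê(𝔫)`. -/
def nEn : Submodule ℂ (En 𝔫) := (inUn 𝔫).map (InvLim.of (inUn 𝔫)).toLinearMap * ⊤

/-- `Ê(𝔫)_Λ`: the elements of `Ê(𝔫)` all of whose weight components lie in weights of `Λ`, that is,
which modulo every `𝔫 ^ k U(𝔫)` are represented by an element of `U(𝔫)_Λ`. -/
def EnΛ : Subalgebra ℂ (En 𝔫) :=
  InvLim.closure (inUn 𝔫) ((UnΛ 𝔞 𝔫 Λ).comap (Un 𝔫).val)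

/-- `(𝔫 Ê(𝔫))_Λ = 𝔫 Ê(𝔫) ∩ Ê(𝔫)_Λ`. -/
def nEnΛ : Submodule ℂ (En 𝔫) := nEn 𝔫 ⊓ Subalgebra.toSubmodule (EnΛ 𝔞 𝔫 Λ)

variable [AdNilpotent 𝔫]

/-- The map `Ê(𝔫) → lim U(𝔤) / 𝔫 ^ k U(𝔤)`. -/
def EnToLim : En 𝔫 →ₐ[ℂ] InvLim (inUg 𝔫) := InvLim.map (Un 𝔫).val (fun _ hx => hx)

/-- The algebra `Ê(𝔤, 𝔫) = Ê(𝔫) ⊗_{U(𝔫)} U(𝔤)`, realised as the subalgebra `Ê(𝔫) U(𝔤)` of the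
complete algebra `lim U(𝔤) / 𝔫 ^ k U(𝔤)`: the map `f ⊗ u ↦ f u` is injective because `U(𝔤)` is a
free left `U(𝔫)`-module, and the product of `Ê(𝔫) ⊗_{U(𝔫)} U(𝔤)` is the continuous extension of the
one of `U(𝔤)`. -/
def Egn : Subalgebra ℂ (InvLim (inUg 𝔫)) := (EnToLim 𝔫).range ⊔ (InvLim.of (inUg 𝔫)).range

/-- `Ê(𝔤, 𝔫)_Λ`: the elements of `Ê(𝔤, 𝔫)` all of whose weight components lie in weights of `Λ`. -/
def EgnΛ : Subalgebra ℂ (InvLim (inUg 𝔫)) := Egn 𝔫 ⊓ InvLim.closure (inUg 𝔫) (UgΛ 𝔞 Λ)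

/-- The inclusion `U(𝔤)_Λ → Ê(𝔤, 𝔫)_Λ`. -/
def ofUgΛ : UgΛ 𝔞 Λ →ₐ[ℂ] EgnΛ 𝔞 𝔫 Λ :=
  AlgHom.codRestrict ((InvLim.of (inUg 𝔫)).comp (UgΛ 𝔞 Λ).val) _ fun x =>
    ⟨Algebra.mem_sup_right ⟨x, rfl⟩, fun _ => ⟨x, x.2, rfl⟩⟩

/-- The inclusion `U(𝔫)_Λ → Ê(𝔤, 𝔫)_Λ`. -/
def ofUnΛ : UnΛ 𝔞 𝔫 Λ →ₐ[ℂ] EgnΛ 𝔞 𝔫 Λ :=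
  (ofUgΛ 𝔞 𝔫 Λ).comp (Subalgebra.inclusion (UnΛ_le 𝔞 𝔫 Λ))

/-- The inclusion `Ê(𝔫)_Λ → Ê(𝔤, 𝔫)_Λ`. -/
def ofEnΛ : EnΛ 𝔞 𝔫 Λ →ₐ[ℂ] EgnΛ 𝔞 𝔫 Λ :=
  AlgHom.codRestrict ((EnToLim 𝔫).comp (EnΛ 𝔞 𝔫 Λ).val) _ fun x =>
    ⟨Algebra.mem_sup_left ⟨x, rfl⟩, fun k => by
      obtain ⟨p, hpS, hp⟩ := x.2 k
      exact ⟨(p : UEnv 𝔤), hpS.2, hp.map (Un 𝔫).val (fun _ hx => hx)⟩⟩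

/-- The module `Û = Ê(𝔤, 𝔫)_Λ ⊗_{U(𝔤)_Λ} U`. -/
abbrev Uhat (U : Type*) [AddCommGroup U] [Module (UgΛ 𝔞 Λ) U] : Type _ :=
  BalancedTensor (ofUgΛ 𝔞 𝔫 Λ).toRingHom U

/-- The canonical map `U → Û`, `u ↦ 1 ⊗ u`. -/
def toUhat {U : Type*} [AddCommGroup U] [Module (UgΛ 𝔞 Λ) U] (u : U) : Uhat 𝔞 𝔫 Λ U :=
  oneTensor (ofUgΛ 𝔞 𝔫 Λ).toRingHom U u

end Enveloping

/-! ### Real semisimple Lie algebras and restricted roots -/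

section Iwasawa

variable (𝔤₀ : Type*) [LieRing 𝔤₀] [LieAlgebra ℝ 𝔤₀]

/-- A Cartan involution `θ` of a real semisimple Lie algebra `𝔤₀`, together with a maximal abelian
subspace `𝔞₀` of the `-1` eigenspace `𝔰₀` of `θ`. -/
structure CartanData where
  /-- The Cartan involution. -/
  θ : 𝔤₀ ≃ₗ⁅ℝ⁆ 𝔤₀
  θ_involutive : ∀ X, θ (θ X) = X
  θ_cartan : ∀ X, X ≠ 0 → killingForm ℝ 𝔤₀ X (θ X) < 0
  /-- The maximal abelian subspace of `𝔰₀`. -/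
  𝔞₀ : Submodule ℝ 𝔤₀
  θ_𝔞₀ : ∀ X ∈ 𝔞₀, θ X = -X
  abelian : ∀ X ∈ 𝔞₀, ∀ Y ∈ 𝔞₀, ⁅X, Y⁆ = 0
  maximal : ∀ X, θ X = -X → (∀ Y ∈ 𝔞₀, ⁅X, Y⁆ = 0) → X ∈ 𝔞₀

/-- The complexification `𝔤` of `𝔤₀`. -/
def Complexification : Type _ := ℂ ⊗[ℝ] 𝔤₀

instance : LieRing (Complexification 𝔤₀) := inferInstanceAs (LieRing (ℂ ⊗[ℝ] 𝔤₀))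

instance : LieAlgebra ℂ (Complexification 𝔤₀) := inferInstanceAs (LieAlgebra ℂ (ℂ ⊗[ℝ] 𝔤₀))

instance [FiniteDimensional ℝ 𝔤₀] : FiniteDimensional ℂ (Complexification 𝔤₀) :=
  inferInstanceAs (FiniteDimensional ℂ (ℂ ⊗[ℝ] 𝔤₀))

variable {𝔤₀}

namespace CartanData

variable (C : CartanData 𝔤₀)

/-- The complexification `𝔞` of `𝔞₀`, as a subspace of `𝔤`. -/
def aSubmodule : Submodule ℂ (Complexification 𝔤₀) := C.𝔞₀.baseChange ℂ

theorem lie_aSubmodule {X Y : Complexification 𝔤₀} (hX : X ∈ C.aSubmodule)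
    (hY : Y ∈ C.aSubmodule) : ⁅X, Y⁆ = 0 := by
  have hspan : C.aSubmodule = Submodule.span ℂ
      ((fun x : 𝔤₀ => ((1 : ℂ) ⊗ₜ[ℝ] x : ℂ ⊗[ℝ] 𝔤₀)) '' C.𝔞₀ : Set (Complexification 𝔤₀)) :=
    Submodule.baseChange_eq_span ..
  rw [hspan] at hX hY
  induction hX using Submodule.span_induction with
  | zero => exact zero_lie Y
  | add X X' _ _ h h' => rw [add_lie, h, h', add_zero]
  | smul c X _ h => rw [smul_lie, h, smul_zero]
  | mem X hX =>
    induction hY using Submodule.span_induction with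
    | zero => exact lie_zero _
    | add Y Y' _ _ h h' => rw [lie_add, h, h', add_zero]
    | smul c Y _ h => rw [lie_smul, h, smul_zero]
    | mem Y hY =>
      obtain ⟨x, hx, rfl⟩ := hX
      obtain ⟨y, hy, rfl⟩ := hY
      refine (LieAlgebra.ExtendScalars.bracket_tmul ℝ ℂ 𝔤₀ 𝔤₀ 1 1 x y).trans ?_
      rw [C.abelian x hx y hy, TensorProduct.tmul_zero]
      rfl

/-- The complexification `𝔞` of `𝔞₀`, as a Lie subalgebra of `𝔤`. -/
def 𝔞 : LieSubalgebra ℂ (Complexification 𝔤₀) where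
  toSubmodule := C.aSubmodule
  lie_mem' {X Y} hX hY := by
    have h : ⁅X, Y⁆ = 0 := C.lie_aSubmodule hX hY
    rw [h]
    exact Submodule.zero_mem _

instance : IsLieAbelian C.𝔞 where
  trivial X Y := Subtype.ext (C.lie_aSubmodule X.2 Y.2)

/-- The restricted root space `𝔤_α` (the `α`-weight space of `𝔞` on `𝔤`), for `α ∈ 𝔞^*`. -/
def rootSpace (α : Module.Dual ℂ C.𝔞) : Submodule ℂ (Complexification 𝔤₀) where
  carrier := {X | ∀ H : C.𝔞, ⁅(H : Complexification 𝔤₀), X⁆ = α H • X}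
  add_mem' {X Y} hX hY := fun H => by rw [lie_add, hX H, hY H, smul_add]
  zero_mem' := fun H => by simp
  smul_mem' c X hX := fun H => by rw [lie_smul, hX H, smul_comm]

theorem lie_mem_rootSpace {α β : Module.Dual ℂ C.𝔞} {X Y : Complexification 𝔤₀}
    (hX : X ∈ C.rootSpace α) (hY : Y ∈ C.rootSpace β) : ⁅X, Y⁆ ∈ C.rootSpace (α + β) := fun H => by
  have h1 := hX H
  have h2 := hY H
  rw [leibniz_lie, h1, h2, smul_lie, lie_smul, LinearMap.add_apply, add_smul]

/-- The restricted root system `Σ`. -/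
def roots : Set (Module.Dual ℂ C.𝔞) := {α | α ≠ 0 ∧ C.rootSpace α ≠ ⊥}

end CartanData

/-- An enumerated system of simple roots `α_1, …, α_l` of the restricted root system: a basis of
`𝔞^*` consisting of roots such that every root is a combination of the `α_i` with
integer coefficients which are all nonnegative or all nonpositive. -/
structure SimpleSystem (C : CartanData 𝔤₀) where
  /-- The number of simple roots. -/
  l : ℕ
  /-- The simple roots. -/
  simple : Module.Basis (Fin l) ℂ (Module.Dual ℂ C.𝔞)
  simple_mem : ∀ i, simple i ∈ C.roots
  pos_or_neg : ∀ α ∈ C.roots,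
    (∃ c : Fin l → ℕ, α = ∑ i, c i • simple i) ∨ (∃ c : Fin l → ℕ, α = -∑ i, c i • simple i)

namespace SimpleSystem

variable {C : CartanData 𝔤₀} (S : SimpleSystem C)

/-- The positive system `Σ⁺` with the given simple roots. -/
def posRoots : Set (Module.Dual ℂ C.𝔞) :=
  {α | α ∈ C.roots ∧ ∃ c : Fin S.l → ℕ, α = ∑ i, c i • S.simple i}

/-- The lattice `𝒫` of integral combinations of positive roots. -/
def latticeP : AddSubgroup (Module.Dual ℂ C.𝔞) := AddSubgroup.closure S.posRoots

/-- The cone `𝒫⁺` of combinations of positive roots with nonnegative integral coefficients. -/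
def coneP : AddSubmonoid (Module.Dual ℂ C.𝔞) := AddSubmonoid.closure S.posRoots

/-- `Re λ ∈ 𝔞₀^*`, written in coordinates with respect to the simple roots; the total order of
`𝔞₀^*` is the lexicographic order of these coordinates. -/
def reLex (lam : Module.Dual ℂ C.𝔞) : Lex (Fin S.l → ℝ) :=
  toLex fun i => (S.simple.repr lam i).re

/-- The real part of the sum of the coordinates with respect to the simple roots. -/
def height : Module.Dual ℂ C.𝔞 →+ ℝ where
  toFun lam := ∑ i, (S.simple.repr lam i).re
  map_zero' := by simp
  map_add' x y := by simp [Finset.sum_add_distrib]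

theorem height_sum (c : Fin S.l → ℕ) :
    S.height (∑ i, c i • S.simple i) = ∑ i, (c i : ℝ) := by
  simp only [map_sum, map_nsmul]
  refine Finset.sum_congr rfl fun i _ => ?_
  have h : S.height (S.simple i) = 1 := by
    simp only [height, AddMonoidHom.coe_mk, ZeroHom.coe_mk, Module.Basis.repr_self]
    rw [Finset.sum_eq_single i]
    · simp
    · intro j _ hj
      rw [Finsupp.single_eq_of_ne hj]; simp
    · simp
  rw [h]; simp

theorem one_le_height {α : Module.Dual ℂ C.𝔞} (hα : α ∈ S.posRoots) : 1 ≤ S.height α := by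
  obtain ⟨⟨hα0, _⟩, c, rfl⟩ := hα
  rw [height_sum, ← Nat.cast_sum, Nat.one_le_cast, Nat.one_le_iff_ne_zero]
  intro h
  refine hα0 (Finset.sum_eq_zero fun i hi => ?_)
  rw [Finset.sum_eq_zero_iff.1 h i hi, zero_smul]

theorem add_mem_posRoots {α β : Module.Dual ℂ C.𝔞} (hα : α ∈ S.posRoots) (hβ : β ∈ S.posRoots)
    (h : C.rootSpace (α + β) ≠ ⊥) : α + β ∈ S.posRoots := by
  refine ⟨⟨fun h0 => ?_, h⟩, ?_⟩
  · have h1 := S.one_le_height hα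
    have h2 := S.one_le_height hβ
    have h3 : S.height (α + β) = 0 := by rw [h0, map_zero]
    rw [map_add] at h3
    linarith
  · obtain ⟨_, c, rfl⟩ := hα
    obtain ⟨_, d, rfl⟩ := hβ
    exact ⟨c + d, by simp [add_smul, Finset.sum_add_distrib]⟩

/-- `𝔫 = ⨁_{α ∈ Σ⁺} 𝔤_α`. -/
def 𝔫 : LieSubalgebra ℂ (Complexification 𝔤₀) where
  toSubmodule := ⨆ α : S.posRoots, C.rootSpace α
  lie_mem' {X Y} hX hY := by
    refine Submodule.iSup_induction (fun α : S.posRoots => C.rootSpace α)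
      (motive := fun X => ⁅X, Y⁆ ∈ ⨆ α : S.posRoots, C.rootSpace α) hX ?_ ?_ ?_
    · intro α X hX
      refine Submodule.iSup_induction (fun α : S.posRoots => C.rootSpace α)
        (motive := fun Y => ⁅X, Y⁆ ∈ ⨆ α : S.posRoots, C.rootSpace α) hY ?_ ?_ ?_
      · intro β Y hY
        have h := C.lie_mem_rootSpace hX hY
        by_cases h0 : C.rootSpace (α + β : Module.Dual ℂ C.𝔞) = ⊥
        · rw [h0, Submodule.mem_bot] at h
          rw [h]
          exact Submodule.zero_mem _
        · exact Submodule.mem_iSup_of_mem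
            (⟨(α + β : Module.Dual ℂ C.𝔞), S.add_mem_posRoots α.2 β.2 h0⟩ : S.posRoots) h
      · rw [lie_zero]; exact Submodule.zero_mem _
      · intro Y Y' h h'
        rw [lie_add]; exact Submodule.add_mem _ h h'
    · rw [zero_lie]; exact Submodule.zero_mem _
    · intro X X' h h'
      rw [add_lie]; exact Submodule.add_mem _ h h'

theorem lie_mem_𝔫 (H : C.𝔞) {X : Complexification 𝔤₀} (hX : X ∈ S.𝔫) :
    ⁅(H : Complexification 𝔤₀), X⁆ ∈ S.𝔫 := by
  have h : S.𝔫.toSubmodule ≤ S.𝔫.toSubmodule.comap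
      (LieModule.toEnd ℂ (Complexification 𝔤₀) (Complexification 𝔤₀) (H : Complexification 𝔤₀)) := by
    refine iSup_le fun α X hX => ?_
    have hX' : ⁅(H : Complexification 𝔤₀), X⁆ = (α : Module.Dual ℂ C.𝔞) H • X := hX H
    change ⁅(H : Complexification 𝔤₀), X⁆ ∈ S.𝔫.toSubmodule
    rw [hX']
    exact Submodule.smul_mem _ _ (Submodule.mem_iSup_of_mem α hX)
  exact h hX

theorem nilDepth_of_height (B : ℝ) (hB : ∀ χ : Module.Dual ℂ C.𝔞,
    LieModule.genWeightSpace (Complexification 𝔤₀) (χ : C.𝔞 → ℂ) ≠ ⊥ → S.height χ ≤ B) :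
    ∀ (d : ℕ) (χ : Module.Dual ℂ C.𝔞), B < S.height χ + d →
      ∀ X ∈ LieModule.genWeightSpace (Complexification 𝔤₀) (χ : C.𝔞 → ℂ), NilDepth S.𝔫 d X
  | 0, χ, h, X, hX => by
    by_cases h0 : LieModule.genWeightSpace (Complexification 𝔤₀) (χ : C.𝔞 → ℂ) = ⊥
    · rw [h0, LieSubmodule.mem_bot] at hX
      exact hX
    · have := hB χ h0
      rw [Nat.cast_zero] at h
      linarith
  | d + 1, χ, h, X, hX => fun Y hY => by
    refine Submodule.iSup_induction (fun α : S.posRoots => C.rootSpace α)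
      (motive := fun Y => NilDepth S.𝔫 d ⁅Y, X⁆) hY ?_ ?_ ?_
    · intro β Y hY
      refine nilDepth_of_height B hB d (β + χ) ?_ _ ?_
      · have := S.one_le_height β.2
        rw [map_add]
        push_cast at h
        linarith
      · refine LieAlgebra.lie_mem_genWeightSpace_of_mem_genWeightSpace
          (χ₁ := (β : Module.Dual ℂ C.𝔞)) (LieModule.weightSpace_le_genWeightSpace _ _ ?_) hX
        rw [LieModule.mem_weightSpace]
        exact hY
    · rw [zero_lie]; exact NilDepth.zero _ _
    · intro Y Y' h h'
      rw [add_lie]; exact h.add _ h'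

instance [FiniteDimensional ℝ 𝔤₀] : AdNilpotent S.𝔫 where
  exists_depth := by
    have hfin : {χ : Module.Dual ℂ C.𝔞 |
        LieModule.genWeightSpace (Complexification 𝔤₀) (χ : C.𝔞 → ℂ) ≠ ⊥}.Finite :=
      (LieModule.finite_genWeightSpace_ne_bot ℂ C.𝔞 (Complexification 𝔤₀)).preimage
        (DFunLike.coe_injective.injOn)
    obtain ⟨B, hB⟩ := (hfin.image S.height).bddAbove
    have hB' : ∀ χ : Module.Dual ℂ C.𝔞, LieModule.genWeightSpace (Complexification 𝔤₀)
        (χ : C.𝔞 → ℂ) ≠ ⊥ → S.height χ ≤ B := fun χ hχ => hB ⟨χ, hχ, rfl⟩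
    intro X
    have hX : X ∈ ⨆ χ : LieModule.Weight ℂ C.𝔞 (Complexification 𝔤₀),
        (LieModule.genWeightSpace (Complexification 𝔤₀) χ).toSubmodule := by
      rw [← LieSubmodule.iSup_toSubmodule, LieModule.iSup_genWeightSpace_eq_top']
      trivial
    refine Submodule.iSup_induction _ (motive := fun X => ∃ d, NilDepth S.𝔫 d X) hX ?_ ?_ ?_
    · intro χ X hX
      obtain ⟨d, hd⟩ := exists_nat_gt (B - S.height (LieModule.Weight.toLinear ℂ C.𝔞 _ χ))
      exact ⟨d, S.nilDepth_of_height B hB' d (LieModule.Weight.toLinear ℂ C.𝔞 _ χ)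
        (by linarith) X hX⟩
    · exact ⟨0, rfl⟩
    · rintro X Y ⟨d, hd⟩ ⟨d', hd'⟩
      exact ⟨max d d', (hd.mono _ (le_max_left _ _)).add _ (hd'.mono _ (le_max_right _ _))⟩

end SimpleSystem

end Iwasawa

/-! ### The quotient `Ū = U / (𝔫 U(𝔫))_Λ U` -/

section Quotient

variable {𝔤 : Type*} [LieRing 𝔤] [LieAlgebra ℂ 𝔤] (𝔞 𝔫 : LieSubalgebra ℂ 𝔤)

/-- `[𝔞, 𝔫] ⊆ 𝔫`. -/
class Normalizes : Prop where
  lie_mem : ∀ H ∈ 𝔞, ∀ X ∈ 𝔫, ⁅H, X⁆ ∈ 𝔫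

variable [Normalizes 𝔞 𝔫]

theorem commutator_mem_inUg (H : 𝔞) {Y : UEnv 𝔤} (hY : Y ∈ inUg 𝔫) :
    iota (H : 𝔤) * Y - Y * iota (H : 𝔤) ∈ inUg 𝔫 := by
  obtain ⟨X, hX, rfl⟩ := hY
  exact ⟨⁅(H : 𝔤), X⁆, Normalizes.lie_mem (H : 𝔤) H.2 X hX, iota_lie _ _⟩

theorem commutator_mem_Un (H : 𝔞) {P : UEnv 𝔤} (hP : P ∈ Un 𝔫) :
    iota (H : 𝔤) * P - P * iota (H : 𝔤) ∈ Un 𝔫 := by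
  refine Algebra.adjoin_induction
    (p := fun P _ => iota (H : 𝔤) * P - P * iota (H : 𝔤) ∈ Un 𝔫) ?_ ?_ ?_ ?_ hP
  · intro Y hY
    exact Algebra.subset_adjoin (commutator_mem_inUg 𝔞 𝔫 H hY)
  · intro c
    rw [Algebra.commutes, sub_self]
    exact zero_mem _
  · intro P Q _ _ ihP ihQ
    have h : iota (H : 𝔤) * (P + Q) - (P + Q) * iota (H : 𝔤) =
        (iota (H : 𝔤) * P - P * iota (H : 𝔤)) + (iota (H : 𝔤) * Q - Q * iota (H : 𝔤)) := by
      noncomm_ring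
    rw [h]; exact add_mem ihP ihQ
  · intro P Q hP hQ ihP ihQ
    have h : iota (H : 𝔤) * (P * Q) - (P * Q) * iota (H : 𝔤) =
        (iota (H : 𝔤) * P - P * iota (H : 𝔤)) * Q
          + P * (iota (H : 𝔤) * Q - Q * iota (H : 𝔤)) := by
      noncomm_ring
    rw [h]; exact add_mem (mul_mem ihP hQ) (mul_mem hP ihQ)

theorem commutator_mem_nUn (H : 𝔞) {P : UEnv 𝔤} (hP : P ∈ nUn 𝔫) :
    iota (H : 𝔤) * P - P * iota (H : 𝔤) ∈ nUn 𝔫 := by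
  refine Submodule.mul_induction_on hP ?_ ?_
  · intro Y hY Q hQ
    have h : iota (H : 𝔤) * (Y * Q) - (Y * Q) * iota (H : 𝔤) =
        (iota (H : 𝔤) * Y - Y * iota (H : 𝔤)) * Q
          + Y * (iota (H : 𝔤) * Q - Q * iota (H : 𝔤)) := by
      noncomm_ring
    rw [h]
    exact add_mem (Submodule.mul_mem_mul (commutator_mem_inUg 𝔞 𝔫 H hY) hQ)
      (Submodule.mul_mem_mul hY (commutator_mem_Un 𝔞 𝔫 H hQ))
  · intro P Q ihP ihQ
    have h : iota (H : 𝔤) * (P + Q) - (P + Q) * iota (H : 𝔤) =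
        (iota (H : 𝔤) * P - P * iota (H : 𝔤)) + (iota (H : 𝔤) * Q - Q * iota (H : 𝔤)) := by
      noncomm_ring
    rw [h]; exact add_mem ihP ihQ

variable [IsLieAbelian 𝔞] (Λ : AddSubgroup (Module.Dual ℂ 𝔞))

theorem commutator_mem_nUnΛ (H : 𝔞) {P : UEnv 𝔤} (hP : P ∈ nUnΛ 𝔞 𝔫 Λ) :
    iota (H : 𝔤) * P - P * iota (H : 𝔤) ∈ nUnΛ 𝔞 𝔫 Λ :=
  ⟨commutator_mem_nUn 𝔞 𝔫 H hP.1, commutator_mem_Un 𝔞 𝔫 H hP.2.1,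
    sub_mem (mul_mem (iota_mem_UgΛ 𝔞 Λ H) hP.2.2) (mul_mem hP.2.2 (iota_mem_UgΛ 𝔞 Λ H))⟩

variable (U : Type*) [AddCommGroup U] [Module (UgΛ 𝔞 Λ) U] [Module ℂ U]

/-- The subspace `(𝔫 U(𝔫))_Λ U` of a `U(𝔤)_Λ`-module `U`. -/
def nUnΛU : Submodule ℂ U :=
  Submodule.span ℂ {y | ∃ (P : UgΛ 𝔞 Λ) (x : U), (P : UEnv 𝔤) ∈ nUnΛ 𝔞 𝔫 Λ ∧ y = P • x}

/-- `Ū = U / (𝔫 U(𝔫))_Λ U`. -/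
abbrev Ubar : Type _ := U ⧸ nUnΛU 𝔞 𝔫 Λ U

variable [IsScalarTower ℂ (UgΛ 𝔞 Λ) U]

theorem nUnΛU_stable (H : 𝔞) :
    nUnΛU 𝔞 𝔫 Λ U ≤ (nUnΛU 𝔞 𝔫 Λ U).comap (Algebra.lsmul ℂ ℂ U (aToUgΛ 𝔞 Λ H)) := by
  refine Submodule.span_le.2 ?_
  rintro _ ⟨P, x, hP, rfl⟩
  have hQ := commutator_mem_nUnΛ 𝔞 𝔫 Λ H hP
  have h : aToUgΛ 𝔞 Λ H • (P • x) =
      (⟨iota (H : 𝔤) * P - P * iota (H : 𝔤), hQ.2.2⟩ : UgΛ 𝔞 Λ) • x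
        + P • (aToUgΛ 𝔞 Λ H • x) := by
    rw [smul_smul, smul_smul, ← add_smul]
    congr 1
    refine Subtype.ext ?_
    change iota (H : 𝔤) * (P : UEnv 𝔤) =
      (iota (H : 𝔤) * (P : UEnv 𝔤) - (P : UEnv 𝔤) * iota (H : 𝔤)) + (P : UEnv 𝔤) * iota (H : 𝔤)
    noncomm_ring
  change aToUgΛ 𝔞 Λ H • (P • x) ∈ nUnΛU 𝔞 𝔫 Λ U
  rw [h]
  exact add_mem (Submodule.subset_span ⟨_, _, hQ, rfl⟩) (Submodule.subset_span ⟨_, _, hP, rfl⟩)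

/-- The action of `H ∈ 𝔞` on `Ū` induced by that on `U`. -/
def aBar (H : 𝔞) : Ubar 𝔞 𝔫 Λ U →ₗ[ℂ] Ubar 𝔞 𝔫 Λ U :=
  Submodule.mapQ _ _ (Algebra.lsmul ℂ ℂ U (aToUgΛ 𝔞 Λ H)) (nUnΛU_stable 𝔞 𝔫 Λ U H)

end Quotient

namespace SimpleSystem

variable {𝔤₀ : Type*} [LieRing 𝔤₀] [LieAlgebra ℝ 𝔤₀] {C : CartanData 𝔤₀} (S : SimpleSystem C)

instance : Normalizes C.𝔞 S.𝔫 where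
  lie_mem H hH _ hX := S.lie_mem_𝔫 ⟨H, hH⟩ hX

variable (Λ : AddSubgroup (Module.Dual ℂ C.𝔞))

/-- `Λ⁺ = Λ ∩ 𝒫⁺`. -/
def posPart : Set (Module.Dual ℂ C.𝔞) := {μ | μ ∈ Λ ∧ μ ∈ S.coneP}

/-- The constant data attached to elements `u_1, …, u_N` of `U`: the eigenvalues
`Re λ_1 ≥ … ≥ Re λ_r` of `𝔞` on `Ū`, a basis `v̄` of `Ū` in which `𝔞` acts by triangular matrices
`Q̄(H)` with diagonal entries `λ_i(H)` and with no entries between different eigenvalues, and constant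
matrices `Ā`, `B̄` with `v̄ = B̄ ū` and `ū = Ā v̄`. -/
structure ConstantData {U : Type*} [AddCommGroup U] [Module (UgΛ C.𝔞 Λ) U] [Module ℂ U]
    [IsScalarTower ℂ (UgΛ C.𝔞 Λ) U] {N : ℕ} (u : Fin N → U) where
  /-- The dimension of `Ū`. -/
  r : ℕ
  /-- The eigenvalues of `𝔞` on `Ū`, with multiplicities. -/
  lam : Fin r → Module.Dual ℂ C.𝔞
  lam_antitone : ∀ i j, i ≤ j → S.reLex (lam j) ≤ S.reLex (lam i)
  /-- The basis `v̄` of `Ū`. -/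
  vbar : Module.Basis (Fin r) ℂ (Ubar C.𝔞 S.𝔫 Λ U)
  /-- The matrices `Q̄(H)`. -/
  Qbar : C.𝔞 →ₗ[ℂ] Matrix (Fin r) (Fin r) ℂ
  action : ∀ H i, aBar C.𝔞 S.𝔫 Λ U H (vbar i) = ∑ j, Qbar H i j • vbar j
  Qbar_diag : ∀ H i, Qbar H i i = lam i H
  Qbar_lower : ∀ H i j, j < i → Qbar H i j = 0
  Qbar_block : ∀ H i j, lam i ≠ lam j → Qbar H i j = 0
  /-- The matrix `Ā`. -/
  Abar : Matrix (Fin N) (Fin r) ℂ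
  /-- The matrix `B̄`. -/
  Bbar : Matrix (Fin r) (Fin N) ℂ
  vbar_eq : ∀ i, vbar i = ∑ j, Bbar i j • (Submodule.Quotient.mk (u j) : Ubar C.𝔞 S.𝔫 Λ U)
  ubar_eq : ∀ j, (Submodule.Quotient.mk (u j) : Ubar C.𝔞 S.𝔫 Λ U) = ∑ i, Abar j i • vbar i

end SimpleSystem

end BoundaryValue

end

/-!
Filter `U(𝔫)_Λ` by the ideals `𝔫 ^ k U(𝔫) ∩ U(𝔫)_Λ`, and `U` by the subspaces `F_k` generated by
them. The quotients `U / F_k` are finite-dimensional `𝔞`-modules, so they are direct sums of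
generalized weight spaces, and `U / F_1` is `Ū`. Triangularizing `𝔞` on `Ū` with the weights in
decreasing order gives the constant data (`SimpleSystem.nonempty_constantData`).

Given constant data, the vectors `B̄ u` represent the basis `v̄`, and are generalized weight vectors
modulo `F_1`. Generalized weight vectors lift along the surjections `U / F_{k+1} → U / F_k`, so they
can be corrected successively to generalized weight vectors modulo all the `F_k`; this produces `B`
as a limit (`IsFilteredAction.exists_weight_seq`). By Nakayama's argument the corrected vectors
generate `U` modulo every `F_k`, which produces `A` (`IsFilteredAction.exists_seq_sub_mem_fil`).
When `H v_i - ∑ Q̄(H)_{ij} v_j`, a generalized weight vector of weight `λ_i` in `F_1`, is expanded in the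
`v_j`, the coefficients can be replaced by their components of weight `λ_i - λ_j`. A weight
space of `U(𝔫)` meets `𝔫 ^ k U(𝔫)` trivially for large `k`, because weights of `𝔫 ^ k U(𝔫)` have
height at least `k`. Hence the coefficients stabilize, and `Q(H)` has entries in `U(𝔫)_Λ` itself
(`IsFilteredAction.exists_coeff`). The shape of `Q(H)` follows from its entries being weight
vectors: an entry of weight outside `Λ⁺` vanishes, an entry in `𝔫 U(𝔫)` of weight `0` vanishes, and
`λ_i - λ_j ∈ 𝒫⁺` with `λ_i ≠ λ_j` forces `Re λ_i > Re λ_j`.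

It remains to see that a combination `∑ f_j u_j` with `f_j ∈ Ê(𝔫)_Λ` vanishes in `Û` as soon as it
is congruent to `0` modulo every `F_k` (`WeightFrame.sum_smul_toUhat_eq_zero`). The tuple `f` is then a
limit of relations between the `u_j`, and the point is that the module of relations is closed: `f`
is a finite combination of relations with coefficients in `Ê(𝔫)_Λ`
(`InvLim.exists_sum_of_mem_closure`), and relations vanish in the tensor product. The algebra
`U(𝔫)_Λ` need not be handled directly: `U(𝔫)` is left Noetherian
(`WeightFrame.isNoetherianRing_Un`, by an iterated Hilbert basis theorem), so finitely many
lowest-height forms of relations generate all of them over `U(𝔫)`, and projecting the coefficients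
to weights in `Λ` makes them elements of `U(𝔫)_Λ`. Division with respect to these forms raises the
height at each step and converges.
-/

noncomputable section

namespace BoundaryValue

/-! ### Enveloping algebras of nilpotent Lie algebras are Noetherian -/

section Ore

variable {A : Type*} [Ring A] [Algebra ℂ A] (B : Subalgebra ℂ A) (x : A)

/-- The left `B`-submodule of polynomials `∑_{i < n} b_i x ^ i` of degree less than `n` in `x`. -/
def polyLT (n : ℕ) : Submodule B A := Submodule.span B ((fun i => x ^ i) '' Set.Iio n)

theorem polyLT_mono {m n : ℕ} (h : m ≤ n) : polyLT B x m ≤ polyLT B x n :=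
  Submodule.span_mono (Set.image_mono (Set.Iio_subset_Iio h))

theorem pow_mem_polyLT {i n : ℕ} (h : i < n) : x ^ i ∈ polyLT B x n :=
  Submodule.subset_span ⟨i, h, rfl⟩

theorem exists_of_mem_polyLT_succ {n : ℕ} {a : A} (ha : a ∈ polyLT B x (n + 1)) :
    ∃ b : B, ∃ d ∈ polyLT B x n, a = b • x ^ n + d := by
  have h : (fun i => x ^ i) '' Set.Iio (n + 1) =
      insert (x ^ n) ((fun i => x ^ i) '' Set.Iio n) := by
    rw [← Set.image_insert_eq]
    congr 1
    ext i
    simp only [Set.mem_Iio, Set.mem_insert_iff]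
    omega
  rw [polyLT, h, Submodule.mem_span_insert] at ha
  exact ha

variable {B x} (hx : ∀ b ∈ B, x * b - b * x ∈ B)
include hx

theorem mul_mem_polyLT {n : ℕ} {a : A} (ha : a ∈ polyLT B x n) : x * a ∈ polyLT B x (n + 1) := by
  induction ha using Submodule.span_induction with
  | zero => rw [mul_zero]; exact zero_mem _
  | add a a' _ _ h h' => rw [mul_add]; exact add_mem h h'
  | mem a ha =>
    obtain ⟨i, hi, rfl⟩ := ha
    change x * x ^ i ∈ _
    rw [← pow_succ']
    exact pow_mem_polyLT B x (Nat.succ_lt_succ hi)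
  | smul b a ha h =>
    have h1 : x * (b • a) = b • (x * a) + (⟨_, hx b b.2⟩ : B) • a := by
      simp only [Subalgebra.smul_def, smul_eq_mul]
      noncomm_ring
    rw [h1]
    exact add_mem (Submodule.smul_mem _ _ h)
      (Submodule.smul_mem _ _ (polyLT_mono B x (Nat.le_succ n) ha))

theorem exists_mem_polyLT (hgen : Algebra.adjoin ℂ (insert x (B : Set A)) = ⊤) (a : A) :
    ∃ n, a ∈ polyLT B x n := by
  have hmul : ∀ a : A, ∀ n, ∀ c ∈ polyLT B x n, ∃ m, a * c ∈ polyLT B x m := by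
    intro a
    have ha : a ∈ Algebra.adjoin ℂ (insert x (B : Set A)) := hgen ▸ Algebra.mem_top
    induction ha using Algebra.adjoin_induction with
    | mem a ha =>
      intro n c hc
      rcases ha with rfl | ha
      · exact ⟨n + 1, mul_mem_polyLT hx hc⟩
      · exact ⟨n, Submodule.smul_mem _ (⟨a, ha⟩ : B) hc⟩
    | algebraMap z =>
      intro n c hc
      exact ⟨n, Submodule.smul_mem _ (⟨_, B.algebraMap_mem z⟩ : B) hc⟩
    | add a a' _ _ h h' =>
      intro n c hc
      obtain ⟨m, hm⟩ := h n c hc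
      obtain ⟨m', hm'⟩ := h' n c hc
      refine ⟨max m m', ?_⟩
      rw [add_mul]
      exact add_mem (polyLT_mono B x (le_max_left _ _) hm)
        (polyLT_mono B x (le_max_right _ _) hm')
    | mul a a' _ _ h h' =>
      intro n c hc
      obtain ⟨m, hm⟩ := h' n c hc
      obtain ⟨m', hm'⟩ := h m _ hm
      exact ⟨m', by rwa [mul_assoc]⟩
  obtain ⟨m, hm⟩ := hmul a 1 1 (by simpa using pow_mem_polyLT B x (i := 0) (n := 1) one_pos)
  exact ⟨m, by rwa [mul_one] at hm⟩

omit hx in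
/-- The left ideal of `B` of the coefficients of `x ^ n` of the elements of degree at most `n` of a
left ideal. -/
def leadIdeal (B : Subalgebra ℂ A) (x : A) (I : Submodule A A) (n : ℕ) : Submodule B B where
  carrier := {b | ∃ d ∈ polyLT B x n, b • x ^ n + d ∈ I}
  zero_mem' := ⟨0, zero_mem _, by simp⟩
  add_mem' := by
    rintro b b' ⟨d, hd, h⟩ ⟨d', hd', h'⟩
    refine ⟨d + d', add_mem hd hd', ?_⟩
    convert add_mem h h' using 1
    rw [add_smul]; abel
  smul_mem' := by
    rintro c b ⟨d, hd, h⟩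
    refine ⟨c • d, Submodule.smul_mem _ _ hd, ?_⟩
    convert I.smul_mem (c : A) h using 1
    simp [Subalgebra.smul_def, mul_add, mul_assoc]

theorem leadIdeal_succ (I : Submodule A A) (n : ℕ) :
    leadIdeal B x I n ≤ leadIdeal B x I (n + 1) := by
  rintro b ⟨d, hd, h⟩
  refine ⟨(⟨_, hx b b.2⟩ : B) • x ^ n + x * d, add_mem (Submodule.smul_mem _ _
    (pow_mem_polyLT B x n.lt_succ_self)) (mul_mem_polyLT hx hd), ?_⟩
  convert I.smul_mem x h using 1
  simp only [Subalgebra.smul_def, smul_eq_mul, pow_succ']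
  noncomm_ring

theorem eq_of_leadIdeal_le (hgen : Algebra.adjoin ℂ (insert x (B : Set A)) = ⊤)
    {I J : Submodule A A} (hIJ : I ≤ J) (h : ∀ n, leadIdeal B x J n ≤ leadIdeal B x I n) :
    I = J := by
  refine le_antisymm hIJ fun a ha => ?_
  obtain ⟨n, hn⟩ := exists_mem_polyLT hx hgen a
  induction n generalizing a with
  | zero =>
    have : a = 0 := by simpa [polyLT] using hn
    rw [this]; exact zero_mem _
  | succ n ih =>
    obtain ⟨b, d, hd, rfl⟩ := exists_of_mem_polyLT_succ B x hn
    obtain ⟨d', hd', h'⟩ := h n ⟨d, hd, ha⟩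
    have := ih (d - d') (by convert sub_mem ha (hIJ h') using 1; abel) (sub_mem hd hd')
    convert add_mem h' this using 1
    abel

/-- A noncommutative Hilbert basis theorem: if `A` is generated by a left Noetherian subalgebra `B`
and an element `x` with `[x, B] ⊆ B`, then `A` is left Noetherian. -/
theorem isNoetherianRing_of_adjoin [IsNoetherianRing B]
    (hgen : Algebra.adjoin ℂ (insert x (B : Set A)) = ⊤) : IsNoetherianRing A := by
  refine ⟨fun I => ?_⟩
  have hmono : ∀ I : Submodule A A, Monotone (leadIdeal B x I) := fun I =>
    monotone_nat_of_le_succ (leadIdeal_succ hx I)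
  obtain ⟨n₀, hn₀⟩ := monotone_stabilizes_iff_noetherian.2 ‹IsNoetherianRing B›
    ⟨leadIdeal B x I, hmono I⟩
  -- Lift finite generating systems of the coefficient ideals in degrees `≤ n₀` to `I`.
  have hfin : ∀ n, ∃ s : Finset A, (s : Set A) ⊆ I ∧
      leadIdeal B x I n ≤ leadIdeal B x (Submodule.span A s) n := by
    intro n
    classical
    obtain ⟨t, ht⟩ := (IsNoetherian.noetherian (leadIdeal B x I n) : (leadIdeal B x I n).FG)
    have hmem : ∀ b : B, ∃ a : A, b ∈ t → a ∈ I ∧ ∃ d ∈ polyLT B x n, a = b • x ^ n + d := by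
      intro b
      by_cases hb : b ∈ t
      · have hb' : b ∈ leadIdeal B x I n := ht ▸ Submodule.subset_span hb
        obtain ⟨d, hd, h⟩ := hb'
        exact ⟨_, fun _ => ⟨h, d, hd, rfl⟩⟩
      · exact ⟨0, fun h => absurd h hb⟩
    choose f hf using hmem
    refine ⟨t.image f, ?_, ?_⟩
    · intro a ha
      obtain ⟨b, hb, rfl⟩ := Finset.mem_image.1 (Finset.mem_coe.1 ha)
      exact (hf b hb).1
    · rw [← ht, Submodule.span_le]
      intro b hb
      obtain ⟨d, hd, h⟩ := (hf b hb).2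
      refine ⟨d, hd, h ▸ Submodule.subset_span ?_⟩
      exact Finset.mem_coe.2 (Finset.mem_image_of_mem f hb)
  choose s hs hs' using hfin
  classical
  refine ⟨(Finset.range (n₀ + 1)).biUnion s, ?_⟩
  refine eq_of_leadIdeal_le hx hgen ?_ fun n => ?_
  · rw [Submodule.span_le]
    intro a ha
    obtain ⟨n, _, h⟩ := Finset.mem_biUnion.1 (Finset.mem_coe.1 ha)
    exact hs n h
  · have hle : ∀ m ≤ n₀, leadIdeal B x I m ≤
        leadIdeal B x (Submodule.span A ((Finset.range (n₀ + 1)).biUnion s : Finset A)) m := by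
      intro m hm
      refine (hs' m).trans ?_
      rintro b ⟨d, hd, h⟩
      refine ⟨d, hd, Submodule.span_mono ?_ h⟩
      exact_mod_cast Finset.subset_biUnion_of_mem s (Finset.mem_range.2 (Nat.lt_succ_of_le hm))
    rcases le_total n n₀ with h | h
    · exact hle n h
    · rw [← show leadIdeal B x I n₀ = leadIdeal B x I n from hn₀ n h]
      exact (hle n₀ le_rfl).trans (hmono _ h)

omit hx
end Ore

/-- If `[x_i, x_j]` lies in the span of `x_0, …, x_{i-1}` for all `j < i`, then the algebra
generated by `x_0, …, x_{n-1}` is left Noetherian. -/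
theorem isNoetherianRing_adjoin_of_lower {A : Type*} [Ring A] [Algebra ℂ A] (x : ℕ → A) (n : ℕ)
    (hx : ∀ i < n, ∀ j < i, x i * x j - x j * x i ∈ Submodule.span ℂ (x '' Set.Iio i)) :
    IsNoetherianRing (Algebra.adjoin ℂ (x '' Set.Iio n)) := by
  induction n with
  | zero =>
    have h : x '' Set.Iio 0 = ∅ := by simp
    rw [h, Algebra.adjoin_empty]
    exact isNoetherianRing_of_surjective ℂ _ (Algebra.ofId ℂ (⊥ : Subalgebra ℂ A)).toRingHom
      (fun y => by
        obtain ⟨z, hz⟩ := Algebra.mem_bot.1 y.2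
        exact ⟨z, Subtype.ext hz⟩)
  | succ n ih =>
    have hB := ih fun i hi => hx i (Nat.lt_succ_of_lt hi)
    set B := Algebra.adjoin ℂ (x '' Set.Iio n) with hBdef
    set D := Algebra.adjoin ℂ (x '' Set.Iio (n + 1)) with hDdef
    have hBD : B ≤ D := Algebra.adjoin_mono (Set.image_mono (Set.Iio_subset_Iio n.le_succ))
    have hxD : x n ∈ D := Algebra.subset_adjoin ⟨n, Nat.lt_succ_self n, rfl⟩
    have hcomm : ∀ b ∈ B, x n * b - b * x n ∈ B := by
      intro b hb
      induction hb using Algebra.adjoin_induction with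
      | mem b hb =>
        obtain ⟨j, hj, rfl⟩ := hb
        exact (Submodule.span_le (p := Subalgebra.toSubmodule B)).2 Algebra.subset_adjoin
          (hx n n.lt_succ_self j hj)
      | algebraMap z => rw [Algebra.commutes, sub_self]; exact zero_mem _
      | add b b' _ _ h h' =>
        convert add_mem h h' using 1
        noncomm_ring
      | mul b b' hb hb' h h' =>
        convert add_mem (mul_mem h hb') (mul_mem hb h') using 1
        noncomm_ring
    let B' : Subalgebra ℂ D := B.comap D.val
    have : IsNoetherianRing B' := by
      refine isNoetherianRing_of_surjective B B'
        (AlgHom.codRestrict (Subalgebra.inclusion hBD) B' (fun b => b.2)).toRingHom ?_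
      rintro ⟨⟨y, hy⟩, hy'⟩
      exact ⟨⟨y, hy'⟩, rfl⟩
    refine isNoetherianRing_of_adjoin (B := B') (x := (⟨x n, hxD⟩ : D))
      (fun b hb => hcomm b hb) ?_
    refine eq_top_iff.2 fun d _ => ?_
    have key : D ≤ (Algebra.adjoin ℂ (insert (⟨x n, hxD⟩ : D) (B' : Set D))).map D.val := by
      refine Algebra.adjoin_le ?_
      rintro _ ⟨i, hi, rfl⟩
      rcases Nat.lt_succ_iff_lt_or_eq.1 hi with h | rfl
      · have hi' : x i ∈ B := Algebra.subset_adjoin ⟨i, h, rfl⟩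
        exact ⟨⟨x i, hBD hi'⟩, Algebra.subset_adjoin (Or.inr hi'), rfl⟩
      · exact ⟨⟨x i, hxD⟩, Algebra.subset_adjoin (Or.inl rfl), rfl⟩
    obtain ⟨d', hd', h⟩ := key d.2
    rwa [← Subtype.ext (a1 := d') (a2 := d) h]

/-! ### Gradings by an abelian group and their projections -/

section Graded

variable {Γ M : Type*} [AddCommGroup M] [Module ℂ M] (𝒜 : Γ → Submodule ℂ M)

/-- The elements all of whose components lie in degrees in `T`. -/
def homSub (T : Set Γ) : Submodule ℂ M := ⨆ μ ∈ T, 𝒜 μ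

variable {𝒜}

theorem mem_homSub {T : Set Γ} {μ : Γ} (hμ : μ ∈ T) {y : M} (hy : y ∈ 𝒜 μ) : y ∈ homSub 𝒜 T :=
  Submodule.mem_iSup_of_mem μ (Submodule.mem_iSup_of_mem hμ hy)

theorem homSub_le {T : Set Γ} {N : Submodule ℂ M} : homSub 𝒜 T ≤ N ↔ ∀ μ ∈ T, 𝒜 μ ≤ N :=
  iSup₂_le_iff

theorem homSub_mono {T T' : Set Γ} (h : T ⊆ T') : homSub 𝒜 T ≤ homSub 𝒜 T' :=
  homSub_le.2 fun _ hμ _ hy => mem_homSub (h hμ) hy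

theorem homSub_univ : homSub 𝒜 Set.univ = ⨆ μ, 𝒜 μ := by simp [homSub]

theorem disjoint_homSub (h : iSupIndep 𝒜) {T T' : Set Γ} (hT : Disjoint T T') :
    Disjoint (homSub 𝒜 T) (homSub 𝒜 T') := h.disjoint_biSup_biSup hT

theorem isCompl_homSub (h : iSupIndep 𝒜) (h' : ⨆ μ, 𝒜 μ = ⊤) (T : Set Γ) :
    IsCompl (homSub 𝒜 T) (homSub 𝒜 Tᶜ) := by
  refine ⟨disjoint_homSub h disjoint_compl_right, codisjoint_iff.2 ?_⟩
  refine eq_top_iff.2 (h' ▸ iSup_le fun μ => ?_)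
  by_cases hμ : μ ∈ T
  · exact le_sup_of_le_left fun y hy => mem_homSub hμ hy
  · exact le_sup_of_le_right fun y hy => mem_homSub (T := Tᶜ) hμ hy

/-- In an independent family, the component of degree `ν` of a finite sum of homogeneous elements
is the sum of the terms of degree `ν`. -/
theorem eq_sum_of_mem (h : iSupIndep 𝒜) {ι : Type*} (s : Finset ι) (χ : ι → Γ) (z : ι → M)
    (hz : ∀ i ∈ s, z i ∈ 𝒜 (χ i)) (ν : Γ) [DecidablePred fun i => χ i = ν]
    (hy : ∑ i ∈ s, z i ∈ 𝒜 ν) :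
    ∑ i ∈ s, z i = ∑ i ∈ s with χ i = ν, z i := by
  rw [← Finset.sum_filter_add_sum_filter_not s (fun i => χ i = ν) z] at hy ⊢
  have h1 : ∑ i ∈ s with χ i = ν, z i ∈ 𝒜 ν := by
    refine sum_mem fun i hi => ?_
    obtain ⟨hi, hχ⟩ := Finset.mem_filter.1 hi
    exact hχ ▸ hz i hi
  have h2 : ∑ i ∈ s with ¬ χ i = ν, z i ∈ ⨆ μ, ⨆ _ : μ ≠ ν, 𝒜 μ := by
    refine sum_mem fun i hi => ?_
    obtain ⟨hi, hne⟩ := Finset.mem_filter.1 hi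
    exact Submodule.mem_iSup_of_mem _ (Submodule.mem_iSup_of_mem hne (hz i hi))
  have h3 : ∑ i ∈ s with ¬ χ i = ν, z i = 0 :=
    Submodule.disjoint_def.1 (h ν) _ ((Submodule.add_mem_iff_right _ h1).1 hy) h2
  rw [h3, add_zero]

variable (hi : iSupIndep 𝒜) (ht : ⨆ μ, 𝒜 μ = ⊤)

/-- The projection onto the components with degrees in `T`. -/
def wproj (T : Set Γ) : M →ₗ[ℂ] M := Submodule.projection _ _ (isCompl_homSub hi ht T)

theorem wproj_mem (T : Set Γ) (y : M) : wproj hi ht T y ∈ homSub 𝒜 T :=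
  Submodule.projection_apply_mem _ y

theorem wproj_of_mem {T : Set Γ} {y : M} (hy : y ∈ homSub 𝒜 T) : wproj hi ht T y = y :=
  Submodule.projection_apply_left _ ⟨y, hy⟩

theorem wproj_of_mem_compl {T : Set Γ} {y : M} (hy : y ∈ homSub 𝒜 Tᶜ) : wproj hi ht T y = 0 :=
  (Submodule.projection_apply_eq_zero_iff _).2 hy

theorem sub_wproj_mem {T S : Set Γ} {y : M} (hy : y ∈ homSub 𝒜 S) :
    y - wproj hi ht T y ∈ homSub 𝒜 (S \ T) := by
  have h : homSub 𝒜 S ≤ (homSub 𝒜 (S \ T)).comap (LinearMap.id - wproj hi ht T) := by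
    refine homSub_le.2 fun μ hμ y hy => ?_
    change y - wproj hi ht T y ∈ homSub 𝒜 (S \ T)
    by_cases hT : μ ∈ T
    · rw [wproj_of_mem hi ht (mem_homSub hT hy), sub_self]; exact zero_mem _
    · rw [wproj_of_mem_compl hi ht (mem_homSub (T := Tᶜ) hT hy), sub_zero]
      exact mem_homSub (show μ ∈ S \ T from ⟨hμ, hT⟩) hy
  exact h hy

theorem wproj_mem_inter {T S : Set Γ} {y : M} (hy : y ∈ homSub 𝒜 S) :
    wproj hi ht T y ∈ homSub 𝒜 (S ∩ T) := by
  have h : homSub 𝒜 S ≤ (homSub 𝒜 (S ∩ T)).comap (wproj hi ht T) := by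
    refine homSub_le.2 fun μ hμ y hy => ?_
    change wproj hi ht T y ∈ homSub 𝒜 (S ∩ T)
    by_cases hT : μ ∈ T
    · rw [wproj_of_mem hi ht (mem_homSub hT hy)]; exact mem_homSub (show μ ∈ S ∩ T from ⟨hμ, hT⟩) hy
    · rw [wproj_of_mem_compl hi ht (mem_homSub (T := Tᶜ) hT hy)]; exact zero_mem _
  exact h hy

end Graded

section GradedRing

variable {Γ R : Type*} [AddCommGroup Γ] [Ring R] [Algebra ℂ R] {𝒜 : Γ → Submodule ℂ R}
  (hi : iSupIndep 𝒜) (ht : ⨆ μ, 𝒜 μ = ⊤)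
  (hm : ∀ μ ν a b, a ∈ 𝒜 μ → b ∈ 𝒜 ν → a * b ∈ 𝒜 (μ + ν))
include hm

theorem mul_mem_homSub {T T' S : Set Γ} (h : ∀ μ ∈ T, ∀ ν ∈ T', μ + ν ∈ S) {a b : R}
    (ha : a ∈ homSub 𝒜 T) (hb : b ∈ homSub 𝒜 T') : a * b ∈ homSub 𝒜 S := by
  have h1 : homSub 𝒜 T * homSub 𝒜 T' ≤ homSub 𝒜 S := by
    simp only [homSub, Submodule.iSup_mul, Submodule.mul_iSup]
    refine iSup₂_le fun ν hν => iSup₂_le fun μ hμ => Submodule.mul_le.2 fun a ha b hb => ?_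
    exact mem_homSub (h μ hμ ν hν) (hm μ ν a b ha hb)
  exact h1 (Submodule.mul_mem_mul ha hb)

/-- Taking components in `T` commutes with right multiplication by an element `b` with components
in `T'`, if `μ + ν ∈ T` is equivalent to `μ ∈ S` for all `ν ∈ T'`. -/
theorem wproj_mul {T T' S : Set Γ} (h : ∀ μ, ∀ ν ∈ T', μ + ν ∈ T ↔ μ ∈ S) (a : R) {b : R}
    (hb : b ∈ homSub 𝒜 T') : wproj hi ht T (a * b) = wproj hi ht S a * b := by
  have h1 : ∀ c : R, c ∈ homSub 𝒜 S → wproj hi ht T (c * b) = c * b := fun c hc =>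
    wproj_of_mem hi ht (mul_mem_homSub hm (fun μ hμ ν hν => (h μ ν hν).2 hμ) hc hb)
  have h2 : ∀ c : R, c ∈ homSub 𝒜 Sᶜ → wproj hi ht T (c * b) = 0 := fun c hc =>
    wproj_of_mem_compl hi ht
      (mul_mem_homSub hm (T := Sᶜ) (S := Tᶜ) (fun μ hμ ν hν h' => hμ ((h μ ν hν).1 h')) hc hb)
  have h3 : a - wproj hi ht S a ∈ homSub 𝒜 Sᶜ := by
    have := sub_wproj_mem hi ht (T := S) (S := Set.univ) (y := a)
      (by rw [homSub_univ, ht]; trivial)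
    rwa [← Set.compl_eq_univ_sdiff] at this
  calc wproj hi ht T (a * b)
      = wproj hi ht T (wproj hi ht S a * b) + wproj hi ht T ((a - wproj hi ht S a) * b) := by
        rw [← map_add, ← add_mul, add_sub_cancel]
    _ = _ := by rw [h1 _ (wproj_mem hi ht S a), h2 _ h3, add_zero]

end GradedRing

/-! ### The weight grading of `U(𝔫)` -/

section Weights

variable {𝔤 : Type*} [LieRing 𝔤] [LieAlgebra ℂ 𝔤] (𝔞 𝔫 : LieSubalgebra ℂ 𝔤)

/-- The operator `P ↦ H P - P H` on `U(𝔤)`. -/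
def adUg (H : 𝔤) : UEnv 𝔤 →ₗ[ℂ] UEnv 𝔤 :=
  LinearMap.mulLeft ℂ (iota H) - LinearMap.mulRight ℂ (iota H)

theorem adUg_apply (H : 𝔤) (P : UEnv 𝔤) : adUg H P = iota H * P - P * iota H := rfl

theorem iSupIndep_wtUg [IsLieAbelian 𝔞] : iSupIndep (wtUg 𝔞) := by
  have hcomm : ∀ H H' : 𝔞, Commute (adUg (H : 𝔤)) (adUg (H' : 𝔤)) := by
    intro H H'
    have h : iota (H : 𝔤) * iota (H' : 𝔤) = iota (H' : 𝔤) * iota (H : 𝔤) := by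
      rw [← sub_eq_zero, ← iota_lie, ← LieSubalgebra.coe_bracket, trivial_lie_zero]
      exact map_zero _
    refine LinearMap.ext fun P => ?_
    simp only [Module.End.mul_apply, adUg_apply, mul_sub, sub_mul, ← mul_assoc, h]
    simp only [mul_assoc, h]
    abel
  have h1 := Module.End.independent_iInf_maxGenEigenspace_of_forall_mapsTo
    (fun H : 𝔞 => adUg (H : 𝔤))
    (fun H H' φ => Module.End.mapsTo_maxGenEigenspace_of_comm (hcomm H' H) φ)
  have h2 := h1.comp (f := fun μ : Module.Dual ℂ 𝔞 => (μ : 𝔞 → ℂ)) DFunLike.coe_injective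
  refine h2.mono fun μ P hP => ?_
  refine (Submodule.mem_iInf _).2 fun H => ?_
  refine (Module.End.mem_maxGenEigenspace _ _ _).2 ⟨1, ?_⟩
  rw [pow_one, LinearMap.sub_apply, adUg_apply, hP H]
  simp

/-- The weight space `U(𝔫)_μ`. -/
def wtUn (μ : Module.Dual ℂ 𝔞) : Submodule ℂ (Un 𝔫) := (wtUg 𝔞 μ).comap (Un 𝔫).val.toLinearMap

theorem iSupIndep_wtUn [IsLieAbelian 𝔞] : iSupIndep (wtUn 𝔞 𝔫) := by
  intro μ
  refine Submodule.disjoint_def.2 fun P hP hP' => Subtype.ext ?_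
  refine Submodule.disjoint_def.1 (iSupIndep_wtUg 𝔞 μ) (P : UEnv 𝔤) hP ?_
  have h : ⨆ ν, ⨆ _ : ν ≠ μ, wtUn 𝔞 𝔫 ν ≤
      (⨆ ν, ⨆ _ : ν ≠ μ, wtUg 𝔞 ν).comap (Un 𝔫).val.toLinearMap :=
    iSup₂_le fun ν hν y hy => Submodule.mem_iSup_of_mem ν (Submodule.mem_iSup_of_mem hν hy)
  exact h hP'

theorem mul_mem_wtUn (μ ν : Module.Dual ℂ 𝔞) (a b : Un 𝔫) (ha : a ∈ wtUn 𝔞 𝔫 μ)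
    (hb : b ∈ wtUn 𝔞 𝔫 ν) : a * b ∈ wtUn 𝔞 𝔫 (μ + ν) :=
  mul_mem_wtUg 𝔞 ha hb

variable {𝔫} in
theorem map_val_inUn : (inUn 𝔫).map (Un 𝔫).val.toLinearMap = inUg 𝔫 := by
  refine le_antisymm (Submodule.map_comap_le _ _) fun y hy => ?_
  exact ⟨⟨y, Algebra.subset_adjoin hy⟩, hy, rfl⟩

/-- A finite system of `𝔞`-weight vectors spanning `𝔫`, and a height function on `𝔞^*` whose values
on the weights of the system are positive integers. -/
structure WeightFrame where
  /-- The number of weight vectors. -/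
  d : ℕ
  /-- The weight vectors. -/
  x : Fin d → 𝔤
  /-- The weights. -/
  wt : Fin d → Module.Dual ℂ 𝔞
  lie_x : ∀ (H : 𝔞) i, ⁅(H : 𝔤), x i⁆ = wt i H • x i
  span_x : Submodule.span ℂ (Set.range x) = 𝔫.toSubmodule
  /-- The height function. -/
  ht : Module.Dual ℂ 𝔞 →+ ℝ
  /-- The heights of the weight vectors. -/
  deg : Fin d → ℕ
  deg_pos : ∀ i, 0 < deg i
  ht_wt : ∀ i, ht (wt i) = deg i

namespace WeightFrame

variable {𝔞 𝔫} (F : WeightFrame 𝔞 𝔫)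

/-- The weight vectors as elements of `U(𝔫)`. -/
def gen (i : Fin F.d) : Un 𝔫 :=
  ⟨iota (F.x i), Algebra.subset_adjoin
    ⟨F.x i, (F.span_x ▸ Submodule.subset_span (Set.mem_range_self i) : _ ∈ 𝔫.toSubmodule), rfl⟩⟩

theorem span_gen : Submodule.span ℂ (Set.range F.gen) = inUn 𝔫 := by
  have h : (Submodule.span ℂ (Set.range F.gen)).map (Un 𝔫).val.toLinearMap =
      (inUn 𝔫).map (Un 𝔫).val.toLinearMap := by
    rw [map_val_inUn, inUg, ← F.span_x, Submodule.map_span, Submodule.map_span, ← Set.range_comp,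
      ← Set.range_comp]
    rfl
  exact Submodule.map_injective_of_injective
    (f := (Un 𝔫).val.toLinearMap) Subtype.val_injective h

/-- The monomials in the weight vectors. -/
def mon (l : List (Fin F.d)) : Un 𝔫 := (l.map F.gen).prod

/-- The weight of a monomial. -/
def monWt (l : List (Fin F.d)) : Module.Dual ℂ 𝔞 := (l.map F.wt).sum

theorem mon_mem (l : List (Fin F.d)) : F.mon l ∈ wtUn 𝔞 𝔫 (F.monWt l) := by
  induction l with
  | nil => exact one_mem_wtUg 𝔞
  | cons i l ih =>
    rw [mon, monWt, List.map_cons, List.map_cons, List.prod_cons, List.sum_cons]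
    refine mul_mem_wtUn 𝔞 𝔫 _ _ _ _ (fun H => ?_) ih
    change iota (H : 𝔤) * iota (F.x i) - iota (F.x i) * iota (H : 𝔤) = F.wt i H • iota (F.x i)
    rw [← iota_lie, F.lie_x, map_smul]

theorem monWt_mem (l : List (Fin F.d)) : F.monWt l ∈ AddSubmonoid.closure (Set.range F.wt) := by
  refine AddSubmonoid.list_sum_mem _ fun μ hμ => ?_
  obtain ⟨i, _, rfl⟩ := List.mem_map.1 hμ
  exact AddSubmonoid.subset_closure (Set.mem_range_self i)

/-- The height of a monomial. -/
def monDeg (l : List (Fin F.d)) : ℕ := (l.map F.deg).sum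

theorem ht_monWt (l : List (Fin F.d)) : F.ht (F.monWt l) = F.monDeg l := by
  induction l with
  | nil => simp [monWt, monDeg]
  | cons i l ih =>
    rw [monWt, monDeg] at *
    simp [ih, F.ht_wt]

theorem length_le_monDeg (l : List (Fin F.d)) : l.length ≤ F.monDeg l := by
  induction l with
  | nil => simp
  | cons i l ih =>
    rw [monDeg] at *
    have := F.deg_pos i
    simp only [List.length_cons, List.map_cons, List.sum_cons]
    omega

/-- A positive bound for the heights of the weight vectors. -/
def maxDeg : ℕ := ∑ i, F.deg i + 1

theorem monDeg_le (l : List (Fin F.d)) : F.monDeg l ≤ F.maxDeg * l.length := by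
  induction l with
  | nil => simp [monDeg]
  | cons i l ih =>
    rw [monDeg] at *
    have h : F.deg i ≤ ∑ i, F.deg i :=
      Finset.single_le_sum (fun _ _ => Nat.zero_le _) (Finset.mem_univ i)
    simp only [List.length_cons, List.map_cons, List.sum_cons]
    rw [mul_add, mul_one]
    have : F.deg i ≤ F.maxDeg := by rw [maxDeg]; omega
    omega

theorem span_mon : Submodule.span ℂ (Set.range F.mon) = ⊤ := by
  set N := Submodule.span ℂ (Set.range F.mon) with hN
  have hmul : N * N ≤ N := by
    rw [hN, Submodule.span_mul_span]
    refine Submodule.span_mono ?_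
    rintro _ ⟨_, ⟨l, rfl⟩, _, ⟨l', rfl⟩, rfl⟩
    exact ⟨l ++ l', by simp [mon]⟩
  have hone : (1 : Un 𝔫) ∈ N := Submodule.subset_span ⟨[], rfl⟩
  have hgen : inUn 𝔫 ≤ N := by
    rw [← F.span_gen, Submodule.span_le]
    rintro _ ⟨i, rfl⟩
    exact Submodule.subset_span ⟨[i], by simp [mon]⟩
  refine eq_top_iff.2 fun P _ => ?_
  have key : ∀ P : UEnv 𝔤, P ∈ Un 𝔫 → ∃ y ∈ N, (y : UEnv 𝔤) = P := by
    intro P hP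
    induction hP using Algebra.adjoin_induction with
    | mem Y hY => exact ⟨⟨Y, Algebra.subset_adjoin hY⟩, hgen hY, rfl⟩
    | algebraMap c => exact ⟨algebraMap ℂ _ c, by
        rw [Algebra.algebraMap_eq_smul_one]; exact N.smul_mem c hone, rfl⟩
    | add P Q _ _ h h' =>
      obtain ⟨y, hy, rfl⟩ := h
      obtain ⟨y', hy', rfl⟩ := h'
      exact ⟨y + y', add_mem hy hy', rfl⟩
    | mul P Q _ _ h h' =>
      obtain ⟨y, hy, rfl⟩ := h
      obtain ⟨y', hy', rfl⟩ := h'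
      exact ⟨y * y', hmul (Submodule.mul_mem_mul hy hy'), rfl⟩
  obtain ⟨y, hy, h⟩ := key P P.2
  rwa [← Subtype.ext h]

theorem powIdeal_eq_span (k : ℕ) :
    powIdeal (inUn 𝔫) k = Submodule.span ℂ (F.mon '' {l | k ≤ l.length}) := by
  induction k with
  | zero =>
    rw [powIdeal_zero, ← F.span_mon]
    congr 1
    simp
  | succ k ih =>
    rw [powIdeal_succ, ih, ← F.span_gen, Submodule.span_mul_span]
    congr 1
    ext P
    constructor
    · rintro ⟨_, ⟨i, rfl⟩, _, ⟨l, hl, rfl⟩, rfl⟩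
      exact ⟨i :: l, Nat.succ_le_succ hl, by simp [mon]⟩
    · rintro ⟨_ | ⟨i, l⟩, hl, rfl⟩
      · simp at hl
      · exact ⟨_, ⟨i, rfl⟩, _, ⟨l, Nat.le_of_succ_le_succ hl, rfl⟩, by simp [mon]⟩

include F in
theorem iSup_wtUn : ⨆ μ, wtUn 𝔞 𝔫 μ = ⊤ := by
  refine eq_top_iff.2 ?_
  rw [← F.span_mon, Submodule.span_le]
  rintro _ ⟨l, rfl⟩
  exact Submodule.mem_iSup_of_mem _ (F.mon_mem l)

variable [IsLieAbelian 𝔞]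

/-- The projection of `U(𝔫)` to the sum of the weight spaces with weights in `T`. -/
def proj (T : Set (Module.Dual ℂ 𝔞)) : Un 𝔫 →ₗ[ℂ] Un 𝔫 :=
  wproj (iSupIndep_wtUn 𝔞 𝔫) F.iSup_wtUn T

theorem proj_of_mem {T : Set (Module.Dual ℂ 𝔞)} {P : Un 𝔫} (hP : P ∈ homSub (wtUn 𝔞 𝔫) T) :
    F.proj T P = P := wproj_of_mem _ _ hP

theorem proj_mem (T : Set (Module.Dual ℂ 𝔞)) (P : Un 𝔫) : F.proj T P ∈ homSub (wtUn 𝔞 𝔫) T :=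
  wproj_mem _ _ T P

/-- An element of `U(𝔫)_μ` with all weights in a set `T` not containing `μ` vanishes. -/
theorem eq_zero_of_mem {μ : Module.Dual ℂ 𝔞} {T : Set (Module.Dual ℂ 𝔞)} (h : μ ∉ T) {P : Un 𝔫}
    (hP : P ∈ wtUn 𝔞 𝔫 μ) (hP' : P ∈ homSub (wtUn 𝔞 𝔫) T) : P = 0 :=
  Submodule.disjoint_def.1 (disjoint_homSub (iSupIndep_wtUn 𝔞 𝔫)
    (Set.disjoint_singleton_left.2 h)) P (mem_homSub (Set.mem_singleton μ) hP) hP'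

open Classical in
theorem proj_mon (T : Set (Module.Dual ℂ 𝔞)) (l : List (Fin F.d)) :
    F.proj T (F.mon l) = if F.monWt l ∈ T then F.mon l else 0 := by
  split_ifs with h
  · exact wproj_of_mem _ _ (mem_homSub h (F.mon_mem l))
  · exact wproj_of_mem_compl _ _ (mem_homSub (T := Tᶜ) h (F.mon_mem l))

theorem proj_mem_powIdeal (T : Set (Module.Dual ℂ 𝔞)) (k : ℕ) {P : Un 𝔫}
    (hP : P ∈ powIdeal (inUn 𝔫) k) : F.proj T P ∈ powIdeal (inUn 𝔫) k := by
  have h : powIdeal (inUn 𝔫) k ≤ (powIdeal (inUn 𝔫) k).comap (F.proj T) := by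
    conv_lhs => rw [F.powIdeal_eq_span]
    rw [Submodule.span_le]
    rintro _ ⟨l, hl, rfl⟩
    change F.proj T (F.mon l) ∈ powIdeal (inUn 𝔫) k
    rw [proj_mon]
    split_ifs
    · rw [F.powIdeal_eq_span]; exact Submodule.subset_span ⟨l, hl, rfl⟩
    · exact zero_mem _
  exact h hP

omit [IsLieAbelian 𝔞] in
/-- `𝔫 ^ k U(𝔫)` has only weights in the cone and of height at least `k`. -/
theorem powIdeal_le (k : ℕ) : powIdeal (inUn 𝔫) k ≤
    homSub (wtUn 𝔞 𝔫) {μ | μ ∈ AddSubmonoid.closure (Set.range F.wt) ∧ k ≤ F.ht μ} := by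
  rw [F.powIdeal_eq_span, Submodule.span_le]
  rintro _ ⟨l, hl, rfl⟩
  refine mem_homSub (μ := F.monWt l) (Set.mem_ofPred.2 ⟨F.monWt_mem l, ?_⟩) (F.mon_mem l)
  rw [F.ht_monWt]
  exact_mod_cast le_trans (Set.mem_ofPred.1 hl) (F.length_le_monDeg l)

theorem proj_mem_span (T : Set (Module.Dual ℂ 𝔞)) (P : Un 𝔫) :
    F.proj T P ∈ Submodule.span ℂ (F.mon '' {l | F.monWt l ∈ T}) := by
  have h : (⊤ : Submodule ℂ (Un 𝔫)) ≤
      (Submodule.span ℂ (F.mon '' {l | F.monWt l ∈ T})).comap (F.proj T) := by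
    rw [← F.span_mon, Submodule.span_le]
    rintro _ ⟨l, rfl⟩
    change F.proj T (F.mon l) ∈ Submodule.span ℂ (F.mon '' {l | F.monWt l ∈ T})
    rw [proj_mon]
    split_ifs with hl
    · exact Submodule.subset_span ⟨l, hl, rfl⟩
    · exact zero_mem _
  exact h (x := P) trivial

theorem homSub_eq_span (T : Set (Module.Dual ℂ 𝔞)) :
    homSub (wtUn 𝔞 𝔫) T = Submodule.span ℂ (F.mon '' {l | F.monWt l ∈ T}) := by
  refine le_antisymm (fun P hP => ?_) ?_
  · rw [← F.proj_of_mem hP]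
    exact F.proj_mem_span T P
  · rw [Submodule.span_le]
    rintro _ ⟨l, hl, rfl⟩
    exact mem_homSub (μ := F.monWt l) (Set.mem_ofPred.1 hl) (F.mon_mem l)

/-- Elements of large height lie in high powers of `𝔫`. -/
theorem homSub_le_powIdeal (k : ℕ) :
    homSub (wtUn 𝔞 𝔫) {μ | ((F.maxDeg * k : ℕ) : ℝ) ≤ F.ht μ} ≤ powIdeal (inUn 𝔫) k := by
  rw [F.homSub_eq_span, F.powIdeal_eq_span]
  refine Submodule.span_mono (Set.image_mono fun l hl => Set.mem_ofPred.2 ?_)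
  replace hl : ((F.maxDeg * k : ℕ) : ℝ) ≤ F.ht (F.monWt l) := Set.mem_ofPred.1 hl
  rw [F.ht_monWt, Nat.cast_le] at hl
  exact Nat.le_of_mul_le_mul_left (hl.trans (F.monDeg_le l)) (Nat.succ_pos _)

theorem wtUn_inf_powIdeal_eq_bot {μ : Module.Dual ℂ 𝔞} {k : ℕ} (h : F.ht μ < k) {P : Un 𝔫}
    (hP : P ∈ wtUn 𝔞 𝔫 μ) (hP' : P ∈ powIdeal (inUn 𝔫) k) : P = 0 :=
  eq_zero_of_mem (fun h' => absurd (Set.mem_ofPred.1 h').2 (not_le.2 h)) hP (F.powIdeal_le k hP')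

theorem eq_zero_of_notMem_closure {μ : Module.Dual ℂ 𝔞}
    (h : μ ∉ AddSubmonoid.closure (Set.range F.wt)) {P : Un 𝔫} (hP : P ∈ wtUn 𝔞 𝔫 μ) : P = 0 :=
  eq_zero_of_mem (fun h' => h (Set.mem_ofPred.1 h').1) hP
    (F.powIdeal_le 0 (by rw [powIdeal_zero]; trivial))

include F in
/-- `U(𝔫)_Λ` consists of the elements of `U(𝔫)` with weights in `Λ`. -/
theorem mem_UnΛ_iff (Λ : AddSubgroup (Module.Dual ℂ 𝔞)) (P : Un 𝔫) :
    (P : UEnv 𝔤) ∈ UnΛ 𝔞 𝔫 Λ ↔ P ∈ homSub (wtUn 𝔞 𝔫) (Λ : Set (Module.Dual ℂ 𝔞)) := by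
  have hmap : ∀ T : Set (Module.Dual ℂ 𝔞), ∀ P ∈ homSub (wtUn 𝔞 𝔫) T,
      (P : UEnv 𝔤) ∈ homSub (wtUg 𝔞) T := fun T P hP => by
    have h : homSub (wtUn 𝔞 𝔫) T ≤ (homSub (wtUg 𝔞) T).comap (Un 𝔫).val.toLinearMap :=
      homSub_le.2 fun μ hμ y hy => mem_homSub hμ hy
    exact h hP
  have hUgΛ : ∀ P : UEnv 𝔤, P ∈ UgΛ 𝔞 Λ ↔ P ∈ homSub (wtUg 𝔞) (Λ : Set (Module.Dual ℂ 𝔞)) := by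
    intro P
    have h : homSub (wtUg 𝔞) (Λ : Set (Module.Dual ℂ 𝔞)) = ⨆ μ : Λ, wtUg 𝔞 μ := by
      rw [homSub, iSup_subtype']; rfl
    rw [h]; rfl
  constructor
  · intro hP
    have h1 := (hUgΛ P).1 hP.2
    have h2 : P - F.proj Λ P ∈ homSub (wtUn 𝔞 𝔫) (Λ : Set (Module.Dual ℂ 𝔞))ᶜ := by
      have := sub_wproj_mem (iSupIndep_wtUn 𝔞 𝔫) F.iSup_wtUn (T := Λ) (S := Set.univ) (y := P)
        (by rw [homSub_univ, F.iSup_wtUn]; trivial)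
      rwa [← Set.compl_eq_univ_sdiff] at this
    have h3 := wproj_mem (iSupIndep_wtUn 𝔞 𝔫) F.iSup_wtUn Λ P
    have h4 : ((P - F.proj Λ P : Un 𝔫) : UEnv 𝔤) = 0 :=
      Submodule.disjoint_def.1 (disjoint_homSub (iSupIndep_wtUg 𝔞) disjoint_compl_right) _
        (sub_mem h1 (hmap _ _ h3)) (hmap _ _ h2)
    have h5 : P - F.proj Λ P = 0 := Subtype.ext h4
    rw [sub_eq_zero.1 h5]
    exact h3
  · exact fun hP => ⟨P.2, (hUgΛ _).2 (hmap _ _ hP)⟩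

end WeightFrame

end Weights

namespace WeightFrame

variable {𝔤 : Type*} [LieRing 𝔤] [LieAlgebra ℂ 𝔤] {𝔞 𝔫 : LieSubalgebra ℂ 𝔤} [IsLieAbelian 𝔞]
  (F : WeightFrame 𝔞 𝔫)

theorem mem_span_gen_of_mem_wtUn {P : Un 𝔫} (hP : P ∈ inUn 𝔫) {μ : Module.Dual ℂ 𝔞}
    (hμ : P ∈ wtUn 𝔞 𝔫 μ) : P ∈ Submodule.span ℂ (F.gen '' {k | F.wt k = μ}) := by
  classical
  rw [← F.span_gen] at hP
  obtain ⟨c, rfl⟩ := (Submodule.mem_span_range_iff_exists_fun ℂ).1 hP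
  have hgen : ∀ k, F.gen k ∈ wtUn 𝔞 𝔫 (F.wt k) := fun k => by
    have := F.mon_mem [k]
    simpa [mon, monWt] using this
  rw [eq_sum_of_mem (iSupIndep_wtUn 𝔞 𝔫) Finset.univ F.wt (fun k => c k • F.gen k)
    (fun k _ => Submodule.smul_mem _ _ (hgen k)) μ hμ]
  refine sum_mem fun k hk => Submodule.smul_mem _ _ (Submodule.subset_span ⟨k, ?_, rfl⟩)
  exact (Finset.mem_filter.1 hk).2

include F in
/-- `U(𝔫)` is left Noetherian: adjoining the weight vectors in the order of decreasing height, each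
one normalizes the subalgebra generated by the previous ones. -/
theorem isNoetherianRing_Un : IsNoetherianRing (Un 𝔫) := by
  let σ := Tuple.sort fun i => -(F.deg i : ℤ)
  have hσ : ∀ i j : Fin F.d, i ≤ j → F.deg (σ j) ≤ F.deg (σ i) := fun i j hij => by
    have := Tuple.monotone_sort (fun i => -(F.deg i : ℤ)) hij
    simp only [Function.comp_apply, neg_le_neg_iff, Nat.cast_le] at this
    exact this
  let y : ℕ → Un 𝔫 := fun n => if h : n < F.d then F.gen (σ ⟨n, h⟩) else 0
  have hy : ∀ n (h : n < F.d), y n = F.gen (σ ⟨n, h⟩) := fun n h => dif_pos h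
  have hlower : ∀ i < F.d, ∀ j < i, y i * y j - y j * y i ∈
      Submodule.span ℂ (y '' Set.Iio i) := by
    intro i hi j hj
    rw [hy i hi, hy j (hj.trans hi)]
    set a := σ ⟨i, hi⟩ with ha
    set b := σ ⟨j, hj.trans hi⟩ with hb
    have hmem : ∀ k, F.x k ∈ 𝔫 := fun k =>
      (F.span_x ▸ Submodule.subset_span (Set.mem_range_self k) : _ ∈ 𝔫.toSubmodule)
    have h1 : F.gen a * F.gen b - F.gen b * F.gen a ∈ inUn 𝔫 :=
      ⟨⁅F.x a, F.x b⁆, 𝔫.lie_mem (hmem a) (hmem b), iota_lie _ _⟩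
    have h2 : F.gen a * F.gen b - F.gen b * F.gen a ∈ wtUn 𝔞 𝔫 (F.wt a + F.wt b) := by
      have hab := F.mon_mem [a, b]
      have hba := F.mon_mem [b, a]
      simp only [mon, monWt, List.map_cons, List.map_nil, List.prod_cons, List.prod_nil,
        List.sum_cons, List.sum_nil, mul_one, add_zero] at hab hba
      rw [add_comm] at hba
      exact sub_mem hab hba
    refine Submodule.span_mono ?_ (F.mem_span_gen_of_mem_wtUn h1 h2)
    rintro _ ⟨k, hk, rfl⟩
    replace hk : F.wt k = F.wt a + F.wt b := hk
    have hdeg : F.deg k = F.deg a + F.deg b := by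
      have := congrArg F.ht hk
      rw [map_add, F.ht_wt, F.ht_wt, F.ht_wt] at this
      exact_mod_cast this
    refine ⟨σ.symm k, ?_, ?_⟩
    · by_contra h
      have h3 := hσ ⟨i, hi⟩ (σ.symm k) (not_lt.1 h)
      rw [Equiv.apply_symm_apply, ← ha] at h3
      have := F.deg_pos b
      omega
    · rw [hy _ (σ.symm k).2]
      simp
  have h := isNoetherianRing_adjoin_of_lower y F.d hlower
  have htop : Algebra.adjoin ℂ (y '' Set.Iio F.d) = ⊤ := by
    refine eq_top_iff.2 ?_
    have h1 : (⊤ : Submodule ℂ (Un 𝔫)) ≤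
        Subalgebra.toSubmodule (Algebra.adjoin ℂ (y '' Set.Iio F.d)) := by
      rw [← F.span_mon, Submodule.span_le]
      rintro _ ⟨l, rfl⟩
      refine list_prod_mem (S := Algebra.adjoin ℂ (y '' Set.Iio F.d)) fun z hz => ?_
      obtain ⟨k, _, rfl⟩ := List.mem_map.1 hz
      refine Algebra.subset_adjoin ⟨σ.symm k, (σ.symm k).2, ?_⟩
      rw [hy _ (σ.symm k).2]
      simp
    exact h1
  rw [htop] at h
  exact isNoetherianRing_of_surjective _ (Un 𝔫)
    (Subalgebra.topEquiv (R := ℂ) (A := Un 𝔫)).toAlgHom.toRingHom Subalgebra.topEquiv.surjective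

end WeightFrame

/-! ### Submodules of free modules over a graded Noetherian ring are closed -/

section Closed

variable {Γ R : Type*} [AddCommGroup Γ] [Ring R] [Algebra ℂ R] {𝒜 : Γ → Submodule ℂ R}
  (hi : iSupIndep 𝒜) (htop : ⨆ μ, 𝒜 μ = ⊤)
  (hm : ∀ μ ν a b, a ∈ 𝒜 μ → b ∈ 𝒜 ν → a * b ∈ 𝒜 (μ + ν))
  (ht : Γ →+ ℝ) (Λ : AddSubgroup Γ)

/-- The degrees in `Λ` of height `t`. -/
def degEq (t : ℝ) : Set Γ := {μ | μ ∈ Λ ∧ ht μ = t}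

/-- The degrees in `Λ` whose height is an integer `≥ h`. -/
def degGe (h : ℕ) : Set Γ := {μ | μ ∈ Λ ∧ ∃ n : ℕ, h ≤ n ∧ ht μ = n}

omit [AddCommGroup Γ] in
theorem homSub_inter {T S : Set Γ} (hi : iSupIndep 𝒜) (htop : ⨆ μ, 𝒜 μ = ⊤) {y : R}
    (hy : y ∈ homSub 𝒜 T) (hy' : y ∈ homSub 𝒜 S) : y ∈ homSub 𝒜 (T ∩ S) := by
  rw [← wproj_of_mem hi htop hy']
  exact wproj_mem_inter hi htop hy

theorem sub_wproj_degEq_mem {h : ℕ} {y : R} (hy : y ∈ homSub 𝒜 (degGe ht Λ h)) :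
    y - wproj hi htop (degEq ht Λ h) y ∈ homSub 𝒜 (degGe ht Λ (h + 1)) := by
  refine homSub_mono ?_ (sub_wproj_mem hi htop hy)
  rintro μ ⟨⟨hμ, n, hn, hn'⟩, hne⟩
  refine ⟨hμ, n, Nat.lt_of_le_of_ne hn ?_, hn'⟩
  rintro rfl
  exact hne ⟨hμ, hn'⟩

include hi htop hm in
/-- Existence of a standard basis. Every element of height at least `h` of a `R_Λ`-submodule `K` of
`R_Λ ^ N` can be moved to height at least `h + 1` by subtracting a combination of finitely many
fixed elements of `K`, with homogeneous coefficients. The fixed elements are those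
whose lowest-height forms generate all the lowest-height forms of elements of `K`. -/
theorem exists_standardBasis [IsNoetherianRing R] {N : ℕ} (K : AddSubgroup (Fin N → R)) :
    ∃ (s : Finset (Fin N → R)) (κ : (Fin N → R) → Fin N → R) (d : (Fin N → R) → ℕ),
      (∀ τ ∈ s, κ τ ∈ K) ∧
      ∀ (h : ℕ), ∀ y ∈ K, (∀ j, y j ∈ homSub 𝒜 (degGe ht Λ h)) →
        ∃ r : (Fin N → R) → R, (∀ τ, r τ ∈ homSub 𝒜 (degEq ht Λ (h - d τ))) ∧
          ∀ j, y j - ∑ τ ∈ s, r τ * κ τ j ∈ homSub 𝒜 (degGe ht Λ (h + 1)) := by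
  let L : Set (Fin N → R) := {τ | ∃ y ∈ K, ∃ h : ℕ, (∀ j, y j ∈ homSub 𝒜 (degGe ht Λ h)) ∧
    τ = fun j => wproj hi htop (degEq ht Λ h) (y j)}
  obtain ⟨s, hs, hspan⟩ := Submodule.fg_span_iff_fg_span_finset_subset L |>.1
    (IsNoetherian.noetherian (Submodule.span R L))
  have hchoose : ∀ τ : Fin N → R, ∃ (y : Fin N → R) (h : ℕ), τ ∈ s → y ∈ K ∧
      (∀ j, y j ∈ homSub 𝒜 (degGe ht Λ h)) ∧
      τ = fun j => wproj hi htop (degEq ht Λ h) (y j) := by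
    intro τ
    by_cases hτ : τ ∈ s
    · obtain ⟨y, hy, h, h'⟩ := hs hτ
      exact ⟨y, h, fun _ => ⟨hy, h'⟩⟩
    · exact ⟨0, 0, fun h => absurd h hτ⟩
  choose κ d hκ using hchoose
  refine ⟨s, κ, d, fun τ hτ => (hκ τ hτ).1, fun h y hy hyh => ?_⟩
  have hmem : (fun j => wproj hi htop (degEq ht Λ h) (y j)) ∈ Submodule.span R (s : Set _) := by
    rw [← hspan]
    exact Submodule.subset_span ⟨y, hy, h, hyh, rfl⟩
  obtain ⟨a, -, ha⟩ := Submodule.mem_span_finset.1 hmem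
  refine ⟨fun τ => wproj hi htop (degEq ht Λ (h - d τ)) (a τ), fun τ => wproj_mem _ _ _ _,
    fun j => ?_⟩
  have hshift : ∀ τ, ∀ μ, ∀ ν ∈ degEq ht Λ (d τ),
      μ + ν ∈ degEq ht Λ h ↔ μ ∈ degEq ht Λ (h - d τ) := by
    rintro τ μ ν ⟨hν, hν'⟩
    constructor
    · rintro ⟨h1, h2⟩
      refine ⟨by simpa using sub_mem h1 hν, ?_⟩
      rw [map_add, hν'] at h2
      rw [← h2]; ring
    · rintro ⟨h1, h2⟩
      refine ⟨add_mem h1 hν, ?_⟩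
      rw [map_add, hν', h2]; ring
  -- The lowest-height form of `y` is a combination of those of the `κ τ`, with coefficients in
  -- `R_Λ`: projecting the coefficients to weights in `Λ` does not change it.
  have hlead : wproj hi htop (degEq ht Λ h) (y j) =
      ∑ τ ∈ s, wproj hi htop (degEq ht Λ (h - d τ)) (a τ) *
        wproj hi htop (degEq ht Λ (d τ)) (κ τ j) := by
    have h1 : wproj hi htop (degEq ht Λ h) (y j) = ∑ τ ∈ s, a τ * τ j := by
      have := congrFun ha j
      rw [← this, Finset.sum_apply]
      rfl
    calc wproj hi htop (degEq ht Λ h) (y j)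
        = wproj hi htop (degEq ht Λ h) (∑ τ ∈ s, a τ * τ j) := by
          rw [← h1, wproj_of_mem hi htop (wproj_mem hi htop _ _)]
      _ = _ := by
          rw [map_sum]
          refine Finset.sum_congr rfl fun τ hτ => ?_
          have h2 : τ j = wproj hi htop (degEq ht Λ (d τ)) (κ τ j) := congrFun (hκ τ hτ).2.2 j
          rw [← h2]
          exact wproj_mul hi htop hm (hshift τ) _ (h2 ▸ wproj_mem _ _ _ _)
  have hdecomp : y j - ∑ τ ∈ s, wproj hi htop (degEq ht Λ (h - d τ)) (a τ) * κ τ j =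
      (y j - wproj hi htop (degEq ht Λ h) (y j)) -
        ∑ τ ∈ s, wproj hi htop (degEq ht Λ (h - d τ)) (a τ) *
          (κ τ j - wproj hi htop (degEq ht Λ (d τ)) (κ τ j)) := by
    simp only [mul_sub, Finset.sum_sub_distrib]
    rw [← hlead]
    abel
  rw [hdecomp]
  refine sub_mem (sub_wproj_degEq_mem hi htop ht Λ (hyh j)) (sum_mem fun τ hτ => ?_)
  refine mul_mem_homSub hm (T := degEq ht Λ (h - d τ)) (T' := degGe ht Λ (d τ + 1)) ?_
    (wproj_mem _ _ _ _) (sub_wproj_degEq_mem hi htop ht Λ ((hκ τ hτ).2.1 j))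
  rintro μ ⟨hμ, hμ'⟩ ν ⟨hν, n, hn, hn'⟩
  refine ⟨add_mem hμ hν, h + (n - d τ), by omega, ?_⟩
  rw [map_add, hμ', hn', Nat.cast_add, Nat.cast_sub (by omega)]
  ring

end Closed

namespace InvLim

variable {R : Type*} [Ring R] [Algebra ℂ R] {V : Submodule ℂ R}

theorem Rep.congr {x : InvLim V} {k : ℕ} {p q : R} (h : Rep x k p) (hpq : p - q ∈ powIdeal V k) :
    Rep x k q :=
  ((Submodule.Quotient.eq _).2 hpq).symm.trans h

theorem Rep.sub {x y : InvLim V} {k : ℕ} {p q : R} (hp : Rep x k p) (hq : Rep y k q) :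
    Rep (x - y) k (p - q) := by
  rw [Rep, map_sub, ← hp, ← hq]; rfl

theorem Rep.sum {ι : Type*} (s : Finset ι) {x : ι → InvLim V} {k : ℕ} {p : ι → R}
    (h : ∀ i ∈ s, Rep (x i) k (p i)) : Rep (∑ i ∈ s, x i) k (∑ i ∈ s, p i) := by
  classical
  induction s using Finset.induction_on with
  | empty => exact rep_zero k
  | insert i s his ih =>
    rw [Finset.sum_insert his, Finset.sum_insert his]
    exact (h i (Finset.mem_insert_self i s)).add
      (ih fun j hj => h j (Finset.mem_insert_of_mem hj))

/-- Two elements with common representatives modulo every `V ^ k R` agree. -/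
theorem eq_of_rep {x y : InvLim V} (h : ∀ k, ∃ p, Rep x k p ∧ Rep y k p) : x = y :=
  ext fun k => by
    obtain ⟨p, hp, hp'⟩ := h k
    exact hp.symm.trans hp'

/-- A tuple in the closure of a `R_Λ`-submodule `K` of `R_Λ ^ N` is a combination of elements of `K`
with coefficients in the closure of `R_Λ`. -/
theorem exists_sum_of_mem_closure [LeftContinuous V] {Γ : Type*} [AddCommGroup Γ]
    {𝒜 : Γ → Submodule ℂ R} (hi : iSupIndep 𝒜) (htop : ⨆ μ, 𝒜 μ = ⊤)
    (hm : ∀ μ ν a b, a ∈ 𝒜 μ → b ∈ 𝒜 ν → a * b ∈ 𝒜 (μ + ν))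
    (ht : Γ →+ ℝ) (Λ : AddSubgroup Γ) [IsNoetherianRing R] (M : ℕ) (hM : 0 < M)
    (hV : ∀ k, powIdeal V k ≤ homSub 𝒜 {μ | ∃ n : ℕ, k ≤ n ∧ ht μ = n})
    (hV' : ∀ k, homSub 𝒜 {μ | ((M * k : ℕ) : ℝ) ≤ ht μ} ≤ powIdeal V k)
    {N : ℕ} (K : AddSubgroup (Fin N → R)) (hK : ∀ y ∈ K, ∀ j, y j ∈ homSub 𝒜 (Λ : Set Γ))
    (hK' : ∀ a ∈ homSub 𝒜 (Λ : Set Γ), ∀ y ∈ K, (fun j => a * y j) ∈ K)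
    (f : Fin N → InvLim V) (hf : ∀ k, ∃ y ∈ K, ∀ j, Rep (f j) k (y j)) :
    ∃ (s : Finset (Fin N → R)) (κ : (Fin N → R) → Fin N → R) (g : (Fin N → R) → InvLim V),
      (∀ τ ∈ s, κ τ ∈ K) ∧ (∀ τ k, ∃ p ∈ homSub 𝒜 (Λ : Set Γ), Rep (g τ) k p) ∧
      ∀ j, f j = ∑ τ ∈ s, g τ * of V (κ τ j) := by
  obtain ⟨s, κ, d, hκ, hstep⟩ := exists_standardBasis hi htop hm ht Λ K
  choose y hy hfy using hf
  -- The invariant of the successive approximation: `y_k - ∑ e_τ κ_τ` has height at least `k`.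
  let Good : ℕ → ((Fin N → R) → R) → Prop := fun k e =>
    (∀ τ, e τ ∈ homSub 𝒜 (Λ : Set Γ)) ∧
      ∀ j, y k j - ∑ τ ∈ s, e τ * κ τ j ∈ homSub 𝒜 (degGe ht Λ k)
  have hΛge : ∀ k, ∀ z ∈ homSub 𝒜 (Λ : Set Γ), z ∈ powIdeal V k →
      z ∈ homSub 𝒜 (degGe ht Λ k) := fun k z hz hz' =>
    homSub_mono (T' := degGe ht Λ k) (fun μ hμ => ⟨hμ.1, hμ.2⟩) (homSub_inter hi htop hz (hV k hz'))
  have h0 : Good 0 0 := by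
    refine ⟨fun τ => zero_mem _, fun j => ?_⟩
    simp only [Pi.zero_apply, zero_mul, Finset.sum_const_zero, sub_zero]
    exact hΛge 0 _ (hK _ (hy 0) j) (by rw [powIdeal_zero]; trivial)
  have hsucc : ∀ k e, Good k e → ∃ e', Good (k + 1) e' ∧
      ∀ τ, e' τ - e τ ∈ homSub 𝒜 (degEq ht Λ (k - d τ)) := by
    rintro k e ⟨he, he'⟩
    have hKmem : (fun j => y (k + 1) j - ∑ τ ∈ s, e τ * κ τ j) ∈ K := by
      have h1 : (fun j => y (k + 1) j - ∑ τ ∈ s, e τ * κ τ j) =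
          y (k + 1) - ∑ τ ∈ s, fun j => e τ * κ τ j := by
        ext j; simp
      rw [h1]
      exact sub_mem (hy _) (sum_mem fun τ hτ => hK' _ (he τ) _ (hκ τ hτ))
    obtain ⟨r, hr, hr'⟩ := hstep k _ hKmem (fun j => by
      have h2 : y (k + 1) j - y k j ∈ homSub 𝒜 (degGe ht Λ k) :=
        hΛge k _ (sub_mem (hK _ (hy _) j) (hK _ (hy _) j))
          (((hfy (k + 1) j).mono (Nat.le_succ k)).sub_mem (hfy k j))
      convert add_mem h2 (he' j) using 1
      abel)
    refine ⟨e + r, ⟨fun τ => add_mem (he τ) (homSub_mono (fun μ hμ => hμ.1) (hr τ)), fun j => ?_⟩,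
      fun τ => ?_⟩
    · convert hr' j using 1
      simp only [Pi.add_apply, add_mul, Finset.sum_add_distrib]
      abel
    · simpa using hr τ
  choose! next hnext hnext' using hsucc
  let e : ℕ → (Fin N → R) → R := fun k => Nat.rec 0 next k
  have he : ∀ k, Good k (e k) := fun k => by
    induction k with
    | zero => exact h0
    | succ k ih => exact hnext k _ ih
  have hed : ∀ (k : ℕ) τ, e (k + 1) τ - e k τ ∈ homSub 𝒜 (degEq ht Λ (k - d τ)) := fun k τ =>
    hnext' k _ (he k) τ
  let c : (Fin N → R) → ℕ → ℕ := fun τ n => M * n + d τ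
  have hc : ∀ τ n k, c τ n ≤ k → e k τ - e (c τ n) τ ∈ powIdeal V n := by
    intro τ n k hk
    induction k, hk using Nat.le_induction with
    | base => rw [sub_self]; exact zero_mem _
    | succ k hk ih =>
      have h1 : e (k + 1) τ - e k τ ∈ powIdeal V n := by
        refine hV' n (homSub_mono ?_ (hed k τ))
        rintro μ ⟨_, hμ⟩
        change ((M * n : ℕ) : ℝ) ≤ ht μ
        have h2 : ((M * n + d τ : ℕ) : ℝ) ≤ k := Nat.cast_le.2 hk
        rw [Nat.cast_add] at h2
        rw [hμ]
        linarith
      convert add_mem h1 ih using 1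
      abel
  let g : (Fin N → R) → InvLim V := fun τ => ofReps (fun n => e (c τ n) τ) (fun i k hik =>
    hc τ i _ (Nat.add_le_add_right (Nat.mul_le_mul_left M hik) _))
  have hg : ∀ τ n k, c τ n ≤ k → Rep (g τ) n (e k τ) := fun τ n k hk =>
    (rep_ofReps _ _ n).congr (by
      rw [← neg_sub]
      exact neg_mem (hc τ n k hk))
  refine ⟨s, κ, g, hκ, fun τ k => ⟨e (c τ k) τ, (he _).1 τ, rep_ofReps _ _ k⟩, fun j => ?_⟩
  refine eq_of_rep fun n => ?_
  let k := M * n + ∑ τ ∈ s, d τ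
  have hnk : n ≤ k := (Nat.le_mul_of_pos_left n hM).trans (Nat.le_add_right _ _)
  refine ⟨∑ τ ∈ s, e k τ * κ τ j, ?_, Rep.sum s fun τ hτ => ?_⟩
  · refine ((hfy k j).mono hnk).congr (hV' n (homSub_mono ?_ ((he k).2 j)))
    rintro μ ⟨_, m, hm, hm'⟩
    change ((M * n : ℕ) : ℝ) ≤ ht μ
    rw [hm', Nat.cast_le]
    exact (Nat.le_add_right _ _).trans hm
  · refine (hg τ n k (Nat.add_le_add_left ?_ _)).mul (fun z hz => modulus_spec _ _ hz) (rep_of _ _)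
    exact Finset.single_le_sum (f := d) (fun _ _ => Nat.zero_le _) hτ

end InvLim

/-! ### Generalized weight spaces and triangular bases -/

section WeightSpaces

variable {L : Type*} [LieRing L] [LieAlgebra ℂ L] [IsLieAbelian L]
variable (M : Type*) [AddCommGroup M] [Module ℂ M] [LieRingModule L M] [LieModule ℂ L M]
variable {M' : Type*} [AddCommGroup M'] [Module ℂ M'] [LieRingModule L M'] [LieModule ℂ L M']

/-- The generalized weight spaces, as a family of subspaces. -/
def genWt (χ : L → ℂ) : Submodule ℂ M := (LieModule.genWeightSpace M χ).toSubmodule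

theorem iSupIndep_genWt : iSupIndep (genWt M (L := L)) :=
  LieSubmodule.iSupIndep_toSubmodule.2 (LieModule.iSupIndep_genWeightSpace ℂ L M)

theorem iSup_genWt [FiniteDimensional ℂ M] : ⨆ χ, genWt M (L := L) χ = ⊤ := by
  have h := LieModule.iSup_genWeightSpace_eq_top ℂ L M
  have h' := congrArg LieSubmodule.toSubmodule h
  rwa [LieSubmodule.iSup_toSubmodule, LieSubmodule.top_toSubmodule] at h'

variable {M}

theorem mem_genWt {χ : L → ℂ} {m : M} : m ∈ genWt M χ ↔
    ∀ x : L, ∃ k : ℕ, ((LieModule.toEnd ℂ L M x - χ x • 1) ^ k) m = 0 :=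
  LieModule.mem_genWeightSpace M χ m

theorem lie_mem_genWt {χ : L → ℂ} {m : M} (hm : m ∈ genWt M χ) (x : L) : ⁅x, m⁆ ∈ genWt M χ :=
  (LieModule.genWeightSpace M χ).lie_mem hm

theorem map_mem_genWt (f : M →ₗ⁅ℂ,L⁆ M') {χ : L → ℂ} {m : M} (hm : m ∈ genWt M χ) :
    f m ∈ genWt M' χ :=
  LieModule.map_genWeightSpace_le f ((LieSubmodule.mem_map _).2 ⟨m, hm, rfl⟩)

/-- Generalized weight vectors lift along surjections of finite-dimensional modules. -/
theorem exists_lift_genWt [FiniteDimensional ℂ M] (f : M →ₗ⁅ℂ,L⁆ M')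
    {χ : L → ℂ} {m : M} (hm : f m ∈ genWt M' χ) : ∃ m₁ ∈ genWt M χ, f m₁ = f m := by
  have hi := iSupIndep_genWt M (L := L)
  have ht := iSup_genWt M (L := L)
  have h1 : wproj hi ht {χ} m ∈ genWt M χ := by
    have := wproj_mem hi ht {χ} m
    simpa [homSub] using this
  have h2 : m - wproj hi ht {χ} m ∈ homSub (genWt M (L := L)) {χ}ᶜ := by
    have := sub_wproj_mem hi ht (T := {χ}) (S := Set.univ) (y := m)
      (by rw [homSub_univ, ht]; trivial)
    rwa [← Set.compl_eq_univ_sdiff] at this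
  have h3 : homSub (genWt M (L := L)) {χ}ᶜ ≤
      (homSub (genWt M' (L := L)) {χ}ᶜ).comap (f : M →ₗ[ℂ] M') :=
    homSub_le.2 fun ν hν y hy => mem_homSub (T := {χ}ᶜ) hν (map_mem_genWt f hy)
  refine ⟨_, h1, Eq.symm (sub_eq_zero.1 ?_)⟩
  rw [← map_sub]
  refine Submodule.disjoint_def.1 (disjoint_homSub (iSupIndep_genWt M' (L := L))
    (T := {χ}) disjoint_compl_right) _ (mem_homSub (Set.mem_singleton χ) ?_) (h3 h2)
  rw [map_sub]
  exact sub_mem hm (map_mem_genWt f h1)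

/-- Simultaneous triangularization of a finite-dimensional module over an abelian Lie algebra, by
generalized weight vectors ordered by a given function of the weight. A common eigenvector for the
smallest weight is put last, and the vectors for the quotient by it are lifted to generalized weight
vectors. -/
theorem exists_triangular_family {α : Type*} [LinearOrder α] (key : Module.Dual ℂ L → α) (n : ℕ) :
    ∀ (M : Type*) [AddCommGroup M] [Module ℂ M] [LieRingModule L M] [LieModule ℂ L M]
      [FiniteDimensional ℂ M], Module.finrank ℂ M = n →
    ∃ (lam : Fin n → Module.Dual ℂ L) (v : Fin n → M),
      (∀ i j, i ≤ j → key (lam j) ≤ key (lam i)) ∧ (∀ i, v i ∈ genWt M (lam i)) ∧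
      (∀ i, v i ≠ 0) ∧ Submodule.span ℂ (Set.range v) = ⊤ ∧
      ∀ (H : L) i, ⁅H, v i⁆ - lam i H • v i ∈
        Submodule.span ℂ (v '' {j | i < j ∧ lam j = lam i}) := by
  induction n with
  | zero =>
    intro M _ _ _ _ _ hM
    have := Module.finrank_zero_iff.1 hM
    refine ⟨Fin.elim0, Fin.elim0, fun i => i.elim0, fun i => i.elim0, fun i => i.elim0, ?_,
      fun _ i => i.elim0⟩
    exact Subsingleton.elim _ _
  | succ n ih =>
    intro M _ _ _ _ _ hM
    have hnt : Nontrivial M := Module.nontrivial_of_finrank_pos (R := ℂ) (by omega)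
    have hne : Nonempty (LieModule.Weight ℂ L M) := by
      by_contra hempty
      rw [not_nonempty_iff] at hempty
      have h := LieModule.iSup_genWeightSpace_eq_top' ℂ L M
      rw [iSup_of_empty] at h
      exact bot_ne_top (α := Submodule ℂ M) (by
        have := congrArg LieSubmodule.toSubmodule h
        simp at this)
    obtain ⟨χ, hχ⟩ := Finite.exists_min
      (fun χ : LieModule.Weight ℂ L M => key (LieModule.Weight.toLinear ℂ L M χ))
    obtain ⟨e, he0, he⟩ := LieModule.exists_forall_lie_eq_smul ℂ L M χ
    set χ' := LieModule.Weight.toLinear ℂ L M χ with hχ'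
    have he' : ∀ x : L, ⁅x, e⁆ = χ' x • e := he
    have hχe : e ∈ genWt M χ' := by
      refine mem_genWt.2 fun x => ⟨1, ?_⟩
      rw [pow_one, LinearMap.sub_apply, LieModule.toEnd_apply_apply, he']
      simp
    let E : LieSubmodule ℂ L M :=
      { Submodule.span ℂ {e} with
        lie_mem := by
          intro x m hm
          obtain ⟨c, rfl⟩ := Submodule.mem_span_singleton.1 hm
          change ⁅x, c • e⁆ ∈ Submodule.span ℂ {e}
          rw [lie_smul, he']
          exact Submodule.smul_mem _ _ (Submodule.smul_mem _ _
            (Submodule.mem_span_singleton_self e)) }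
    have hE : ∀ m, m ∈ E ↔ ∃ c : ℂ, c • e = m := fun m => Submodule.mem_span_singleton
    have hfin : Module.finrank ℂ (M ⧸ E) = n := by
      have h1 := Submodule.finrank_quotient_add_finrank (Submodule.span ℂ {e})
      rw [finrank_span_singleton he0, hM] at h1
      exact Nat.succ_injective h1
    have : FiniteDimensional ℂ (M ⧸ E) :=
      inferInstanceAs (FiniteDimensional ℂ (M ⧸ Submodule.span ℂ {e}))
    obtain ⟨lam, vb, hanti, hwt, hnz, hspan, htri⟩ := ih (M ⧸ E) hfin
    have hlift : ∀ i, ∃ m ∈ genWt M (lam i), LieSubmodule.Quotient.mk' E m = vb i := by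
      intro i
      obtain ⟨m, hm⟩ := LieSubmodule.Quotient.surjective_mk' E (vb i)
      obtain ⟨m₁, h1, h2⟩ := exists_lift_genWt (LieSubmodule.Quotient.mk' E) (m := m)
        (χ := lam i) (hm ▸ hwt i)
      exact ⟨m₁, h1, h2.trans hm⟩
    choose w hw hwv using hlift
    have hker : ∀ m, LieSubmodule.Quotient.mk' E m = 0 → ∃ c : ℂ, c • e = m := fun m hm => by
      rw [← hE, ← LieSubmodule.Quotient.mk_eq_zero']
      exact hm
    have hwnz : ∀ i, w i ≠ 0 := fun i h => hnz i (by rw [← hwv, h, map_zero])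
    have hrange : Set.range (Fin.snoc w e : Fin (n + 1) → M) = insert e (Set.range w) := by
      rw [Fin.range_snoc]
    refine ⟨Fin.snoc lam χ', Fin.snoc w e, ?_, ?_, ?_, ?_, ?_⟩
    · intro i j h
      induction i using Fin.lastCases with
      | last => rw [Fin.last_le_iff.1 h]
      | cast i =>
        induction j using Fin.lastCases with
        | last =>
          rw [Fin.snoc_last, Fin.snoc_castSucc]
          have hb : LieModule.genWeightSpace M (lam i : L → ℂ) ≠ ⊥ := fun h => by
            have h1 : w i ∈ LieModule.genWeightSpace M (lam i : L → ℂ) := hw i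
            rw [h] at h1
            exact hwnz i ((LieSubmodule.mem_bot (w i)).1 h1)
          exact hχ ⟨_, hb⟩
        | cast j =>
          rw [Fin.snoc_castSucc, Fin.snoc_castSucc]
          exact hanti i j (Fin.castSucc_le_castSucc_iff.1 h)
    · refine Fin.lastCases ?_ fun i => ?_
      · rw [Fin.snoc_last, Fin.snoc_last]; exact hχe
      · rw [Fin.snoc_castSucc, Fin.snoc_castSucc]; exact hw i
    · refine Fin.lastCases ?_ fun i => ?_
      · rw [Fin.snoc_last]; exact he0
      · rw [Fin.snoc_castSucc]; exact hwnz i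
    · rw [hrange]
      refine eq_top_iff.2 fun m _ => ?_
      have h1 : LieSubmodule.Quotient.mk' E m ∈ Submodule.span ℂ (Set.range vb) := by
        rw [hspan]; trivial
      obtain ⟨c, hc⟩ := (Submodule.mem_span_range_iff_exists_fun ℂ).1 h1
      obtain ⟨a, ha⟩ := hker (m - ∑ i, c i • w i) (by
        rw [map_sub, map_sum, ← hc, sub_eq_zero]
        refine Finset.sum_congr rfl fun i _ => ?_
        rw [map_smul, hwv])
      rw [← sub_add_cancel m (∑ i, c i • w i), ← ha]
      refine add_mem (Submodule.smul_mem _ _ (Submodule.subset_span (Set.mem_insert _ _)))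
        (sum_mem fun i _ => Submodule.smul_mem _ _ (Submodule.subset_span
          (Set.mem_insert_of_mem _ (Set.mem_range_self i))))
    · intro H
      refine Fin.lastCases ?_ fun i => ?_
      · rw [Fin.snoc_last, Fin.snoc_last, he', sub_self]
        exact zero_mem _
      · rw [Fin.snoc_castSucc, Fin.snoc_castSucc]
        have hset : w '' {j | i < j ∧ lam j = lam i} ⊆ (Fin.snoc w e : Fin (n + 1) → M) ''
            {j | i.castSucc < j ∧ (Fin.snoc lam χ' : Fin (n + 1) → Module.Dual ℂ L) j = lam i} := by
          rintro _ ⟨j, hj, rfl⟩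
          refine ⟨j.castSucc, ⟨Fin.castSucc_lt_castSucc_iff.2 hj.1, ?_⟩, Fin.snoc_castSucc ..⟩
          rw [Fin.snoc_castSucc]; exact hj.2
        have hmem : LieSubmodule.Quotient.mk' E (⁅H, w i⁆ - lam i H • w i) ∈
            (Submodule.span ℂ (w '' {j | i < j ∧ lam j = lam i})).map
              (LieSubmodule.Quotient.mk' E : M →ₗ[ℂ] M ⧸ E) := by
          rw [Submodule.map_span, Set.image_image]
          have := htri H i
          convert this using 1
          · congr 1
            exact Set.image_congr fun j _ => hwv j
          · rw [map_sub, LieModuleHom.map_lie, map_smul, hwv]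
        obtain ⟨y, hy, hy'⟩ := hmem
        obtain ⟨c, hc⟩ := hker (⁅H, w i⁆ - lam i H • w i - y) (by
          rw [map_sub, sub_eq_zero]; exact hy'.symm)
        have hywt : y ∈ genWt M (lam i) := by
          refine (Submodule.span_le (p := genWt M (lam i : L → ℂ))).2 ?_ hy
          rintro _ ⟨j, hj, rfl⟩
          have := hw j
          rwa [hj.2] at this
        have hcwt : c • e ∈ genWt M (lam i) := by
          rw [hc]
          exact sub_mem (sub_mem (lie_mem_genWt (hw i) H) (Submodule.smul_mem _ _ (hw i))) hywt
        rw [← sub_add_cancel (⁅H, w i⁆ - lam i H • w i) y, ← hc]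
        refine add_mem ?_ (Submodule.span_mono hset hy)
        by_cases hχi : χ' = lam i
        · refine Submodule.smul_mem _ _ (Submodule.subset_span ⟨Fin.last n, ?_, Fin.snoc_last ..⟩)
          refine ⟨Fin.castSucc_lt_last i, ?_⟩
          rw [Fin.snoc_last]; exact hχi
        · have hne : (χ' : L → ℂ) ≠ lam i := fun h => hχi (DFunLike.coe_injective h)
          have h0 : c • e = 0 := Submodule.disjoint_def.1
            ((iSupIndep_genWt M (L := L)).pairwiseDisjoint hne) _
            (Submodule.smul_mem _ _ hχe) hcwt
          rw [h0]
          exact zero_mem _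

end WeightSpaces

/-! ### Modules over an algebra with a filtration and weights -/

section Filtered

set_option linter.unusedSectionVars false

variable {L : Type*} [LieRing L] [LieAlgebra ℂ L] [IsLieAbelian L]
  {A : Type*} [Ring A] [Algebra ℂ A] (I : ℕ → Submodule ℂ A) (W : Module.Dual ℂ L → Submodule ℂ A)
  (U : Type*) [AddCommGroup U] [Module ℂ U] [Module A U] [IsScalarTower ℂ A U]
  [LieRingModule L U] [LieModule ℂ L U]

/-- An `A`-module `U` with an action of the abelian Lie algebra `L`, where `A` is filtered by
two-sided ideals `I k` of finite codimension, spanned by weight vectors. The subspace `W μ` consists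
of elements of `A` of weight `μ`, and meets `I k` trivially for large `k`. -/
structure IsFilteredAction : Prop where
  zero : I 0 = ⊤
  anti : Antitone I
  mul_mem : ∀ {i j a b}, a ∈ I i → b ∈ I j → a * b ∈ I (i + j)
  finite : ∀ k, FiniteDimensional ℂ (A ⧸ I k)
  le_iSup : ∀ k, I k ≤ ⨆ μ, W μ ⊓ I k
  lie_smul : ∀ {μ P}, P ∈ W μ → ∀ (H : L) (x : U), ⁅H, P • x⁆ = μ H • P • x + P • ⁅H, x⁆
  bound : ∀ μ, ∃ k, W μ ⊓ I k = ⊥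

namespace IsFilteredAction

variable {I W U} (h : IsFilteredAction I W U)
include h

/-- The submodule `I k U`. -/
def fil (k : ℕ) : LieSubmodule ℂ L U :=
  { I k • (⊤ : Submodule ℂ U) with
    lie_mem := by
      intro H x hx
      change ⁅H, x⁆ ∈ I k • (⊤ : Submodule ℂ U)
      refine Submodule.smul_induction_on (p := fun x => ⁅H, x⁆ ∈ I k • (⊤ : Submodule ℂ U)) hx ?_ ?_
      · intro P hP x _
        refine Submodule.iSup_induction _ (motive := fun P => ⁅H, P • x⁆ ∈
          I k • (⊤ : Submodule ℂ U)) (h.le_iSup k hP) ?_ ?_ ?_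
        · intro μ P hP
          rw [h.lie_smul hP.1]
          exact add_mem (Submodule.smul_mem _ _ (Submodule.smul_mem_smul hP.2 trivial))
            (Submodule.smul_mem_smul hP.2 trivial)
        · rw [zero_smul, lie_zero]; exact zero_mem _
        · intro P P' hP hP'
          rw [add_smul, lie_add]; exact add_mem hP hP'
      · intro x y hx hy
        rw [lie_add]; exact add_mem hx hy }

theorem smul_mem_fil {k : ℕ} {P : A} (hP : P ∈ I k) (x : U) : P • x ∈ h.fil k :=
  Submodule.smul_mem_smul hP trivial

theorem fil_le {k : ℕ} {N : Submodule ℂ U} (hN : ∀ P ∈ I k, ∀ x : U, P • x ∈ N) {x : U}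
    (hx : x ∈ h.fil k) : x ∈ N :=
  (Submodule.smul_le.2 fun P hP x _ => hN P hP x : I k • (⊤ : Submodule ℂ U) ≤ N) hx

theorem fil_anti {i k : ℕ} (hik : i ≤ k) {x : U} (hx : x ∈ h.fil k) : x ∈ h.fil i :=
  h.fil_le (N := (h.fil i).toSubmodule) (fun _ hP x => h.smul_mem_fil (h.anti hik hP) x) hx

theorem smul_fil {i k : ℕ} {P : A} (hP : P ∈ I i) {x : U} (hx : x ∈ h.fil k) :
    P • x ∈ h.fil (i + k) := by
  refine h.fil_le (N := (h.fil (i + k)).toSubmodule.comap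
    (Algebra.lsmul ℂ ℂ U P)) (fun Q hQ y => ?_) hx
  change P • Q • y ∈ h.fil (i + k)
  rw [smul_smul]
  exact h.smul_mem_fil (h.mul_mem hP hQ) y

theorem smul_fil' {k : ℕ} (P : A) {x : U} (hx : x ∈ h.fil k) : P • x ∈ h.fil k := by
  have := h.smul_fil (i := 0) (P := P) (by rw [h.zero]; trivial) hx
  rwa [zero_add] at this

theorem mul_mem_right {k : ℕ} {P : A} (hP : P ∈ I k) (Q : A) : P * Q ∈ I k := by
  have := h.mul_mem (j := 0) (b := Q) hP (by rw [h.zero]; trivial)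
  rwa [add_zero] at this

/-- If `U` is generated by `u_1, …, u_N` over `A`, then so is `I k U` over `I k`. -/
theorem exists_of_mem_fil {N : ℕ} {u : Fin N → U}
    (hu : ∀ x : U, ∃ P : Fin N → A, x = ∑ j, P j • u j) {k : ℕ} {x : U} (hx : x ∈ h.fil k) :
    ∃ P : Fin N → A, (∀ j, P j ∈ I k) ∧ x = ∑ j, P j • u j := by
  refine Submodule.smul_induction_on (p := fun x => ∃ P : Fin N → A, (∀ j, P j ∈ I k) ∧
    x = ∑ j, P j • u j) hx ?_ ?_
  · intro P hP x _
    obtain ⟨Q, rfl⟩ := hu x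
    exact ⟨fun j => P * Q j, fun j => h.mul_mem_right hP _, by simp [Finset.smul_sum, mul_smul]⟩
  · rintro _ _ ⟨P, hP, rfl⟩ ⟨Q, hQ, rfl⟩
    exact ⟨P + Q, fun j => add_mem (hP j) (hQ j), by simp [add_smul, Finset.sum_add_distrib]⟩

theorem finite_quotient {N : ℕ} {u : Fin N → U}
    (hu : ∀ x : U, ∃ P : Fin N → A, x = ∑ j, P j • u j) (k : ℕ) :
    FiniteDimensional ℂ (U ⧸ h.fil k) := by
  have := h.finite k
  let φ : Fin N → (A ⧸ I k) →ₗ[ℂ] U ⧸ h.fil k := fun j =>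
    (I k).liftQ ((LieSubmodule.Quotient.mk' (h.fil k) : U →ₗ[ℂ] U ⧸ h.fil k).comp
      ((LinearMap.toSpanSingleton A U (u j)).restrictScalars ℂ)) (fun P hP => by
        rw [LinearMap.mem_ker]
        exact (LieSubmodule.Quotient.mk_eq_zero' (N := h.fil k)).2 (h.smul_mem_fil hP (u j)))
  refine Module.Finite.of_surjective (LinearMap.lsum ℂ (fun _ : Fin N => A ⧸ I k) ℂ φ) fun y => ?_
  obtain ⟨x, rfl⟩ := LieSubmodule.Quotient.surjective_mk' (h.fil k) y
  obtain ⟨P, rfl⟩ := hu x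
  refine ⟨fun j => Submodule.Quotient.mk (P j), ?_⟩
  rw [LinearMap.lsum_apply, LinearMap.sum_apply, map_sum]
  rfl

/-- `x` is a generalized weight vector of weight `χ` modulo `I k U`. -/
def IsWt (k : ℕ) (χ : Module.Dual ℂ L) (x : U) : Prop :=
  LieSubmodule.Quotient.mk' (h.fil k) x ∈ genWt (U ⧸ h.fil k) (χ : L → ℂ)

theorem isWt_iff {k : ℕ} {χ : Module.Dual ℂ L} {x : U} : h.IsWt k χ x ↔
    ∀ H : L, ∃ n : ℕ, ((LieModule.toEnd ℂ L U H - χ H • 1) ^ n) x ∈ h.fil k := by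
  refine mem_genWt.trans (forall_congr' fun H => exists_congr fun n => ?_)
  have key : ∀ (n : ℕ), ((LieModule.toEnd ℂ L (U ⧸ h.fil k) H - χ H • 1) ^ n)
      (LieSubmodule.Quotient.mk' (h.fil k) x) =
      LieSubmodule.Quotient.mk' (h.fil k) (((LieModule.toEnd ℂ L U H - χ H • 1) ^ n) x) := by
    intro n
    induction n with
    | zero => rfl
    | succ n ih =>
      rw [pow_succ', pow_succ', Module.End.mul_apply, Module.End.mul_apply, ih]
      rfl
  rw [key]
  exact LieSubmodule.Quotient.mk_eq_zero'

theorem IsWt.sub {k : ℕ} {χ : Module.Dual ℂ L} {x y : U} (hx : h.IsWt k χ x) (hy : h.IsWt k χ y) :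
    h.IsWt k χ (x - y) := by
  rw [IsWt, map_sub]; exact sub_mem hx hy

theorem IsWt.sum {ι : Type*} {s : Finset ι} {k : ℕ} {χ : Module.Dual ℂ L} {x : ι → U}
    (hx : ∀ i ∈ s, h.IsWt k χ (x i)) : h.IsWt k χ (∑ i ∈ s, x i) := by
  rw [IsWt, map_sum]; exact sum_mem hx

theorem IsWt.smul {k : ℕ} {χ : Module.Dual ℂ L} {x : U} (c : ℂ) (hx : h.IsWt k χ x) :
    h.IsWt k χ (c • x) := by
  rw [IsWt, map_smul]; exact Submodule.smul_mem _ _ hx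

theorem IsWt.lie {k : ℕ} {χ : Module.Dual ℂ L} {x : U} (H : L) (hx : h.IsWt k χ x) :
    h.IsWt k χ ⁅H, x⁆ := by
  rw [IsWt, LieModuleHom.map_lie]; exact lie_mem_genWt hx H

theorem IsWt.congr {k : ℕ} {χ : Module.Dual ℂ L} {x y : U} (hx : h.IsWt k χ x)
    (hxy : x - y ∈ h.fil k) : h.IsWt k χ y := by
  have h1 : LieSubmodule.Quotient.mk' (h.fil k) (x - y) = 0 :=
    LieSubmodule.Quotient.mk_eq_zero'.2 hxy
  rw [map_sub, sub_eq_zero] at h1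
  rw [IsWt, ← h1]; exact hx

theorem IsWt.weight_smul {k : ℕ} {χ μ : Module.Dual ℂ L} {P : A} (hP : P ∈ W μ) {x : U}
    (hx : h.IsWt k χ x) : h.IsWt k (χ + μ) (P • x) := by
  rw [isWt_iff] at hx ⊢
  intro H
  obtain ⟨n, hn⟩ := hx H
  refine ⟨n, ?_⟩
  have key : ∀ n : ℕ, ((LieModule.toEnd ℂ L U H - (χ + μ) H • 1) ^ n) (P • x) =
      P • ((LieModule.toEnd ℂ L U H - χ H • 1) ^ n) x := by
    intro n
    induction n with
    | zero => rfl
    | succ n ih =>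
      rw [pow_succ', pow_succ', Module.End.mul_apply, Module.End.mul_apply, ih]
      simp only [LinearMap.sub_apply, LieModule.toEnd_apply_apply, LinearMap.smul_apply,
        Module.End.one_apply, LinearMap.add_apply, h.lie_smul hP, add_smul, smul_sub]
      rw [smul_comm P (χ H)]
      abel
  rw [key]
  exact h.smul_fil' P hn

/-- A vector which is a generalized weight vector modulo `I k U` can be changed by an element of
`I k U` to be one modulo `I (k+1) U`. -/
theorem IsWt.exists_succ {N : ℕ} {u : Fin N → U}
    (hu : ∀ x : U, ∃ P : Fin N → A, x = ∑ j, P j • u j) {k : ℕ} {χ : Module.Dual ℂ L} {x : U}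
    (hx : h.IsWt k χ x) : ∃ y ∈ h.fil k, h.IsWt (k + 1) χ (x + y) := by
  have := h.finite_quotient hu (k + 1)
  let f : (U ⧸ h.fil (k + 1)) →ₗ⁅ℂ,L⁆ U ⧸ h.fil k :=
    { Submodule.factor (p := (h.fil (k + 1)).toSubmodule) (p' := (h.fil k).toSubmodule)
        (fun x hx => h.fil_anti (Nat.le_succ k) hx) with
      map_lie' := by
        intro H m
        obtain ⟨x, rfl⟩ := LieSubmodule.Quotient.surjective_mk' (h.fil (k + 1)) m
        rfl }
  have hf : ∀ z, f (LieSubmodule.Quotient.mk' (h.fil (k + 1)) z) =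
      LieSubmodule.Quotient.mk' (h.fil k) z := fun z => rfl
  obtain ⟨m, hm, hm'⟩ := exists_lift_genWt f
    (m := LieSubmodule.Quotient.mk' (h.fil (k + 1)) x) (χ := χ) hx
  obtain ⟨z, rfl⟩ := LieSubmodule.Quotient.surjective_mk' (h.fil (k + 1)) m
  refine ⟨z - x, ?_, ?_⟩
  · rw [hf, hf, ← sub_eq_zero, ← map_sub] at hm'
    exact LieSubmodule.Quotient.mk_eq_zero'.1 hm'
  · rw [add_sub_cancel]; exact hm

theorem exists_weight_seq {N : ℕ} {u : Fin N → U}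
    (hu : ∀ x : U, ∃ P : Fin N → A, x = ∑ j, P j • u j) {χ : Module.Dual ℂ L} (b₀ : Fin N → A)
    (hb₀ : h.IsWt 1 χ (∑ j, b₀ j • u j)) : ∃ b : ℕ → Fin N → A, b 0 = b₀ ∧
      (∀ k j, b (k + 1) j - b k j ∈ I (k + 1)) ∧ ∀ k, h.IsWt (k + 1) χ (∑ j, b k j • u j) := by
  have hstep : ∀ (k : ℕ) (b : Fin N → A), h.IsWt (k + 1) χ (∑ j, b j • u j) →
      ∃ b' : Fin N → A, (∀ j, b' j - b j ∈ I (k + 1)) ∧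
        h.IsWt (k + 1 + 1) χ (∑ j, b' j • u j) := by
    intro k b hb
    obtain ⟨y, hy, hy'⟩ := IsWt.exists_succ h hu hb
    obtain ⟨P, hP, rfl⟩ := h.exists_of_mem_fil hu hy
    refine ⟨b + P, fun j => by simpa using hP j, ?_⟩
    convert hy' using 1
    simp [add_smul, Finset.sum_add_distrib]
  choose! next h1 h2 using hstep
  let b : ℕ → Fin N → A := fun k => Nat.rec b₀ next k
  have hb : ∀ k, h.IsWt (k + 1) χ (∑ j, b k j • u j) := fun k => by
    induction k with
    | zero => exact hb₀
    | succ k ih => exact h2 k _ ih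
  exact ⟨b, rfl, fun k j => h1 k _ (hb k) j, hb⟩

section Adapted

variable {N r : ℕ} {u : Fin N → U} (hu : ∀ x : U, ∃ P : Fin N → A, x = ∑ j, P j • u j)
  {Abar : Fin N → Fin r → ℂ}
include hu

/-- If the `w_i` generate `U` over `ℂ` modulo `I 1 U`, they generate `I m U` over `I m` modulo every
`I (m + k) U`. -/
theorem exists_sub_mem_fil {w : Fin r → U} (hw : ∀ j, u j - ∑ i, Abar j i • w i ∈ h.fil 1)
    {m : ℕ} (k : ℕ) {x : U} (hx : x ∈ h.fil m) :
    ∃ P : Fin r → A, (∀ i, P i ∈ I m) ∧ x - ∑ i, P i • w i ∈ h.fil (m + k) := by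
  induction k with
  | zero => exact ⟨0, fun i => zero_mem _, by simpa using hx⟩
  | succ k ih =>
    obtain ⟨P, hP, hx'⟩ := ih
    obtain ⟨Q, hQ, hQ'⟩ := h.exists_of_mem_fil hu hx'
    refine ⟨fun i => P i + ∑ j, Abar j i • Q j, fun i => add_mem (hP i) (sum_mem fun j _ =>
      Submodule.smul_mem _ _ (h.anti (Nat.le_add_right m k) (hQ j))), ?_⟩
    have h1 : x - ∑ i, (P i + ∑ j, Abar j i • Q j) • w i =
        ∑ j, Q j • (u j - ∑ i, Abar j i • w i) := by
      have h2 : ∑ i, (∑ j, Abar j i • Q j) • w i = ∑ j, Q j • ∑ i, Abar j i • w i := by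
        simp only [Finset.sum_smul, Finset.smul_sum]
        rw [Finset.sum_comm]
        refine Finset.sum_congr rfl fun j _ => Finset.sum_congr rfl fun i _ => ?_
        rw [smul_assoc, smul_comm]
      simp only [add_smul, Finset.sum_add_distrib, smul_sub, Finset.sum_sub_distrib, h2]
      rw [← hQ']
      abel
    rw [h1, ← add_assoc]
    exact sum_mem fun j _ => h.smul_fil (hQ j) (hw j)

/-- A generalized weight vector of `I m U` modulo `I k U` is a combination of the generalized weight
vectors `w_i` whose coefficients are weight vectors. -/
theorem exists_weight_sub_mem_fil {w : Fin r → U}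
    (hw : ∀ j, u j - ∑ i, Abar j i • w i ∈ h.fil 1) {k m : ℕ} (hmk : m ≤ k)
    {lam : Fin r → Module.Dual ℂ L} (hwt : ∀ i, h.IsWt k (lam i) (w i))
    {χ : Module.Dual ℂ L} {x : U} (hx : x ∈ h.fil m) (hxt : h.IsWt k χ x) :
    ∃ P : Fin r → A, (∀ i, P i ∈ W (χ - lam i) ⊓ I m) ∧ x - ∑ i, P i • w i ∈ h.fil k := by
  classical
  obtain ⟨P, hP, hxP⟩ := h.exists_sub_mem_fil hu hw (k - m) hx
  rw [Nat.add_sub_cancel' hmk] at hxP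
  have hsplit : ∀ i, ∃ f : Module.Dual ℂ L →₀ A, (∀ μ, f μ ∈ W μ ⊓ I m) ∧
      (f.sum fun _ a => a) = P i := fun i =>
    (Submodule.mem_iSup_iff_exists_finsupp _ _).1 (h.le_iSup m (hP i))
  choose f hf hf' using hsplit
  let s : Finset (Σ _ : Fin r, Module.Dual ℂ L) := Finset.univ.sigma fun i => (f i).support
  let z : (Σ _ : Fin r, Module.Dual ℂ L) → U := fun p => f p.1 p.2 • w p.1
  have hsum : ∑ p ∈ s, z p = ∑ i, P i • w i := by
    rw [Finset.sum_sigma]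
    refine Finset.sum_congr rfl fun i _ => ?_
    rw [← hf' i, Finsupp.sum, Finset.sum_smul]
  have hfilter : ∑ p ∈ s with lam p.1 + p.2 = χ, z p = ∑ i, f i (χ - lam i) • w i := by
    rw [Finset.sum_filter, Finset.sum_sigma]
    refine Finset.sum_congr rfl fun i _ => ?_
    have h1 : ∀ μ : Module.Dual ℂ L, lam i + μ = χ ↔ μ = χ - lam i := fun μ => by
      rw [eq_sub_iff_add_eq, add_comm]
    simp only [h1]
    rw [Finset.sum_ite_eq']
    split_ifs with h2
    · rfl
    · rw [Finsupp.notMem_support_iff.1 h2, zero_smul]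
  have hxs : h.IsWt k χ (∑ p ∈ s, z p) := IsWt.congr h hxt (by rw [hsum]; exact hxP)
  have hz : ∀ p ∈ s, LieSubmodule.Quotient.mk' (h.fil k) (z p) ∈
      genWt (U ⧸ h.fil k) ((lam p.1 + p.2 : Module.Dual ℂ L) : L → ℂ) := fun p _ =>
    IsWt.weight_smul h (hf p.1 p.2).1 (hwt p.1)
  have hxs' : ∑ p ∈ s, LieSubmodule.Quotient.mk' (h.fil k) (z p) ∈
      genWt (U ⧸ h.fil k) (χ : L → ℂ) := by
    rw [← map_sum]; exact hxs
  have hind := (iSupIndep_genWt (U ⧸ h.fil k) (L := L)).comp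
    (f := fun μ : Module.Dual ℂ L => (μ : L → ℂ)) DFunLike.coe_injective
  have key := eq_sum_of_mem hind s (fun p => lam p.1 + p.2)
    (fun p => LieSubmodule.Quotient.mk' (h.fil k) (z p)) hz χ hxs'
  rw [← map_sum, ← map_sum, hfilter, hsum, ← sub_eq_zero, ← map_sub] at key
  refine ⟨fun i => f i (χ - lam i), fun i => hf i _, ?_⟩
  convert add_mem hxP (LieSubmodule.Quotient.mk_eq_zero'.1 key) using 1
  abel

/-- The rows of the matrix `Q(H)`. For a vector `y_k` in `I 1 U` which is a generalized weight
vector modulo `I (k+1) U`, and does not depend on `k` up to `I (k+1) U`, the coefficients with respect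
to the `w_i` can be chosen independently of `k`: they are determined by those for large `k`, since
`W μ` meets `I k` trivially for large `k`. -/
theorem exists_coeff {w : ℕ → Fin r → U} (hw : ∀ k j, u j - ∑ i, Abar j i • w k i ∈ h.fil 1)
    (hw' : ∀ k i, w (k + 1) i - w k i ∈ h.fil (k + 1))
    {lam : Fin r → Module.Dual ℂ L} (hwt : ∀ k i, h.IsWt (k + 1) (lam i) (w k i))
    {χ : Module.Dual ℂ L} {y : ℕ → U} (hy : ∀ k, y k ∈ h.fil 1)
    (hy' : ∀ k, y (k + 1) - y k ∈ h.fil (k + 1)) (hyt : ∀ k, h.IsWt (k + 1) χ (y k)) :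
    ∃ P : Fin r → A, (∀ i, P i ∈ W (χ - lam i) ⊓ I 1) ∧
      ∀ k, y k - ∑ i, P i • w k i ∈ h.fil (k + 1) := by
  have hK : ∃ K, ∀ i, W (χ - lam i) ⊓ I K = ⊥ := by
    choose K hK using fun i => h.bound (χ - lam i)
    refine ⟨∑ i, K i, fun i => ?_⟩
    rw [eq_bot_iff, ← hK i]
    exact inf_le_inf_left _ (h.anti (Finset.single_le_sum (f := K) (fun _ _ => Nat.zero_le _)
      (Finset.mem_univ i)))
  obtain ⟨K, hK⟩ := hK
  obtain ⟨P, hP, hPK⟩ := h.exists_weight_sub_mem_fil hu (hw K) (Nat.le_add_left 1 K) (hwt K)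
    (hy K) (hyt K)
  refine ⟨P, hP, ?_⟩
  let z : ℕ → U := fun k => y k - ∑ i, P i • w k i
  have hz : ∀ k, z (k + 1) - z k ∈ h.fil (k + 1) := fun k => by
    have h1 : z (k + 1) - z k = (y (k + 1) - y k) - ∑ i, P i • (w (k + 1) i - w k i) := by
      simp only [z, smul_sub, Finset.sum_sub_distrib]
      abel
    rw [h1]
    exact sub_mem (hy' k) (sum_mem fun i _ => h.smul_fil' _ (hw' k i))
  have hz' : ∀ i k, i ≤ k → z k - z i ∈ h.fil (i + 1) := fun i k hik => by
    induction k, hik using Nat.le_induction with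
    | base => rw [sub_self]; exact zero_mem _
    | succ k hik ih =>
      rw [← sub_add_sub_cancel (z (k + 1)) (z k) (z i)]
      exact add_mem (h.fil_anti (Nat.succ_le_succ hik) (hz k)) ih
  have hbig : ∀ k, K ≤ k → z k ∈ h.fil (k + 1) := fun k hk => by
    have h1 : z k ∈ h.fil K := by
      rw [← sub_add_cancel (z k) (z K)]
      exact h.fil_anti (Nat.le_succ K) (add_mem (hz' K k hk) hPK)
    have h2 : h.IsWt (k + 1) χ (z k) := by
      refine IsWt.sub h (hyt k) (IsWt.sum h fun i _ => ?_)
      have := IsWt.weight_smul h (hP i).1 (hwt k i)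
      rwa [add_sub_cancel] at this
    obtain ⟨P', hP', hP''⟩ := h.exists_weight_sub_mem_fil hu (hw k) (hk.trans (Nat.le_succ k))
      (hwt k) h1 h2
    have h0 : ∀ i, P' i = 0 := fun i => by
      have := hP' i
      rwa [hK i, Submodule.mem_bot] at this
    simpa [h0] using hP''
  intro k
  rcases le_total K k with hk | hk
  · exact hbig k hk
  · change z k ∈ h.fil (k + 1)
    rw [← sub_sub_cancel (z K) (z k)]
    exact sub_mem (h.fil_anti (Nat.succ_le_succ hk) (hbig K le_rfl)) (hz' k K hk)

/-- The rows of the matrix `A`, by successive approximation. -/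
theorem exists_seq_sub_mem_fil {w : ℕ → Fin r → U}
    (hw : ∀ k j, u j - ∑ i, Abar j i • w k i ∈ h.fil 1)
    (hw' : ∀ k i, w (k + 1) i - w k i ∈ h.fil (k + 1)) (j : Fin N) :
    ∃ a : ℕ → Fin r → A, (a 0 = fun i => algebraMap ℂ A (Abar j i)) ∧
      (∀ k i, a (k + 1) i - a k i ∈ I (k + 1)) ∧
      ∀ k, u j - ∑ i, a k i • w k i ∈ h.fil (k + 1) := by
  have hstep : ∀ (k : ℕ) (a : Fin r → A), u j - ∑ i, a i • w k i ∈ h.fil (k + 1) →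
      ∃ a' : Fin r → A, (∀ i, a' i - a i ∈ I (k + 1)) ∧
        u j - ∑ i, a' i • w (k + 1) i ∈ h.fil (k + 1 + 1) := by
    intro k a ha
    have h1 : u j - ∑ i, a i • w (k + 1) i ∈ h.fil (k + 1) := by
      have h2 : u j - ∑ i, a i • w (k + 1) i =
          (u j - ∑ i, a i • w k i) - ∑ i, a i • (w (k + 1) i - w k i) := by
        simp only [smul_sub, Finset.sum_sub_distrib]
        abel
      rw [h2]
      exact sub_mem ha (sum_mem fun i _ => h.smul_fil' _ (hw' k i))
    obtain ⟨P, hP, hP'⟩ := h.exists_sub_mem_fil hu (hw (k + 1)) 1 h1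
    refine ⟨a + P, fun i => by simpa using hP i, ?_⟩
    convert hP' using 1
    simp only [Pi.add_apply, add_smul, Finset.sum_add_distrib]
    abel
  choose! next h1 h2 using hstep
  let a : ℕ → Fin r → A := fun k => Nat.rec (fun i => algebraMap ℂ A (Abar j i)) next k
  have ha : ∀ k, u j - ∑ i, a k i • w k i ∈ h.fil (k + 1) := fun k => by
    induction k with
    | zero =>
      have := hw 0 j
      simpa [a, algebraMap_smul] using this
    | succ k ih => exact h2 k _ ih
  exact ⟨a, rfl, fun k i => h1 k _ (ha k) i, ha⟩

end Adapted

end IsFilteredAction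

end Filtered

/-! ### The filtration of `U(𝔫)_Λ` by powers of `𝔫` -/

section Concrete

variable {𝔤 : Type*} [LieRing 𝔤] [LieAlgebra ℂ 𝔤] {𝔞 𝔫 : LieSubalgebra ℂ 𝔤}

theorem mem_nUn_iff (P : Un 𝔫) : (P : UEnv 𝔤) ∈ nUn 𝔫 ↔ P ∈ powIdeal (inUn 𝔫) 1 := by
  have h2 : (⊤ : Submodule ℂ (Un 𝔫)).map (Un 𝔫).val.toLinearMap =
      Subalgebra.toSubmodule (Un 𝔫) := by
    ext y
    exact ⟨fun ⟨z, _, hz⟩ => hz ▸ z.2, fun hy => ⟨⟨y, hy⟩, trivial, rfl⟩⟩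
  have h : (powIdeal (inUn 𝔫) 1).map (Un 𝔫).val.toLinearMap = nUn 𝔫 := by
    rw [powIdeal, pow_one, Submodule.map_mul, map_val_inUn, h2, nUn]
  rw [← h]
  constructor
  · rintro ⟨Q, hQ, hQP⟩
    rwa [← Subtype.ext (a1 := Q) (a2 := P) hQP]
  · exact fun hP => ⟨P, hP, rfl⟩

variable (𝔞 𝔫) (Λ : AddSubgroup (Module.Dual ℂ 𝔞))

/-- The inclusion `U(𝔫)_Λ → U(𝔫)`. -/
def UnΛ.toUn : UnΛ 𝔞 𝔫 Λ →ₐ[ℂ] Un 𝔫 := Subalgebra.inclusion inf_le_left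

/-- The ideal `𝔫 ^ k U(𝔫) ∩ U(𝔫)_Λ` of `U(𝔫)_Λ`. -/
def powIdealΛ (k : ℕ) : Submodule ℂ (UnΛ 𝔞 𝔫 Λ) :=
  (powIdeal (inUn 𝔫) k).comap (UnΛ.toUn 𝔞 𝔫 Λ).toLinearMap

/-- The weight spaces of `U(𝔫)_Λ`. -/
def wtUnΛ (μ : Module.Dual ℂ 𝔞) : Submodule ℂ (UnΛ 𝔞 𝔫 Λ) :=
  (wtUn 𝔞 𝔫 μ).comap (UnΛ.toUn 𝔞 𝔫 Λ).toLinearMap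

variable {𝔞 𝔫 Λ}

theorem UnΛ.toUn_injective : Function.Injective (UnΛ.toUn 𝔞 𝔫 Λ) :=
  Subalgebra.inclusion_injective _

theorem mem_nUnΛ_iff (P : UnΛ 𝔞 𝔫 Λ) : (P : UEnv 𝔤) ∈ nUnΛ 𝔞 𝔫 Λ ↔ P ∈ powIdealΛ 𝔞 𝔫 Λ 1 := by
  change _ ↔ UnΛ.toUn 𝔞 𝔫 Λ P ∈ powIdeal (inUn 𝔫) 1
  rw [← mem_nUn_iff]
  exact ⟨fun h => h.1, fun h => ⟨h, P.2⟩⟩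

namespace WeightFrame

variable (F : WeightFrame 𝔞 𝔫)

include F in
theorem mul_mem_powIdeal_add {i j : ℕ} {a b : Un 𝔫} (ha : a ∈ powIdeal (inUn 𝔫) i)
    (hb : b ∈ powIdeal (inUn 𝔫) j) : a * b ∈ powIdeal (inUn 𝔫) (i + j) := by
  have h : powIdeal (inUn 𝔫) i * powIdeal (inUn 𝔫) j ≤ powIdeal (inUn 𝔫) (i + j) := by
    simp only [F.powIdeal_eq_span]
    rw [Submodule.span_mul_span]
    refine Submodule.span_mono ?_
    rintro _ ⟨_, ⟨l, hl, rfl⟩, _, ⟨l', hl', rfl⟩, rfl⟩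
    refine ⟨l ++ l', ?_, by simp [mon]⟩
    change i + j ≤ (l ++ l').length
    rw [List.length_append]
    exact add_le_add hl hl'
  exact h (Submodule.mul_mem_mul ha hb)

include F in
theorem finite_quotient_powIdeal (k : ℕ) : FiniteDimensional ℂ (Un 𝔫 ⧸ powIdeal (inUn 𝔫) k) := by
  have hfin : {l : List (Fin F.d) | l.length < k}.Finite := List.finite_length_lt _ k
  have htop : Submodule.span ℂ
      ((powIdeal (inUn 𝔫) k).mkQ '' (F.mon '' {l | l.length < k})) = ⊤ := by
    refine eq_top_iff.2 ?_
    rw [← Submodule.range_mkQ (powIdeal (inUn 𝔫) k), LinearMap.range_eq_map, ← F.span_mon,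
      Submodule.map_span, Submodule.span_le]
    rintro _ ⟨_, ⟨l, rfl⟩, rfl⟩
    rcases lt_or_ge l.length k with h | h
    · exact Submodule.subset_span ⟨_, ⟨l, h, rfl⟩, rfl⟩
    · have h1 : F.mon l ∈ powIdeal (inUn 𝔫) k := by
        rw [F.powIdeal_eq_span]
        exact Submodule.subset_span ⟨l, h, rfl⟩
      have h2 : (powIdeal (inUn 𝔫) k).mkQ (F.mon l) = 0 := (Submodule.Quotient.mk_eq_zero _).2 h1
      rw [h2]
      exact zero_mem _
  exact ⟨⟨((hfin.image F.mon).image _).toFinset, by rw [Set.Finite.coe_toFinset]; exact htop⟩⟩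

include F in
/-- `U(𝔫)_Λ = ℂ ⊕ (𝔫 U(𝔫))_Λ`. -/
theorem exists_sub_mem_powIdealΛ (P : UnΛ 𝔞 𝔫 Λ) :
    ∃ c : ℂ, P - algebraMap ℂ _ c ∈ powIdealΛ 𝔞 𝔫 Λ 1 := by
  have h : ∀ Q : Un 𝔫, ∃ c : ℂ, Q - algebraMap ℂ _ c ∈ powIdeal (inUn 𝔫) 1 := by
    intro Q
    have hQ : Q ∈ Submodule.span ℂ (Set.range F.mon) := by rw [F.span_mon]; trivial
    induction hQ using Submodule.span_induction with
    | zero => exact ⟨0, by simp⟩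
    | add Q Q' _ _ h h' =>
      obtain ⟨c, hc⟩ := h
      obtain ⟨c', hc'⟩ := h'
      refine ⟨c + c', ?_⟩
      convert add_mem hc hc' using 1
      rw [map_add]; abel
    | smul a Q _ h =>
      obtain ⟨c, hc⟩ := h
      refine ⟨a * c, ?_⟩
      convert Submodule.smul_mem _ a hc using 1
      rw [smul_sub, map_mul, Algebra.smul_def, Algebra.smul_def]
    | mem Q hQ =>
      obtain ⟨l, rfl⟩ := hQ
      rcases l with _ | ⟨i, l⟩
      · exact ⟨1, by simp [mon]⟩
      · refine ⟨0, ?_⟩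
        rw [map_zero, sub_zero, F.powIdeal_eq_span]
        exact Submodule.subset_span ⟨i :: l, Nat.succ_pos _, rfl⟩
  obtain ⟨c, hc⟩ := h (UnΛ.toUn 𝔞 𝔫 Λ P)
  refine ⟨c, ?_⟩
  change UnΛ.toUn 𝔞 𝔫 Λ (P - algebraMap ℂ _ c) ∈ powIdeal (inUn 𝔫) 1
  rw [map_sub, AlgHom.commutes]
  exact hc

variable [IsLieAbelian 𝔞]

include F in
theorem powIdealΛ_le_iSup (k : ℕ) :
    powIdealΛ 𝔞 𝔫 Λ k ≤ ⨆ μ, wtUnΛ 𝔞 𝔫 Λ μ ⊓ powIdealΛ 𝔞 𝔫 Λ k := by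
  let π : Un 𝔫 →ₗ[ℂ] UnΛ 𝔞 𝔫 Λ :=
    { toFun := fun P => ⟨F.proj Λ P, (F.mem_UnΛ_iff Λ _).2 (F.proj_mem Λ P)⟩
      map_add' := fun P Q => UnΛ.toUn_injective (map_add (F.proj Λ) P Q)
      map_smul' := fun c P => UnΛ.toUn_injective (map_smul (F.proj Λ) c P) }
  have hπ : ∀ P, UnΛ.toUn 𝔞 𝔫 Λ (π P) = F.proj Λ P := fun P => rfl
  have h : powIdeal (inUn 𝔫) k ≤
      (⨆ μ, wtUnΛ 𝔞 𝔫 Λ μ ⊓ powIdealΛ 𝔞 𝔫 Λ k : Submodule ℂ (UnΛ 𝔞 𝔫 Λ)).comap π := by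
    conv_lhs => rw [F.powIdeal_eq_span]
    rw [Submodule.span_le]
    rintro _ ⟨l, hl, rfl⟩
    refine Submodule.mem_iSup_of_mem (F.monWt l) ⟨?_, ?_⟩
    · change UnΛ.toUn 𝔞 𝔫 Λ (π (F.mon l)) ∈ wtUn 𝔞 𝔫 (F.monWt l)
      rw [hπ, proj_mon]
      split_ifs
      · exact F.mon_mem l
      · exact zero_mem _
    · change UnΛ.toUn 𝔞 𝔫 Λ (π (F.mon l)) ∈ powIdeal (inUn 𝔫) k
      rw [hπ]
      refine F.proj_mem_powIdeal _ k ?_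
      rw [F.powIdeal_eq_span]
      exact Submodule.subset_span ⟨l, hl, rfl⟩
  intro P hP
  have h1 : π (UnΛ.toUn 𝔞 𝔫 Λ P) = P :=
    UnΛ.toUn_injective
      (F.proj_of_mem ((F.mem_UnΛ_iff Λ (UnΛ.toUn 𝔞 𝔫 Λ P)).1 P.2))
  have h2 : π (UnΛ.toUn 𝔞 𝔫 Λ P) ∈ ⨆ μ, wtUnΛ 𝔞 𝔫 Λ μ ⊓ powIdealΛ 𝔞 𝔫 Λ k :=
    h (x := UnΛ.toUn 𝔞 𝔫 Λ P) hP
  rwa [h1] at h2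

include F in
/-- The filtration of `U(𝔫)_Λ` by powers of `𝔫` acts on any `U(𝔤)_Λ`-module. -/
theorem isFilteredAction (U : Type*) [AddCommGroup U] [Module (UgΛ 𝔞 Λ) U] [Module ℂ U]
    [Module (UnΛ 𝔞 𝔫 Λ) U] [LieRingModule 𝔞 U]
    (hsmul : ∀ (P : UnΛ 𝔞 𝔫 Λ) (x : U), P • x = Subalgebra.inclusion (UnΛ_le 𝔞 𝔫 Λ) P • x)
    (hlie : ∀ (H : 𝔞) (x : U), ⁅H, x⁆ = aToUgΛ 𝔞 Λ H • x) [IsScalarTower ℂ (UgΛ 𝔞 Λ) U] :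
    IsFilteredAction (powIdealΛ 𝔞 𝔫 Λ) (wtUnΛ 𝔞 𝔫 Λ) U where
  zero := by
    rw [powIdealΛ, powIdeal_zero, Submodule.comap_top]
  anti i k hik := Submodule.comap_mono (powIdeal_antitone _ hik)
  mul_mem {i j a b} ha hb := by
    change UnΛ.toUn 𝔞 𝔫 Λ (a * b) ∈ powIdeal (inUn 𝔫) (i + j)
    rw [map_mul]
    exact F.mul_mem_powIdeal_add ha hb
  finite k := by
    have := F.finite_quotient_powIdeal k
    refine FiniteDimensional.of_injective
      (Submodule.mapQ (powIdealΛ 𝔞 𝔫 Λ k) (powIdeal (inUn 𝔫) k) (UnΛ.toUn 𝔞 𝔫 Λ).toLinearMap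
        (fun _ hP => hP)) ((injective_iff_map_eq_zero _).2 fun y => ?_)
    obtain ⟨P, rfl⟩ := Submodule.Quotient.mk_surjective _ y
    intro hP
    have hP' : (Submodule.Quotient.mk (UnΛ.toUn 𝔞 𝔫 Λ P) : Un 𝔫 ⧸ powIdeal (inUn 𝔫) k) = 0 := hP
    have hP'' := (Submodule.Quotient.mk_eq_zero (powIdeal (inUn 𝔫) k)).1 hP'
    exact (Submodule.Quotient.mk_eq_zero (powIdealΛ 𝔞 𝔫 Λ k)).2 hP''
  le_iSup k := F.powIdealΛ_le_iSup k
  lie_smul {μ P} hP H x := by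
    have hP' : iota (H : 𝔤) * (P : UEnv 𝔤) - (P : UEnv 𝔤) * iota (H : 𝔤) =
        μ H • (P : UEnv 𝔤) := hP H
    have h : aToUgΛ 𝔞 Λ H * Subalgebra.inclusion (UnΛ_le 𝔞 𝔫 Λ) P =
        μ H • Subalgebra.inclusion (UnΛ_le 𝔞 𝔫 Λ) P +
          Subalgebra.inclusion (UnΛ_le 𝔞 𝔫 Λ) P * aToUgΛ 𝔞 Λ H :=
      Subtype.ext (sub_eq_iff_eq_add.1 hP')
    rw [hlie, hlie, hsmul, hsmul, smul_smul, h, add_smul, smul_assoc, mul_smul]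
  bound μ := by
    obtain ⟨k, hk⟩ := exists_nat_gt (F.ht μ)
    refine ⟨k, (Submodule.eq_bot_iff _).2 fun P hP => ?_⟩
    have := F.wtUn_inf_powIdeal_eq_bot hk hP.1 hP.2
    exact UnΛ.toUn_injective (this.trans (map_zero _).symm)

end WeightFrame

end Concrete

/-! ### The eigenvalues and the triangular basis of `Ū` -/

namespace SimpleSystem

variable {𝔤₀ : Type*} [LieRing 𝔤₀] [LieAlgebra ℝ 𝔤₀] {C : CartanData 𝔤₀} (S : SimpleSystem C)

theorem exists_weightFrame [FiniteDimensional ℝ 𝔤₀] :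
    ∃ F : WeightFrame C.𝔞 S.𝔫, Set.range F.wt ⊆ S.posRoots := by
  classical
  have hspan : Submodule.span ℂ (⋃ α : S.posRoots, (C.rootSpace α : Set (Complexification 𝔤₀))) =
      S.𝔫.toSubmodule := (Submodule.iSup_eq_span _).symm
  have hfg : (Submodule.span ℂ
      (⋃ α : S.posRoots, (C.rootSpace α : Set (Complexification 𝔤₀)))).FG :=
    IsNoetherian.noetherian _
  obtain ⟨s, hs, hs'⟩ := (Submodule.fg_span_iff_fg_span_finset_subset _).1 hfg
  have hmem : ∀ y : s, ∃ α : S.posRoots, (y : Complexification 𝔤₀) ∈ C.rootSpace α := fun y => by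
    obtain ⟨α, hα⟩ := Set.mem_iUnion.1 (hs y.2)
    exact ⟨α, hα⟩
  choose α hα using hmem
  have hdeg : ∀ α : S.posRoots, ∃ n : ℕ, S.height α = n := fun α => by
    obtain ⟨c, hc⟩ := α.2.2
    exact ⟨∑ i, c i, by rw [hc, S.height_sum, Nat.cast_sum]⟩
  choose deg hdeg using hdeg
  refine ⟨{ d := s.card
            x := fun i => (s.equivFin.symm i : Complexification 𝔤₀)
            wt := fun i => α (s.equivFin.symm i)
            lie_x := fun H i => hα (s.equivFin.symm i) H
            span_x := ?_
            ht := S.height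
            deg := fun i => deg (α (s.equivFin.symm i))
            deg_pos := fun i => ?_
            ht_wt := fun i => hdeg _ }, ?_⟩
  · have : Set.range (fun i => (s.equivFin.symm i : Complexification 𝔤₀)) = s := by
      rw [show (fun i => (s.equivFin.symm i : Complexification 𝔤₀)) =
        Subtype.val ∘ s.equivFin.symm from rfl, Set.range_comp, Equiv.range_eq_univ, Set.image_univ,
        Subtype.range_coe]
    rw [this, ← hs', hspan]
  · have h := S.one_le_height (α (s.equivFin.symm i)).2
    rw [hdeg, Nat.one_le_cast] at h
    exact h
  · rintro _ ⟨i, rfl⟩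
    exact (α (s.equivFin.symm i)).2

/-- A nonzero element `λ - μ` of the cone `𝒫⁺` makes `Re λ` greater than `Re μ`. -/
theorem reLex_lt_of_sub_mem {lam mu : Module.Dual ℂ C.𝔞} (h : lam - mu ∈ S.coneP) (hne : lam ≠ mu) :
    S.reLex mu < S.reLex lam := by
  have hcone : ∀ ν ∈ S.coneP, ∃ c : Fin S.l → ℕ, ν = ∑ i, c i • S.simple i := by
    intro ν hν
    induction hν using AddSubmonoid.closure_induction with
    | mem ν hν => exact hν.2
    | zero => exact ⟨0, by simp⟩
    | add ν ν' _ _ h h' =>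
      obtain ⟨c, rfl⟩ := h
      obtain ⟨d, rfl⟩ := h'
      exact ⟨c + d, by simp [add_smul, Finset.sum_add_distrib]⟩
  obtain ⟨c, hc⟩ := hcone _ h
  have hle : ∀ i, (S.simple.repr lam i).re = (S.simple.repr mu i).re + c i := fun i => by
    have h1 : S.simple.repr lam = S.simple.repr mu + S.simple.repr (∑ i, c i • S.simple i) := by
      rw [← hc, ← map_add, add_sub_cancel]
    have h2 : S.simple.repr (∑ i, c i • S.simple i) i = c i := by
      have : ∑ i, c i • S.simple i = ∑ i, (c i : ℂ) • S.simple i :=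
        Finset.sum_congr rfl fun i _ => (Nat.cast_smul_eq_nsmul ℂ _ _).symm
      rw [this, Module.Basis.repr_sum_self]
    rw [h1, Finsupp.add_apply, h2, Complex.add_re, Complex.natCast_re]
  have hc0 : c ≠ 0 := by
    rintro rfl
    refine hne (sub_eq_zero.1 ?_)
    simpa using hc
  refine Pi.toLex_strictMono (lt_of_le_of_ne (fun i => ?_) fun heq => hc0 ?_)
  · change (S.simple.repr mu i).re ≤ (S.simple.repr lam i).re
    rw [hle]
    exact le_add_of_nonneg_right (Nat.cast_nonneg _)
  · ext i
    have h1 : (S.simple.repr mu i).re = (S.simple.repr lam i).re := congrFun heq i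
    rw [hle] at h1
    have h2 : (c i : ℝ) = 0 := by linarith
    simpa using h2

end SimpleSystem

section Ubar

variable {𝔤 : Type*} [LieRing 𝔤] [LieAlgebra ℂ 𝔤] {𝔞 𝔫 : LieSubalgebra ℂ 𝔤} [IsLieAbelian 𝔞]
  {Λ : AddSubgroup (Module.Dual ℂ 𝔞)} {U : Type*} [AddCommGroup U] [Module (UgΛ 𝔞 Λ) U] [Module ℂ U]
  [IsScalarTower ℂ (UgΛ 𝔞 Λ) U]

variable (𝔞 𝔫 Λ U) in
/-- The action of `U(𝔫)_Λ` on a `U(𝔤)_Λ`-module. -/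
@[reducible] def unModule : Module (UnΛ 𝔞 𝔫 Λ) U :=
  Module.compHom U (Subalgebra.inclusion (UnΛ_le 𝔞 𝔫 Λ)).toRingHom

omit [IsLieAbelian 𝔞] in
theorem unModule_isScalarTower :
    letI := unModule 𝔞 𝔫 Λ U
    IsScalarTower ℂ (UnΛ 𝔞 𝔫 Λ) U :=
  letI := unModule 𝔞 𝔫 Λ U
  ⟨fun c P x => by
    change Subalgebra.inclusion (UnΛ_le 𝔞 𝔫 Λ) (c • P) • x =
      c • (Subalgebra.inclusion (UnΛ_le 𝔞 𝔫 Λ) P • x)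
    rw [map_smul, smul_assoc]⟩

variable (𝔞 Λ U) in
/-- The action of the Lie algebra `𝔞` on a `U(𝔤)_Λ`-module. -/
@[reducible] def aLieRingModule : LieRingModule 𝔞 U where
  bracket H x := aToUgΛ 𝔞 Λ H • x
  add_lie H H' x := by
    change aToUgΛ 𝔞 Λ (H + H') • x = aToUgΛ 𝔞 Λ H • x + aToUgΛ 𝔞 Λ H' • x
    rw [← add_smul]
    congr 1
    exact Subtype.ext (map_add iota (H : 𝔤) (H' : 𝔤))
  lie_add H x y := smul_add _ x y
  leibniz_lie H H' x := by
    change aToUgΛ 𝔞 Λ H • aToUgΛ 𝔞 Λ H' • x =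
      aToUgΛ 𝔞 Λ ⁅H, H'⁆ • x + aToUgΛ 𝔞 Λ H' • aToUgΛ 𝔞 Λ H • x
    rw [smul_smul, smul_smul, ← add_smul]
    congr 1
    refine Subtype.ext ?_
    change iota (H : 𝔤) * iota (H' : 𝔤) =
      iota (⁅H, H'⁆ : 𝔞).1 + iota (H' : 𝔤) * iota (H : 𝔤)
    rw [LieSubalgebra.coe_bracket, iota_lie]
    abel

theorem aLieModule :
    letI := aLieRingModule 𝔞 Λ U
    LieModule ℂ 𝔞 U :=
  letI := aLieRingModule 𝔞 Λ U
  { smul_lie := fun c H x => by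
      change aToUgΛ 𝔞 Λ (c • H) • x = c • aToUgΛ 𝔞 Λ H • x
      rw [← smul_assoc]
      congr 1
      exact Subtype.ext (map_smul iota c (H : 𝔤))
    lie_smul := fun c H x => by
      change aToUgΛ 𝔞 Λ H • c • x = c • aToUgΛ 𝔞 Λ H • x
      exact (Algebra.lsmul ℂ ℂ U (aToUgΛ 𝔞 Λ H)).map_smul c x }

omit [IsScalarTower ℂ (UgΛ 𝔞 Λ) U] in
theorem fil_one_eq [Module (UnΛ 𝔞 𝔫 Λ) U] [IsScalarTower ℂ (UnΛ 𝔞 𝔫 Λ) U] [LieRingModule 𝔞 U]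
    [LieModule ℂ 𝔞 U] (h : IsFilteredAction (powIdealΛ 𝔞 𝔫 Λ) (wtUnΛ 𝔞 𝔫 Λ) U)
    (hsmul : ∀ (P : UnΛ 𝔞 𝔫 Λ) (x : U), P • x = Subalgebra.inclusion (UnΛ_le 𝔞 𝔫 Λ) P • x) :
    (h.fil 1).toSubmodule = nUnΛU 𝔞 𝔫 Λ U := by
  refine le_antisymm (fun x hx => h.fil_le (fun P hP x => ?_) hx) (Submodule.span_le.2 ?_)
  · exact Submodule.subset_span ⟨_, x, (mem_nUnΛ_iff P).2 hP, hsmul P x⟩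
  · rintro _ ⟨P, x, hP, rfl⟩
    have h1 : P • x = (⟨P, hP.2⟩ : UnΛ 𝔞 𝔫 Λ) • x := by rw [hsmul]; rfl
    rw [h1]
    exact h.smul_mem_fil ((mem_nUnΛ_iff _).1 hP) x

end Ubar

namespace SimpleSystem

variable {𝔤₀ : Type*} [LieRing 𝔤₀] [LieAlgebra ℝ 𝔤₀] {C : CartanData 𝔤₀} (S : SimpleSystem C)

/-- The constant data come from a simultaneous triangularization of the action of `𝔞` on `Ū`. -/
theorem nonempty_constantData {Λ : AddSubgroup (Module.Dual ℂ C.𝔞)}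
    {U : Type*} [AddCommGroup U] [Module (UgΛ C.𝔞 Λ) U] [Module ℂ U]
    [IsScalarTower ℂ (UgΛ C.𝔞 Λ) U] [Module (UnΛ C.𝔞 S.𝔫 Λ) U]
    [IsScalarTower ℂ (UnΛ C.𝔞 S.𝔫 Λ) U] [LieRingModule C.𝔞 U] [LieModule ℂ C.𝔞 U]
    (F : WeightFrame C.𝔞 S.𝔫) (h : IsFilteredAction (powIdealΛ C.𝔞 S.𝔫 Λ) (wtUnΛ C.𝔞 S.𝔫 Λ) U)
    (hsmul : ∀ (P : UnΛ C.𝔞 S.𝔫 Λ) (x : U), P • x = Subalgebra.inclusion (UnΛ_le C.𝔞 S.𝔫 Λ) P • x)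
    (hlie : ∀ (H : C.𝔞) (x : U), ⁅H, x⁆ = aToUgΛ C.𝔞 Λ H • x) {N : ℕ} (u : Fin N → U)
    (hu : ∀ x : U, ∃ P : Fin N → UnΛ C.𝔞 S.𝔫 Λ, x = ∑ j, P j • u j) :
    Nonempty (S.ConstantData Λ u) := by
  have := h.finite_quotient hu 1
  obtain ⟨lam, v, hanti, -, -, hspan, htri⟩ := exists_triangular_family S.reLex
    (Module.finrank ℂ (U ⧸ h.fil 1)) (U ⧸ h.fil 1) rfl
  let b := basisOfTopLeSpanOfCardEqFinrank v hspan.ge (by simp)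
  have hb : ∀ i, b i = v i := fun i => by simp [b]
  let E : (U ⧸ h.fil 1) ≃ₗ[ℂ] Ubar C.𝔞 S.𝔫 Λ U := Submodule.quotEquivOfEq _ _
    (fil_one_eq h hsmul)
  have hE : ∀ x : U, E (LieSubmodule.Quotient.mk' (h.fil 1) x) = Submodule.Quotient.mk x :=
    fun x => rfl
  have hEa : ∀ (H : C.𝔞) (y : U ⧸ h.fil 1), aBar C.𝔞 S.𝔫 Λ U H (E y) = E ⁅H, y⁆ := fun H y => by
    obtain ⟨x, rfl⟩ := LieSubmodule.Quotient.surjective_mk' (h.fil 1) y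
    rw [← LieModuleHom.map_lie, hE, hE, hlie]
    rfl
  have hzero : ∀ (H : C.𝔞) i j, ¬ (i < j ∧ lam j = lam i) →
      b.repr ⁅H, b i⁆ j - lam i H • (Finsupp.single i (1 : ℂ)) j = 0 := by
    intro H i j hj
    have h1 : ⁅H, b i⁆ - lam i H • b i ∈ Submodule.span ℂ (b '' {j | i < j ∧ lam j = lam i}) := by
      have := htri H i
      rw [← hb] at this
      convert this using 2
      exact Set.image_congr fun j _ => hb j
    have h2 : b.repr (⁅H, b i⁆ - lam i H • b i) j = 0 := by
      by_contra hne
      exact hj ((b.mem_span_image).1 h1 (Finsupp.mem_support_iff.2 hne))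
    rwa [map_sub, map_smul, b.repr_self, Finsupp.sub_apply, Finsupp.smul_apply] at h2
  have hrepr : ∀ (H : C.𝔞) i j, j ≠ i → ¬ (i < j ∧ lam j = lam i) → b.repr ⁅H, b i⁆ j = 0 := by
    intro H i j hji hj
    simpa [Finsupp.single_eq_of_ne hji] using hzero H i j hj
  have hdiag : ∀ (H : C.𝔞) i, b.repr ⁅H, b i⁆ i = lam i H := by
    intro H i
    simpa [sub_eq_zero] using hzero H i i fun hi => lt_irrefl i hi.1
  have hlower : ∀ (H : C.𝔞) i j, j < i → b.repr ⁅H, b i⁆ j = 0 := fun H i j hij =>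
    hrepr H i j hij.ne fun h => lt_asymm hij h.1
  have hblock : ∀ (H : C.𝔞) i j, lam i ≠ lam j → b.repr ⁅H, b i⁆ j = 0 := fun H i j hij =>
    hrepr H i j (fun h => hij (by rw [h])) fun h => hij h.2.symm
  have hB : ∀ y : U ⧸ h.fil 1, ∃ c : Fin N → ℂ,
      y = ∑ j, c j • LieSubmodule.Quotient.mk' (h.fil 1) (u j) := fun y => by
    obtain ⟨x, rfl⟩ := LieSubmodule.Quotient.surjective_mk' (h.fil 1) y
    obtain ⟨P, rfl⟩ := hu x
    choose c hc using fun j => F.exists_sub_mem_powIdealΛ (P j)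
    refine ⟨c, ?_⟩
    rw [map_sum]
    refine Finset.sum_congr rfl fun j _ => ?_
    rw [← map_smul, ← sub_eq_zero, ← map_sub]
    refine LieSubmodule.Quotient.mk_eq_zero'.2 ?_
    rw [← algebraMap_smul (UnΛ C.𝔞 S.𝔫 Λ) (c j), ← sub_smul]
    exact h.smul_mem_fil (hc j) _
  choose B hB using fun i => hB (b i)
  let Qbar : C.𝔞 →ₗ[ℂ] Matrix (Fin (Module.finrank ℂ (U ⧸ h.fil 1)))
      (Fin (Module.finrank ℂ (U ⧸ h.fil 1))) ℂ :=
    { toFun := fun H => Matrix.of fun i j => b.repr ⁅H, b i⁆ j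
      map_add' := fun H H' => by
        ext i j
        simp [add_lie]
      map_smul' := fun c H => by
        ext i j
        simp [smul_lie] }
  have haction : ∀ (H : C.𝔞) i, aBar C.𝔞 S.𝔫 Λ U H (b.map E i) = ∑ j, Qbar H i j • b.map E j := by
    intro H i
    simp only [Module.Basis.map_apply]
    rw [hEa]
    nth_rewrite 1 [← b.sum_repr ⁅H, b i⁆]
    rw [map_sum]
    exact Finset.sum_congr rfl fun j _ => map_smul E _ _
  have hvbar : ∀ i, b.map E i =
      ∑ j, Matrix.of B i j • (Submodule.Quotient.mk (u j) : Ubar C.𝔞 S.𝔫 Λ U) := by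
    intro i
    rw [Module.Basis.map_apply, hB i, map_sum]
    exact Finset.sum_congr rfl fun j _ => map_smul E _ _
  have hubar : ∀ j, (Submodule.Quotient.mk (u j) : Ubar C.𝔞 S.𝔫 Λ U) =
      ∑ i, Matrix.of (fun j i => b.repr (LieSubmodule.Quotient.mk' (h.fil 1) (u j)) i) j i •
        b.map E i := by
    intro j
    rw [← hE]
    nth_rewrite 1 [← b.sum_repr (LieSubmodule.Quotient.mk' (h.fil 1) (u j))]
    rw [map_sum]
    exact Finset.sum_congr rfl fun i _ => map_smul E _ _
  exact ⟨⟨_, lam, hanti, b.map E, Qbar, haction, hdiag, hlower, hblock, _, _, hvbar, hubar⟩⟩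

end SimpleSystem

/-! ### Calculations in the completions and in `Û` -/

namespace InvLim

variable {R : Type*} [Ring R] [Algebra ℂ R] {V : Submodule ℂ R} [LeftContinuous V]

omit [LeftContinuous V] in
theorem exists_of_mem_powIdeal_succ {d : ℕ} {X : Fin d → R}
    (hX : Submodule.span ℂ (Set.range X) = V) {k : ℕ} {y : R} (hy : y ∈ powIdeal V (k + 1)) :
    ∃ q : Fin d → R, (∀ a, q a ∈ powIdeal V k) ∧ y = ∑ a, X a * q a := by
  rw [powIdeal_succ, ← hX] at hy
  refine Submodule.mul_induction_on hy ?_ ?_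
  · intro m hm n hn
    obtain ⟨c, rfl⟩ := (Submodule.mem_span_range_iff_exists_fun ℂ).1 hm
    refine ⟨fun a => c a • n, fun a => Submodule.smul_mem _ _ (hX ▸ hn), ?_⟩
    rw [Finset.sum_mul]
    exact Finset.sum_congr rfl fun a _ => by rw [smul_mul_assoc, mul_smul_comm]
  · rintro _ _ ⟨q, hq, rfl⟩ ⟨q', hq', rfl⟩
    exact ⟨q + q', fun a => add_mem (hq a) (hq' a), by simp [mul_add, Finset.sum_add_distrib]⟩

/-- If `V` is finite-dimensional, the closed right ideal of the completion of elements
vanishing modulo `V R` is generated by `V`. -/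
theorem mem_map_mul_top {d : ℕ} {X : Fin d → R} (hX : Submodule.span ℂ (Set.range X) = V)
    {x : InvLim V} (hx : Rep x 1 0) : x ∈ V.map (of V).toLinearMap * ⊤ := by
  choose p hp using fun k => exists_rep x k
  have hp1 : p 1 ∈ powIdeal V (0 + 1) := by
    have := (hp 1).sub_mem hx
    rwa [sub_zero] at this
  obtain ⟨q', -, hq'⟩ := exists_of_mem_powIdeal_succ hX hp1
  have hstep : ∀ k, ∃ q : Fin d → R, (∀ a, q a ∈ powIdeal V k) ∧
      p (k + 2) - p (k + 1) = ∑ a, X a * q a := fun k =>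
    exists_of_mem_powIdeal_succ hX (((hp (k + 2)).mono (Nat.le_succ _)).sub_mem (hp (k + 1)))
  choose q hq hq2 using hstep
  let s : Fin d → ℕ → R := fun a n => q' a + ∑ k ∈ Finset.range n, q k a
  have hs : ∀ a i k, i ≤ k → s a k - s a i ∈ powIdeal V i := by
    intro a i k hik
    induction k, hik using Nat.le_induction with
    | base => rw [sub_self]; exact zero_mem _
    | succ k hik ih =>
      have h1 : s a (k + 1) - s a i = (s a k - s a i) + q k a := by
        simp only [s, Finset.sum_range_succ]
        abel
      rw [h1]
      exact add_mem ih (powIdeal_antitone V hik (hq k a))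
  have hps : ∀ n, p (n + 1) = ∑ a, X a * s a n := by
    intro n
    induction n with
    | zero => simpa [s] using hq'
    | succ n ih =>
      rw [← sub_add_cancel (p (n + 1 + 1)) (p (n + 1)), hq2 n, ih, ← Finset.sum_add_distrib]
      refine Finset.sum_congr rfl fun a _ => ?_
      simp only [s, Finset.sum_range_succ]
      rw [← mul_add]
      congr 1
      abel
  have hXV : ∀ a, X a ∈ V := fun a => hX ▸ Submodule.subset_span (Set.mem_range_self a)
  have hx' : x = ∑ a, of V (X a) * ofReps (s a) (hs a) := eq_of_rep fun n => by
    refine ⟨p (n + 1), (hp (n + 1)).mono (Nat.le_succ n), ?_⟩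
    rw [hps n]
    refine Rep.sum _ fun a _ => (rep_of (X a) n).mul (b := n) (fun z hz => ?_) (rep_ofReps _ _ n)
    refine powIdeal_antitone V (Nat.le_succ n) ?_
    rw [powIdeal_succ]
    exact Submodule.mul_mem_mul (hXV a) hz
  rw [hx']
  exact sum_mem fun a _ => Submodule.mul_mem_mul ⟨X a, hXV a, rfl⟩ trivial

end InvLim

open InvLim

section Concrete

variable {𝔤 : Type*} [LieRing 𝔤] [LieAlgebra ℂ 𝔤] {𝔞 𝔫 : LieSubalgebra ℂ 𝔤}
  {Λ : AddSubgroup (Module.Dual ℂ 𝔞)}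

variable (𝔞 𝔫 Λ) in
/-- The inclusion `U(𝔫)_Λ → Ê(𝔫)_Λ`. -/
def UnΛ.toEnΛ : UnΛ 𝔞 𝔫 Λ →ₐ[ℂ] EnΛ 𝔞 𝔫 Λ :=
  AlgHom.codRestrict ((of (inUn 𝔫)).comp (UnΛ.toUn 𝔞 𝔫 Λ)) _ fun P _ =>
    ⟨UnΛ.toUn 𝔞 𝔫 Λ P, P.2, rep_of _ _⟩

theorem ofEnΛ_toEnΛ [AdNilpotent 𝔫] (P : UnΛ 𝔞 𝔫 Λ) :
    ofEnΛ 𝔞 𝔫 Λ (UnΛ.toEnΛ 𝔞 𝔫 Λ P) = ofUnΛ 𝔞 𝔫 Λ P :=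
  Subtype.ext (eq_of_rep fun k => ⟨(P : UEnv 𝔤),
    (rep_of (UnΛ.toUn 𝔞 𝔫 Λ P) k).map (Un 𝔫).val (fun _ hx => hx), rep_of (P : UEnv 𝔤) k⟩)

/-- The element of `Ê(𝔫)_Λ` given by compatible representatives in `U(𝔫)_Λ`. -/
def EnΛ.ofSeq (f : ℕ → UnΛ 𝔞 𝔫 Λ) (hf : ∀ k, f (k + 1) - f k ∈ powIdealΛ 𝔞 𝔫 Λ (k + 1)) :
    EnΛ 𝔞 𝔫 Λ :=
  ⟨ofReps (fun k => UnΛ.toUn 𝔞 𝔫 Λ (f k)) (fun i k hik => by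
      induction k, hik using Nat.le_induction with
      | base => rw [sub_self]; exact zero_mem _
      | succ k hik ih =>
        rw [← sub_add_sub_cancel _ (UnΛ.toUn 𝔞 𝔫 Λ (f k)) _, ← map_sub]
        exact add_mem (powIdeal_antitone _ (hik.trans (Nat.le_succ k)) (hf k)) ih),
    fun k => ⟨UnΛ.toUn 𝔞 𝔫 Λ (f k), (f k).2, rep_ofReps _ _ k⟩⟩

theorem EnΛ.rep_ofSeq (f : ℕ → UnΛ 𝔞 𝔫 Λ)
    (hf : ∀ k, f (k + 1) - f k ∈ powIdealΛ 𝔞 𝔫 Λ (k + 1)) (k : ℕ) :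
    Rep (EnΛ.ofSeq f hf : En 𝔫) k (UnΛ.toUn 𝔞 𝔫 Λ (f k)) := rfl

theorem WeightFrame.ofSeq_sub_mem (F : WeightFrame 𝔞 𝔫) (f : ℕ → UnΛ 𝔞 𝔫 Λ)
    (hf : ∀ k, f (k + 1) - f k ∈ powIdealΛ 𝔞 𝔫 Λ (k + 1)) {c : ℂ} (hc : f 0 = algebraMap ℂ _ c) :
    (EnΛ.ofSeq f hf : En 𝔫) - algebraMap ℂ _ c ∈ nEnΛ 𝔞 𝔫 Λ := by
  refine ⟨mem_map_mul_top F.span_gen ?_, sub_mem (EnΛ.ofSeq f hf).2 (Subalgebra.algebraMap_mem _ c)⟩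
  have h1 : Rep (algebraMap ℂ (En 𝔫) c) 1 (algebraMap ℂ (Un 𝔫) c) := by
    rw [← AlgHom.commutes (of (inUn 𝔫)) c]; exact rep_of _ _
  refine ((EnΛ.rep_ofSeq f hf 1).sub h1).congr ?_
  have h2 : UnΛ.toUn 𝔞 𝔫 Λ (f 1 - f 0) ∈ powIdeal (inUn 𝔫) 1 := hf 0
  rw [map_sub, hc, AlgHom.commutes] at h2
  rwa [sub_zero]

theorem WeightFrame.rep_mul (F : WeightFrame 𝔞 𝔫) {x y : En 𝔫} {k : ℕ} {p q : Un 𝔫} (hp : Rep x k p)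
    (hq : Rep y k q) : Rep (x * y) k (p * q) :=
  hp.mul (fun z hz => by
    have := F.mul_mem_powIdeal_add (i := 0) (a := p) (by rw [powIdeal_zero]; trivial) hz
    rwa [zero_add] at this) hq

section Ad

variable [Normalizes 𝔞 𝔫]

variable (𝔫) in
/-- The derivation `P ↦ H P - P H` of `U(𝔫)`. -/
def adUn (H : 𝔞) : Un 𝔫 →ₗ[ℂ] Un 𝔫 :=
  LinearMap.codRestrict (Subalgebra.toSubmodule (Un 𝔫))
    ((adUg (H : 𝔤)).comp (Un 𝔫).val.toLinearMap) fun P => commutator_mem_Un 𝔞 𝔫 H P.2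

theorem WeightFrame.adUn_mem_powIdeal (F : WeightFrame 𝔞 𝔫) (H : 𝔞) {k : ℕ} {P : Un 𝔫}
    (hP : P ∈ powIdeal (inUn 𝔫) k) : adUn 𝔫 H P ∈ powIdeal (inUn 𝔫) k := by
  have h : powIdeal (inUn 𝔫) k ≤ (powIdeal (inUn 𝔫) k).comap (adUn 𝔫 H) := by
    conv_lhs => rw [F.powIdeal_eq_span]
    rw [Submodule.span_le]
    rintro _ ⟨l, hl, rfl⟩
    have h1 : adUn 𝔫 H (F.mon l) = F.monWt l H • F.mon l := Subtype.ext (F.mon_mem l H)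
    change adUn 𝔫 H (F.mon l) ∈ powIdeal (inUn 𝔫) k
    rw [h1, F.powIdeal_eq_span]
    exact Submodule.smul_mem _ _ (Submodule.subset_span ⟨l, hl, rfl⟩)
  exact h hP

variable [IsLieAbelian 𝔞]

variable (𝔫 Λ) in
/-- The derivation `P ↦ H P - P H` of `U(𝔫)_Λ`. -/
def adUnΛ (H : 𝔞) (P : UnΛ 𝔞 𝔫 Λ) : UnΛ 𝔞 𝔫 Λ :=
  ⟨iota (H : 𝔤) * P - P * iota (H : 𝔤), commutator_mem_Un 𝔞 𝔫 H P.2.1,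
    sub_mem (mul_mem (iota_mem_UgΛ 𝔞 Λ H) P.2.2) (mul_mem P.2.2 (iota_mem_UgΛ 𝔞 Λ H))⟩

/-- The derivation `b ↦ H b - b H` maps `Ê(𝔫)_Λ` to itself. -/
theorem WeightFrame.exists_commutator [AdNilpotent 𝔫] (F : WeightFrame 𝔞 𝔫) (H : 𝔞)
    (b : EnΛ 𝔞 𝔫 Λ) : ∃ b' : EnΛ 𝔞 𝔫 Λ,
      (∀ k (p : UnΛ 𝔞 𝔫 Λ), Rep (b : En 𝔫) k (UnΛ.toUn 𝔞 𝔫 Λ p) →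
        Rep (b' : En 𝔫) k (UnΛ.toUn 𝔞 𝔫 Λ (adUnΛ 𝔫 Λ H p))) ∧
      ofUgΛ 𝔞 𝔫 Λ (aToUgΛ 𝔞 Λ H) * ofEnΛ 𝔞 𝔫 Λ b =
        ofEnΛ 𝔞 𝔫 Λ b' + ofEnΛ 𝔞 𝔫 Λ b * ofUgΛ 𝔞 𝔫 Λ (aToUgΛ 𝔞 Λ H) := by
  choose p hp using fun k => exists_rep (b : En 𝔫) k
  let x : En 𝔫 := ofReps (fun k => adUn 𝔫 H (p k)) (fun i k hik => by
    rw [← map_sub]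
    exact F.adUn_mem_powIdeal H (((hp k).mono hik).sub_mem (hp i)))
  have hx : ∀ k q, Rep (b : En 𝔫) k q → Rep x k (adUn 𝔫 H q) := fun k q hq =>
    (rep_ofReps _ _ k).congr (by
      rw [← map_sub]
      exact F.adUn_mem_powIdeal H ((hp k).sub_mem hq))
  have hxΛ : x ∈ EnΛ 𝔞 𝔫 Λ := fun k => by
    obtain ⟨q, hqΛ, hq⟩ := b.2 k
    exact ⟨_, (adUnΛ 𝔫 Λ H ⟨q, hqΛ⟩).2, hx k q hq⟩
  refine ⟨⟨x, hxΛ⟩, fun k q hq => hx k _ hq, Subtype.ext (eq_of_rep fun k => ?_)⟩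
  let m := max (modulus (inUg 𝔫) (iota (H : 𝔤)) k) k
  have hm := hp m
  have hlim : ∀ {y : En 𝔫} {i : ℕ} {q : Un 𝔫}, Rep y i q → Rep (EnToLim 𝔫 y) i (q : UEnv 𝔤) :=
    fun h => h.map (Un 𝔫).val (fun _ hx => hx)
  have hmk : Rep (b : En 𝔫) k (p m) := hm.mono (le_max_right _ _)
  refine ⟨iota (H : 𝔤) * p m, ?_, ?_⟩
  · exact (rep_of (V := inUg 𝔫) (iota (H : 𝔤)) k).mul
      (fun z hz => modulus_spec _ _ (powIdeal_antitone _ (le_max_left _ _) hz)) (hlim hm)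
  · have h1 := (hlim (hx k _ hmk)).add ((hlim hmk).mul (fun z hz => modulus_spec _ _ hz)
      (rep_of (V := inUg 𝔫) (iota (H : 𝔤)) _))
    have h2 : ((adUn 𝔫 H (p m) : Un 𝔫) : UEnv 𝔤) + p m * iota (H : 𝔤) = iota (H : 𝔤) * p m :=
      sub_add_cancel _ _
    rw [h2] at h1
    exact h1

end Ad

section Uhat

variable [AdNilpotent 𝔫] {U : Type*} [AddCommGroup U] [Module (UgΛ 𝔞 Λ) U]

variable (𝔞 𝔫 Λ U) in
/-- The canonical map `U → Û` as a homomorphism of groups. -/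
def toUhatHom : U →+ Uhat 𝔞 𝔫 Λ U where
  toFun := toUhat 𝔞 𝔫 Λ
  map_zero' := by
    change Submodule.Quotient.mk _ = _
    rw [TensorProduct.tmul_zero]
    rfl
  map_add' x y := by
    change Submodule.Quotient.mk _ = _
    rw [TensorProduct.tmul_add]
    rfl

theorem ofUgΛ_smul_toUhat (P : UgΛ 𝔞 Λ) (x : U) :
    ofUgΛ 𝔞 𝔫 Λ P • toUhat 𝔞 𝔫 Λ x = toUhat 𝔞 𝔫 Λ (P • x) := by
  have h1 : ofUgΛ 𝔞 𝔫 Λ P • ((1 : EgnΛ 𝔞 𝔫 Λ) ⊗ₜ[ℤ] x) =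
      ((1 : EgnΛ 𝔞 𝔫 Λ) * (ofUgΛ 𝔞 𝔫 Λ).toRingHom P) ⊗ₜ[ℤ] x := by
    rw [TensorProduct.smul_tmul', smul_eq_mul, mul_one, one_mul]
    rfl
  change Submodule.Quotient.mk (ofUgΛ 𝔞 𝔫 Λ P • ((1 : EgnΛ 𝔞 𝔫 Λ) ⊗ₜ[ℤ] x)) = _
  rw [h1]
  exact (Submodule.Quotient.eq _).2 (Submodule.subset_span ⟨1, P, x, rfl⟩)

/-- The vanishing criterion in `Û`: if the partial sums approximating `∑ f_j u_j` lie in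
`(𝔫 ^ k U(𝔫))_Λ U` for every `k`, then `∑ f_j u_j = 0` in `Û`. The tuple `f` is then in the
closure of the relations between the `u_j`, hence a combination of relations. -/
theorem WeightFrame.sum_smul_toUhat_eq_zero [IsLieAbelian 𝔞] [Module ℂ U]
    [Module (UnΛ 𝔞 𝔫 Λ) U] [IsScalarTower ℂ (UnΛ 𝔞 𝔫 Λ) U] [LieRingModule 𝔞 U] [LieModule ℂ 𝔞 U]
    (F : WeightFrame 𝔞 𝔫) (h : IsFilteredAction (powIdealΛ 𝔞 𝔫 Λ) (wtUnΛ 𝔞 𝔫 Λ) U)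
    (hsmul : ∀ (P : UnΛ 𝔞 𝔫 Λ) (x : U), P • x = Subalgebra.inclusion (UnΛ_le 𝔞 𝔫 Λ) P • x)
    {N : ℕ} {u : Fin N → U} (hu : ∀ x : U, ∃ P : Fin N → UnΛ 𝔞 𝔫 Λ, x = ∑ j, P j • u j)
    (f : Fin N → EnΛ 𝔞 𝔫 Λ)
    (hf : ∀ k, ∃ p : Fin N → UnΛ 𝔞 𝔫 Λ, (∀ j, Rep (f j : En 𝔫) k (UnΛ.toUn 𝔞 𝔫 Λ (p j))) ∧
      ∑ j, p j • u j ∈ h.fil k) :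
    ∑ j, ofEnΛ 𝔞 𝔫 Λ (f j) • toUhat 𝔞 𝔫 Λ (u j) = 0 := by
  have := F.isNoetherianRing_Un
  let K : AddSubgroup (Fin N → Un 𝔫) :=
    { carrier := {y | ∃ p : Fin N → UnΛ 𝔞 𝔫 Λ, (∀ j, UnΛ.toUn 𝔞 𝔫 Λ (p j) = y j) ∧
        ∑ j, p j • u j = 0}
      zero_mem' := ⟨0, fun j => map_zero _, by simp⟩
      add_mem' := by
        rintro y y' ⟨p, hp, hpu⟩ ⟨p', hp', hpu'⟩
        refine ⟨p + p', fun j => ?_, ?_⟩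
        · rw [Pi.add_apply, map_add, hp, hp']; rfl
        · simp only [Pi.add_apply, add_smul, Finset.sum_add_distrib, hpu, hpu', add_zero]
      neg_mem' := by
        rintro y ⟨p, hp, hpu⟩
        refine ⟨-p, fun j => ?_, ?_⟩
        · rw [Pi.neg_apply, map_neg, hp]; rfl
        · simp only [Pi.neg_apply, neg_smul, Finset.sum_neg_distrib, hpu, neg_zero] }
  have hKΛ : ∀ y ∈ K, ∀ j, y j ∈ homSub (wtUn 𝔞 𝔫) (Λ : Set (Module.Dual ℂ 𝔞)) := by
    rintro y ⟨p, hp, -⟩ j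
    rw [← F.mem_UnΛ_iff, ← hp j]
    exact (p j).2
  have hKmul : ∀ a ∈ homSub (wtUn 𝔞 𝔫) (Λ : Set (Module.Dual ℂ 𝔞)), ∀ y ∈ K,
      (fun j => a * y j) ∈ K := by
    rintro a ha y ⟨p, hp, hpu⟩
    let a' : UnΛ 𝔞 𝔫 Λ := ⟨a, (F.mem_UnΛ_iff Λ a).2 ha⟩
    refine ⟨fun j => a' * p j, fun j => ?_, ?_⟩
    · rw [map_mul, hp]; rfl
    · simp only [mul_smul, ← Finset.smul_sum, hpu, smul_zero]
  have hcone : ∀ μ ∈ AddSubmonoid.closure (Set.range F.wt), ∃ n : ℕ, F.ht μ = n := by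
    intro μ hμ
    induction hμ using AddSubmonoid.closure_induction with
    | mem μ hμ => obtain ⟨i, rfl⟩ := hμ; exact ⟨_, F.ht_wt i⟩
    | zero => exact ⟨0, by simp⟩
    | add μ ν _ _ h h' =>
      obtain ⟨n, hn⟩ := h
      obtain ⟨n', hn'⟩ := h'
      exact ⟨n + n', by rw [map_add, hn, hn', Nat.cast_add]⟩
  obtain ⟨s, κ, g, hκ, hg, hfg⟩ := exists_sum_of_mem_closure (iSupIndep_wtUn 𝔞 𝔫) F.iSup_wtUn
    (mul_mem_wtUn 𝔞 𝔫) F.ht Λ F.maxDeg (Nat.succ_pos _)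
    (fun k => (F.powIdeal_le k).trans (homSub_mono (by
      rintro μ ⟨hμ, hk⟩
      obtain ⟨n, hn⟩ := hcone μ hμ
      refine ⟨n, ?_, hn⟩
      rw [hn] at hk
      exact_mod_cast hk)))
    F.homSub_le_powIdeal K hKΛ hKmul (fun j => (f j : En 𝔫)) (fun k => by
      obtain ⟨p, hp, hpu⟩ := hf k
      obtain ⟨q, hq, hqu⟩ := h.exists_of_mem_fil hu hpu
      refine ⟨fun j => UnΛ.toUn 𝔞 𝔫 Λ (p j - q j), ⟨fun j => p j - q j, fun j => rfl, ?_⟩,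
        fun j => (hp j).congr ?_⟩
      · simp only [sub_smul, Finset.sum_sub_distrib]
        rw [← hqu, sub_self]
      · change UnΛ.toUn 𝔞 𝔫 Λ (p j) - UnΛ.toUn 𝔞 𝔫 Λ (p j - q j) ∈ powIdeal (inUn 𝔫) k
        rw [map_sub, sub_sub_cancel]
        exact hq j)
  have hg' : ∀ τ, g τ ∈ EnΛ 𝔞 𝔫 Λ := fun τ k => by
    obtain ⟨p, hp, hp'⟩ := hg τ k
    exact ⟨p, (F.mem_UnΛ_iff Λ p).2 hp, hp'⟩
  have hκ' : ∀ τ, ∃ p : Fin N → UnΛ 𝔞 𝔫 Λ, τ ∈ s → (∀ j, UnΛ.toUn 𝔞 𝔫 Λ (p j) = κ τ j) ∧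
      ∑ j, p j • u j = 0 := fun τ => by
    by_cases hτ : τ ∈ s
    · obtain ⟨p, hp⟩ := hκ τ hτ
      exact ⟨p, fun _ => hp⟩
    · exact ⟨0, fun h => absurd h hτ⟩
  choose p hp using hκ'
  have hfj : ∀ j, f j = ∑ τ ∈ s, (⟨g τ, hg' τ⟩ : EnΛ 𝔞 𝔫 Λ) * UnΛ.toEnΛ 𝔞 𝔫 Λ (p τ j) := by
    intro j
    refine Subtype.ext ((hfg j).trans ?_)
    rw [AddSubmonoidClass.coe_finsetSum]
    refine Finset.sum_congr rfl fun τ hτ => ?_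
    rw [← (hp τ hτ).1 j]
    rfl
  have hrel : ∀ τ ∈ s, ∑ j, ofUnΛ 𝔞 𝔫 Λ (p τ j) • toUhat 𝔞 𝔫 Λ (u j) = 0 := by
    intro τ hτ
    have h1 : ∀ j, ofUnΛ 𝔞 𝔫 Λ (p τ j) • toUhat 𝔞 𝔫 Λ (u j) = toUhatHom 𝔞 𝔫 Λ U (p τ j • u j) :=
      fun j => by
        rw [hsmul]
        exact ofUgΛ_smul_toUhat _ _
    simp only [h1]
    rw [← map_sum, (hp τ hτ).2, map_zero]
  simp only [hfj, map_sum, map_mul, ofEnΛ_toEnΛ, Finset.sum_smul, mul_smul]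
  rw [Finset.sum_comm]
  refine Finset.sum_eq_zero fun τ hτ => ?_
  rw [← Finset.smul_sum, hrel τ hτ, smul_zero]

end Uhat

end Concrete

/-! ### Lifting the triangular form from `U / I 1 U` -/

namespace IsFilteredAction

variable {L : Type*} [LieRing L] [LieAlgebra ℂ L] [IsLieAbelian L]
  {A : Type*} [Ring A] [Algebra ℂ A] {I : ℕ → Submodule ℂ A} {W : Module.Dual ℂ L → Submodule ℂ A}
  {U : Type*} [AddCommGroup U] [Module ℂ U] [Module A U] [IsScalarTower ℂ A U]
  [LieRingModule L U] [LieModule ℂ L U] (h : IsFilteredAction I W U)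
include h

/-- A vector of a triangular family is a generalized weight vector, by downward induction on its
index: `(H - λ_i(H)) w_i` is a combination of later vectors with the same weight. -/
theorem isWt_of_triangular {r : ℕ} {w : Fin r → U} {lam : Fin r → Module.Dual ℂ L}
    {Q : L →ₗ[ℂ] Matrix (Fin r) (Fin r) ℂ}
    (hQ : ∀ H i, ⁅H, w i⁆ - ∑ j, Q H i j • w j ∈ h.fil 1) (hdiag : ∀ H i, Q H i i = lam i H)
    (hlower : ∀ H i j, j < i → Q H i j = 0) (hblock : ∀ H i j, lam i ≠ lam j → Q H i j = 0)
    (i : Fin r) : h.IsWt 1 (lam i) (w i) := by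
  classical
  induction i using WellFoundedGT.induction with
  | ind i ih =>
    rw [h.isWt_iff]
    intro H
    have h1 : h.IsWt 1 (lam i) (∑ j ∈ Finset.univ.erase i, Q H i j • w j) := by
      refine IsWt.sum h fun j hj => ?_
      rcases lt_or_gt_of_ne (Finset.ne_of_mem_erase hj) with hji | hij
      · rw [hlower H i j hji, IsWt, zero_smul, map_zero]
        exact zero_mem _
      · by_cases hl : lam i = lam j
        · rw [hl]
          exact IsWt.smul h _ (ih j hij)
        · rw [hblock H i j hl, IsWt, zero_smul, map_zero]
          exact zero_mem _
    have h2 : h.IsWt 1 (lam i) ((LieModule.toEnd ℂ L U H - lam i H • 1) (w i)) := by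
      refine IsWt.congr h h1 ?_
      have h3 := hQ H i
      rw [← Finset.add_sum_erase _ _ (Finset.mem_univ i), hdiag] at h3
      rw [← neg_mem_iff]
      convert h3 using 1
      simp only [LinearMap.sub_apply, LinearMap.smul_apply, Module.End.one_apply,
        LieModule.toEnd_apply_apply]
      abel
    obtain ⟨n, hn⟩ := h.isWt_iff.1 h2 H
    exact ⟨n + 1, by rw [pow_succ]; exact hn⟩

/-- A triangular form of the action of `L` on `U / I 1 U` lifts to `U / I (k+1) U` for all `k`,
with coefficient matrices `a k`, `b k` that converge, and with a matrix `Q(H) = Q̄(H) + P(H)` that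
does not depend on `k` and whose entries are weight vectors. -/
theorem exists_lift_triangular {N r : ℕ} {u : Fin N → U}
    (hu : ∀ x : U, ∃ P : Fin N → A, x = ∑ j, P j • u j) {lam : Fin r → Module.Dual ℂ L}
    {Abar : Fin N → Fin r → ℂ} {Bbar : Fin r → Fin N → ℂ} {Qbar : L →ₗ[ℂ] Matrix (Fin r) (Fin r) ℂ}
    (hA : ∀ j, u j - ∑ i, Abar j i • ∑ l, Bbar i l • u l ∈ h.fil 1)
    (hQ : ∀ H i, ⁅H, ∑ l, Bbar i l • u l⁆ - ∑ j, Qbar H i j • ∑ l, Bbar j l • u l ∈ h.fil 1)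
    (hdiag : ∀ H i, Qbar H i i = lam i H) (hlower : ∀ H i j, j < i → Qbar H i j = 0)
    (hblock : ∀ H i j, lam i ≠ lam j → Qbar H i j = 0) :
    ∃ (a : Fin N → ℕ → Fin r → A) (b : Fin r → ℕ → Fin N → A)
      (P : L →ₗ[ℂ] Matrix (Fin r) (Fin r) A),
      (∀ j i, a j 0 i = algebraMap ℂ A (Abar j i)) ∧
      (∀ j i k, a j (k + 1) i - a j k i ∈ I (k + 1)) ∧
      (∀ i j, b i 0 j = algebraMap ℂ A (Bbar i j)) ∧
      (∀ i j k, b i (k + 1) j - b i k j ∈ I (k + 1)) ∧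
      (∀ H i j, P H i j ∈ W (lam i - lam j) ⊓ I 1) ∧
      (∀ k j, u j - ∑ i, a j k i • ∑ l, b i k l • u l ∈ h.fil (k + 1)) ∧
      ∀ k H i, ⁅H, ∑ l, b i k l • u l⁆ -
        ∑ j, (algebraMap ℂ A (Qbar H i j) + P H i j) • ∑ l, b j k l • u l ∈ h.fil (k + 1) := by
  have hwt0 : ∀ i, h.IsWt 1 (lam i) (∑ l, algebraMap ℂ A (Bbar i l) • u l) := fun i => by
    simp only [algebraMap_smul]
    exact h.isWt_of_triangular hQ hdiag hlower hblock i
  choose b hb0 hb hbt using fun i => h.exists_weight_seq hu _ (hwt0 i)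
  let w : ℕ → Fin r → U := fun k i => ∑ l, b i k l • u l
  have hw0 : ∀ i, w 0 i = ∑ l, Bbar i l • u l := fun i => by simp [w, hb0, algebraMap_smul]
  have hw' : ∀ k i, w (k + 1) i - w k i ∈ h.fil (k + 1) := fun k i => by
    simp only [w]
    rw [← Finset.sum_sub_distrib]
    refine sum_mem fun l _ => ?_
    rw [← sub_smul]
    exact h.smul_mem_fil (hb i k l) _
  have hw1 : ∀ k i, w k i - w 0 i ∈ h.fil 1 := fun k i => by
    induction k with
    | zero => rw [sub_self]; exact zero_mem _
    | succ k ih =>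
      rw [← sub_add_sub_cancel _ (w k i)]
      exact add_mem (h.fil_anti (Nat.succ_le_succ (Nat.zero_le k)) (hw' k i)) ih
  have hw : ∀ k j, u j - ∑ i, Abar j i • w k i ∈ h.fil 1 := fun k j => by
    have h1 : u j - ∑ i, Abar j i • w k i =
        (u j - ∑ i, Abar j i • w 0 i) - ∑ i, Abar j i • (w k i - w 0 i) := by
      simp only [smul_sub, Finset.sum_sub_distrib]
      abel
    rw [h1]
    refine sub_mem ?_ (sum_mem fun i _ => (h.fil 1).smul_mem _ (hw1 k i))
    simpa only [hw0] using hA j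
  let y : L → Fin r → ℕ → U := fun H i k => ⁅H, w k i⁆ - ∑ j, Qbar H i j • w k j
  have hycont : ∀ H i m k l, (∀ j, w k j - w l j ∈ h.fil m) → y H i k - y H i l ∈ h.fil m := by
    intro H i m k l hkl
    have h1 : y H i k - y H i l =
        ⁅H, w k i - w l i⁆ - ∑ j, Qbar H i j • (w k j - w l j) := by
      simp only [y, smul_sub, Finset.sum_sub_distrib, lie_sub]
      abel
    rw [h1]
    exact sub_mem ((h.fil m).lie_mem (hkl i)) (sum_mem fun j _ => (h.fil m).smul_mem _ (hkl j))
  have hy' : ∀ H i k, y H i (k + 1) - y H i k ∈ h.fil (k + 1) := fun H i k =>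
    hycont H i _ _ _ (hw' k)
  have hy : ∀ H i k, y H i k ∈ h.fil 1 := fun H i k => by
    rw [← sub_add_cancel (y H i k) (y H i 0)]
    refine add_mem (hycont H i _ _ _ (hw1 k)) ?_
    simpa only [y, hw0] using hQ H i
  have hyt : ∀ H i k, h.IsWt (k + 1) (lam i) (y H i k) := fun H i k => by
    refine IsWt.sub h (IsWt.lie h H (hbt i k)) (IsWt.sum h fun j _ => ?_)
    by_cases hl : lam i = lam j
    · rw [hl]
      exact IsWt.smul h _ (hbt j k)
    · rw [hblock H i j hl, IsWt, zero_smul, map_zero]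
      exact zero_mem _
  -- The admissible pairs `(H, P)` form a subspace that projects onto `L`; a linear section of
  -- this projection makes `P` depend linearly on `H`.
  let G : Submodule ℂ (L × Matrix (Fin r) (Fin r) A) :=
    { carrier := {p | (∀ i j, p.2 i j ∈ W (lam i - lam j) ⊓ I 1) ∧
        ∀ k i, y p.1 i k - ∑ j, p.2 i j • w k j ∈ h.fil (k + 1)}
      zero_mem' := ⟨fun _ _ => zero_mem _, fun k i => by simp [y]⟩
      add_mem' := by
        rintro p q ⟨hp, hp'⟩ ⟨hq, hq'⟩
        refine ⟨fun i j => add_mem (hp i j) (hq i j), fun k i => ?_⟩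
        convert add_mem (hp' k i) (hq' k i) using 1
        simp only [y, Prod.fst_add, Prod.snd_add, Matrix.add_apply, map_add, add_smul, add_lie,
          Finset.sum_add_distrib]
        abel
      smul_mem' := by
        rintro c p ⟨hp, hp'⟩
        refine ⟨fun i j => Submodule.smul_mem _ c (hp i j), fun k i => ?_⟩
        convert (h.fil (k + 1)).smul_mem c (hp' k i) using 1
        simp only [y, Prod.smul_fst, Prod.smul_snd, Matrix.smul_apply, map_smul, smul_lie, smul_sub,
          Finset.smul_sum, smul_assoc]
        exact Iff.rfl }
  have hsurj : Function.Surjective ((LinearMap.fst ℂ L (Matrix (Fin r) (Fin r) A)).comp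
      G.subtype) := fun H => by
    choose P hP hP' using fun i => h.exists_coeff hu hw hw' (fun k i => hbt i k) (hy H i)
      (hy' H i) (hyt H i)
    exact ⟨⟨(H, Matrix.of P), hP, fun k i => hP' i k⟩, rfl⟩
  obtain ⟨s, hs⟩ := LinearMap.exists_rightInverse_of_surjective _ (LinearMap.range_eq_top.2 hsurj)
  have hs' : ∀ H, (s H : L × Matrix (Fin r) (Fin r) A).1 = H := fun H => LinearMap.congr_fun hs H
  choose a ha0 ha ha' using h.exists_seq_sub_mem_fil hu hw hw'
  refine ⟨a, b, (LinearMap.snd ℂ L (Matrix (Fin r) (Fin r) A)).comp (G.subtype.comp s),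
    fun j i => congrFun (ha0 j) i, fun j i k => ha j k i, fun i j => congrFun (hb0 i) j,
    fun i j k => hb i k j, fun H => (s H).2.1, fun k j => ha' j k, fun k H i => ?_⟩
  have h1 := (s H).2.2 k i
  rw [hs'] at h1
  convert h1 using 1
  simp only [y, w, add_smul, Finset.sum_add_distrib, algebraMap_smul, LinearMap.comp_apply,
    LinearMap.snd_apply, Submodule.subtype_apply]
  abel

end IsFilteredAction

/-! ### Identities in `Û` from congruences in `U` -/

/-- The computation of `H v_i` for `v = B x`, from the commutators `B' = [H, B_i]` and the action of
`H` on the `x_l`. -/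
theorem smul_sum_eq_of_commutator {E M ι κ : Type*} [Ring E] [AddCommGroup M] [Module E M]
    [Fintype ι] [Fintype κ] {H : E} {B : ι → κ → E} {i : ι} {B' : κ → E} {R : κ → κ → E} {q : ι → E}
    (x : κ → M)
    (hB : ∀ l, H * B i l = B' l + B i l * H) (hx : ∀ l, H • x l = ∑ m, R l m • x m)
    (key : ∑ l, (B' l + ∑ j, B i j * R j l - ∑ j, q j * B j l) • x l = 0) :
    H • ∑ l, B i l • x l = ∑ j, q j • ∑ l, B j l • x l := by
  have h1 : ∀ l, H • B i l • x l = B' l • x l + B i l • ∑ m, R l m • x m := fun l => by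
    rw [smul_smul, hB, add_smul, mul_smul, hx]
  simp only [sub_smul, add_smul, Finset.sum_sub_distrib, Finset.sum_add_distrib, Finset.sum_smul,
    mul_smul, sub_eq_zero] at key
  simp only [Finset.smul_sum, h1, Finset.sum_add_distrib]
  rw [Finset.sum_comm (s := Finset.univ (α := ι)), ← key]
  congr 1
  exact Finset.sum_comm

section Identities

variable {𝔤 : Type*} [LieRing 𝔤] [LieAlgebra ℂ 𝔤] {𝔞 𝔫 : LieSubalgebra ℂ 𝔤} [IsLieAbelian 𝔞]
  {Λ : AddSubgroup (Module.Dual ℂ 𝔞)} [AdNilpotent 𝔫] {U : Type*} [AddCommGroup U]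
  [Module (UgΛ 𝔞 Λ) U] [Module ℂ U] [Module (UnΛ 𝔞 𝔫 Λ) U] [IsScalarTower ℂ (UnΛ 𝔞 𝔫 Λ) U]
  [LieRingModule 𝔞 U] [LieModule ℂ 𝔞 U] (F : WeightFrame 𝔞 𝔫)
  (h : IsFilteredAction (powIdealΛ 𝔞 𝔫 Λ) (wtUnΛ 𝔞 𝔫 Λ) U)
  (hsmul : ∀ (P : UnΛ 𝔞 𝔫 Λ) (x : U), P • x = Subalgebra.inclusion (UnΛ_le 𝔞 𝔫 Λ) P • x)
  {N r : ℕ} {u : Fin N → U} (hu : ∀ x : U, ∃ P : Fin N → UnΛ 𝔞 𝔫 Λ, x = ∑ j, P j • u j)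
  {B : Matrix (Fin r) (Fin N) (EnΛ 𝔞 𝔫 Λ)} {b : Fin r → ℕ → Fin N → UnΛ 𝔞 𝔫 Λ}
  (hB : ∀ i j k, Rep (B i j : En 𝔫) k (UnΛ.toUn 𝔞 𝔫 Λ (b i k j)))

omit [IsLieAbelian 𝔞] [Module ℂ U] [IsScalarTower ℂ (UnΛ 𝔞 𝔫 Λ) U] [LieRingModule 𝔞 U]
  [LieModule ℂ 𝔞 U] in
include hsmul in
theorem toUhat_sum_smul (P : Fin N → UnΛ 𝔞 𝔫 Λ) :
    toUhat 𝔞 𝔫 Λ (∑ j, P j • u j) =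
      ∑ j, ofEnΛ 𝔞 𝔫 Λ (UnΛ.toEnΛ 𝔞 𝔫 Λ (P j)) • toUhat 𝔞 𝔫 Λ (u j) := by
  refine (map_sum (toUhatHom 𝔞 𝔫 Λ U) _ _).trans (Finset.sum_congr rfl fun j _ => ?_)
  rw [ofEnΛ_toEnΛ, hsmul]
  exact (ofUgΛ_smul_toUhat _ _).symm

include F h hsmul hu hB in
/-- The identity `u = A B u` in `Û`. -/
theorem toUhat_eq_sum_mul {A : Matrix (Fin N) (Fin r) (EnΛ 𝔞 𝔫 Λ)}
    {a : Fin N → ℕ → Fin r → UnΛ 𝔞 𝔫 Λ}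
    (hA : ∀ j i k, Rep (A j i : En 𝔫) k (UnΛ.toUn 𝔞 𝔫 Λ (a j k i))) (j : Fin N)
    (hj : ∀ k, u j - ∑ i, a j k i • ∑ l, b i k l • u l ∈ h.fil (k + 1)) :
    toUhat 𝔞 𝔫 Λ (u j) = ∑ l, ofEnΛ 𝔞 𝔫 Λ ((A * B) j l) • toUhat 𝔞 𝔫 Λ (u l) := by
  classical
  have key := F.sum_smul_toUhat_eq_zero h hsmul hu
    (fun l => UnΛ.toEnΛ 𝔞 𝔫 Λ (if l = j then 1 else 0) - (A * B) j l) fun k =>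
      ⟨fun l => (if l = j then 1 else 0) - ∑ i, a j k i * b i k l, fun l => ?_, ?_⟩
  · simp only [map_sub, sub_smul, Finset.sum_sub_distrib, sub_eq_zero, ofEnΛ_toEnΛ] at key
    rw [← key]
    simp [apply_ite, ite_smul]
  · rw [map_sub]
    refine (rep_of _ _).sub ?_
    rw [Matrix.mul_apply, map_sum, AddSubmonoidClass.coe_finsetSum]
    refine Rep.sum _ fun i _ => ?_
    rw [map_mul]
    exact F.rep_mul (hA j i k) (hB i l k)
  · convert h.fil_anti (Nat.le_succ k) (hj k) using 1
    simp only [sub_smul, Finset.sum_sub_distrib, ite_smul, one_smul, zero_smul, Finset.sum_ite_eq',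
      Finset.mem_univ, if_true, Finset.sum_smul, Finset.smul_sum, mul_smul]
    rw [Finset.sum_comm]

include F h hsmul hu hB in
/-- The identity `H v_i = ∑ q_j v_j` in `Û` for `v = B u`. -/
theorem aToUgΛ_smul_sum [Normalizes 𝔞 𝔫] (hlie : ∀ (H : 𝔞) (x : U), ⁅H, x⁆ = aToUgΛ 𝔞 Λ H • x)
    (H : 𝔞) (i : Fin r) (q : Fin r → UnΛ 𝔞 𝔫 Λ)
    (hi : ∀ k, ⁅H, ∑ l, b i k l • u l⁆ - ∑ j, q j • ∑ l, b j k l • u l ∈ h.fil (k + 1)) :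
    ofUgΛ 𝔞 𝔫 Λ (aToUgΛ 𝔞 Λ H) • ∑ l, ofEnΛ 𝔞 𝔫 Λ (B i l) • toUhat 𝔞 𝔫 Λ (u l) =
      ∑ j, ofUnΛ 𝔞 𝔫 Λ (q j) • ∑ l, ofEnΛ 𝔞 𝔫 Λ (B j l) • toUhat 𝔞 𝔫 Λ (u l) := by
  choose R hR using fun j => hu ⁅H, u j⁆
  choose B' hB' hB'' using fun l => F.exists_commutator H (B i l)
  have hlieP : ∀ (P : UnΛ 𝔞 𝔫 Λ) (x : U), ⁅H, P • x⁆ = adUnΛ 𝔫 Λ H P • x + P • ⁅H, x⁆ := by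
    intro P x
    rw [hlie, hlie, hsmul, hsmul, hsmul, smul_smul, smul_smul, ← add_smul]
    congr 1
    exact Subtype.ext (sub_add_cancel _ _).symm
  have key := F.sum_smul_toUhat_eq_zero h hsmul hu
    (fun l => B' l + ∑ j, B i j * UnΛ.toEnΛ 𝔞 𝔫 Λ (R j l) - ∑ j, UnΛ.toEnΛ 𝔞 𝔫 Λ (q j) * B j l)
    fun k => ⟨fun l => adUnΛ 𝔫 Λ H (b i k l) + ∑ j, b i k j * R j l - ∑ j, q j * b j k l,
      fun l => ?_, ?_⟩
  · refine smul_sum_eq_of_commutator (E := EgnΛ 𝔞 𝔫 Λ) (M := Uhat 𝔞 𝔫 Λ U)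
      (H := ofUgΛ 𝔞 𝔫 Λ (aToUgΛ 𝔞 Λ H)) (B := fun i l => ofEnΛ 𝔞 𝔫 Λ (B i l)) (i := i)
      (B' := fun l => ofEnΛ 𝔞 𝔫 Λ (B' l)) (R := fun j l => ofEnΛ 𝔞 𝔫 Λ (UnΛ.toEnΛ 𝔞 𝔫 Λ (R j l)))
      (q := fun j => ofUnΛ 𝔞 𝔫 Λ (q j)) (fun l => toUhat 𝔞 𝔫 Λ (u l)) hB'' (fun l => ?_) ?_
    · rw [ofUgΛ_smul_toUhat, ← hlie, hR, toUhat_sum_smul hsmul]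
    · refine (Finset.sum_congr rfl fun l _ => ?_).trans key
      refine congrArg (· • toUhat 𝔞 𝔫 Λ (u l)) ?_
      simp only [map_sub, map_add, map_sum, map_mul, ofEnΛ_toEnΛ]
  · rw [map_sub, map_add, map_sum, map_sum]
    refine ((hB' l k _ (hB i l k)).add ?_).sub ?_
    · rw [AddSubmonoidClass.coe_finsetSum]
      refine Rep.sum _ fun j _ => ?_
      rw [map_mul]
      exact F.rep_mul (hB i j k) (rep_of _ _)
    · rw [AddSubmonoidClass.coe_finsetSum]
      refine Rep.sum _ fun j _ => ?_
      rw [map_mul]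
      exact F.rep_mul (rep_of _ _) (hB j l k)
  · have h1 : ∑ l, (adUnΛ 𝔫 Λ H (b i k l) + ∑ j, b i k j * R j l - ∑ j, q j * b j k l) • u l =
        ⁅H, ∑ l, b i k l • u l⁆ - ∑ j, q j • ∑ l, b j k l • u l := by
      simp only [lie_sum, hlieP, hR, sub_smul, add_smul, Finset.sum_sub_distrib,
        Finset.sum_add_distrib, Finset.sum_smul, Finset.smul_sum, mul_smul]
      rw [Finset.sum_comm (s := Finset.univ (α := Fin r))]
      congr 2
      exact Finset.sum_comm
    rw [h1]
    exact h.fil_anti (Nat.le_succ k) (hi k)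

end Identities

/-! ### The matrices `A`, `B` and `Q(H)` -/

/-- Elements of `𝔫 U(𝔫)` have positive height, so none of them has weight `0`. -/
theorem WeightFrame.eq_zero_of_wtUnΛ_zero {𝔤 : Type*} [LieRing 𝔤] [LieAlgebra ℂ 𝔤]
    {𝔞 𝔫 : LieSubalgebra ℂ 𝔤} [IsLieAbelian 𝔞] (F : WeightFrame 𝔞 𝔫)
    {Λ : AddSubgroup (Module.Dual ℂ 𝔞)} {P : UnΛ 𝔞 𝔫 Λ}
    (hP : P ∈ wtUnΛ 𝔞 𝔫 Λ 0 ⊓ powIdealΛ 𝔞 𝔫 Λ 1) : P = 0 := by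
  refine UnΛ.toUn_injective ?_
  rw [map_zero]
  exact F.wtUn_inf_powIdeal_eq_bot (k := 1) (by rw [map_zero]; exact_mod_cast one_pos) hP.1 hP.2

namespace SimpleSystem

variable {𝔤₀ : Type*} [LieRing 𝔤₀] [LieAlgebra ℝ 𝔤₀] {C : CartanData 𝔤₀} (S : SimpleSystem C)

theorem eq_zero_of_notMem_posPart {F : WeightFrame C.𝔞 S.𝔫} (hF : Set.range F.wt ⊆ S.posRoots)
    {Λ : AddSubgroup (Module.Dual ℂ C.𝔞)} {μ : Module.Dual ℂ C.𝔞} (hμ : μ ∉ S.posPart Λ)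
    {P : UnΛ C.𝔞 S.𝔫 Λ} (hP : P ∈ wtUnΛ C.𝔞 S.𝔫 Λ μ) : P = 0 := by
  refine UnΛ.toUn_injective ?_
  rw [map_zero]
  by_cases h : μ ∈ Λ
  · exact F.eq_zero_of_notMem_closure
      (fun h' => hμ ⟨h, AddSubmonoid.closure_mono hF h'⟩) hP
  · exact WeightFrame.eq_zero_of_mem (T := (Λ : Set (Module.Dual ℂ C.𝔞))) h hP
      ((F.mem_UnΛ_iff Λ (UnΛ.toUn C.𝔞 S.𝔫 Λ P)).1 P.2)

end SimpleSystem

end BoundaryValue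

end

open BoundaryValue in
theorem mainTheorem3
    {𝔤₀ : Type*} [LieRing 𝔤₀] [LieAlgebra ℝ 𝔤₀] [FiniteDimensional ℝ 𝔤₀]
    [LieAlgebra.IsSemisimple ℝ 𝔤₀] (C : CartanData 𝔤₀) (S : SimpleSystem C)
    (Λ : AddSubgroup (Module.Dual ℂ C.𝔞)) (hΛ : Λ ≤ S.latticeP)
    {U : Type*} [AddCommGroup U] [Module (UgΛ C.𝔞 Λ) U] [Module ℂ U]
    [IsScalarTower ℂ (UgΛ C.𝔞 Λ) U] {N : ℕ} (u : Fin N → U)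
    (hu : ∀ x : U, ∃ P : Fin N → UnΛ C.𝔞 S.𝔫 Λ,
      x = ∑ j, Subalgebra.inclusion (UnΛ_le C.𝔞 S.𝔫 Λ) (P j) • u j) :
    Nonempty (S.ConstantData Λ u) ∧
    ∀ D : S.ConstantData Λ u,
      ∃ (A : Matrix (Fin N) (Fin D.r) (EnΛ C.𝔞 S.𝔫 Λ))
        (B : Matrix (Fin D.r) (Fin N) (EnΛ C.𝔞 S.𝔫 Λ))
        (Q : C.𝔞 →ₗ[ℂ] Matrix (Fin D.r) (Fin D.r) (UnΛ C.𝔞 S.𝔫 Λ))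
        (v : Fin D.r → Uhat C.𝔞 S.𝔫 Λ U),
        -- `v = B u`
        (∀ i, v i = ∑ j, ofEnΛ C.𝔞 S.𝔫 Λ (B i j) • toUhat C.𝔞 S.𝔫 Λ (u j)) ∧
        -- `H v = Q(H) v`
        (∀ H i, ofUgΛ C.𝔞 S.𝔫 Λ (aToUgΛ C.𝔞 Λ H) • v i =
          ∑ j, ofUnΛ C.𝔞 S.𝔫 Λ (Q H i j) • v j) ∧
        -- `Q(H) - Q̄(H)` has entries in `(𝔫 U(𝔫))_Λ`
        (∀ H i j, (Q H i j : UEnv (Complexification 𝔤₀)) - algebraMap ℂ _ (D.Qbar H i j) ∈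
          nUnΛ C.𝔞 S.𝔫 Λ) ∧
        (∀ i j, D.lam i - D.lam j ∉ S.posPart Λ → ∀ H, Q H i j = 0) ∧
        -- `[H', Q(H)_{ij}] = (λ_i - λ_j)(H') Q(H)_{ij}`
        (∀ i j, D.lam i - D.lam j ∈ S.posPart Λ → ∀ H H' : C.𝔞,
          iota (H' : Complexification 𝔤₀) * (Q H i j : UEnv (Complexification 𝔤₀)) -
            (Q H i j : UEnv (Complexification 𝔤₀)) * iota (H' : Complexification 𝔤₀) =
          (D.lam i - D.lam j) H' • (Q H i j : UEnv (Complexification 𝔤₀))) ∧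
        -- `Q(H)` is upper triangular with diagonal entries `λ_i(H)`
        (∀ H i j, j < i → Q H i j = 0) ∧
        (∀ H i, Q H i i = algebraMap ℂ _ (D.lam i H)) ∧
        -- `u = A B u`
        (∀ i, toUhat C.𝔞 S.𝔫 Λ (u i) = ∑ j, ofEnΛ C.𝔞 S.𝔫 Λ ((A * B) i j) • toUhat C.𝔞 S.𝔫 Λ (u j)) ∧
        -- `A - Ā` and `B - B̄` have entries in `(𝔫 Ê(𝔫))_Λ`
        (∀ i j, (A i j : En S.𝔫) - algebraMap ℂ _ (D.Abar i j) ∈ nEnΛ C.𝔞 S.𝔫 Λ) ∧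
        (∀ i j, (B i j : En S.𝔫) - algebraMap ℂ _ (D.Bbar i j) ∈ nEnΛ C.𝔞 S.𝔫 Λ) := by
  let := unModule C.𝔞 S.𝔫 Λ U
  let := aLieRingModule C.𝔞 Λ U
  have : LieModule ℂ C.𝔞 U := aLieModule
  have : IsScalarTower ℂ (UnΛ C.𝔞 S.𝔫 Λ) U := unModule_isScalarTower
  obtain ⟨F, hF⟩ := S.exists_weightFrame
  have hsmul : ∀ (P : UnΛ C.𝔞 S.𝔫 Λ) (x : U),
      P • x = Subalgebra.inclusion (UnΛ_le C.𝔞 S.𝔫 Λ) P • x := fun _ _ => rfl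
  have hlie : ∀ (H : C.𝔞) (x : U), ⁅H, x⁆ = aToUgΛ C.𝔞 Λ H • x := fun _ _ => rfl
  have h := F.isFilteredAction U hsmul hlie
  have hu' : ∀ x : U, ∃ P : Fin N → UnΛ C.𝔞 S.𝔫 Λ, x = ∑ j, P j • u j := hu
  refine ⟨S.nonempty_constantData F h hsmul hlie u hu', fun D => ?_⟩
  have hmk : ∀ x : U, (Submodule.Quotient.mk x : Ubar C.𝔞 S.𝔫 Λ U) = 0 → x ∈ h.fil 1 :=
    fun x hx => by
      have h1 := (Submodule.Quotient.mk_eq_zero _).1 hx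
      rw [← fil_one_eq h hsmul] at h1
      exact h1
  let π : U →ₗ[ℂ] Ubar C.𝔞 S.𝔫 Λ U := (nUnΛU C.𝔞 S.𝔫 Λ U).mkQ
  have hv : ∀ i, π (∑ l, D.Bbar i l • u l) = D.vbar i := fun i => by
    rw [D.vbar_eq, map_sum]
    exact Finset.sum_congr rfl fun l _ => map_smul π _ _
  obtain ⟨a, b, P, ha0, ha, hb0, hb, hP, hua, hHb⟩ := h.exists_lift_triangular hu'
    (lam := D.lam) (Abar := D.Abar) (Bbar := D.Bbar) (Qbar := D.Qbar)
    (fun j => hmk _ (by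
      change π _ = 0
      rw [map_sub, map_sum, sub_eq_zero]
      simp only [map_smul, hv]
      exact D.ubar_eq j))
    (fun H i => hmk _ (by
      change π _ = 0
      rw [map_sub, map_sum, sub_eq_zero]
      simp only [map_smul, hv]
      rw [← D.action, ← hv]
      rfl))
    D.Qbar_diag D.Qbar_lower D.Qbar_block
  let A : Matrix (Fin N) (Fin D.r) (EnΛ C.𝔞 S.𝔫 Λ) :=
    Matrix.of fun j i => EnΛ.ofSeq (fun k => a j k i) (ha j i)
  let B : Matrix (Fin D.r) (Fin N) (EnΛ C.𝔞 S.𝔫 Λ) :=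
    Matrix.of fun i j => EnΛ.ofSeq (fun k => b i k j) (hb i j)
  let Q : C.𝔞 →ₗ[ℂ] Matrix (Fin D.r) (Fin D.r) (UnΛ C.𝔞 S.𝔫 Λ) :=
    (Algebra.linearMap ℂ (UnΛ C.𝔞 S.𝔫 Λ)).mapMatrix.comp D.Qbar + P
  have hQ : ∀ H i j, Q H i j = algebraMap ℂ _ (D.Qbar H i j) + P H i j := fun H i j => rfl
  have hB : ∀ i j k, InvLim.Rep (B i j : En S.𝔫) k (UnΛ.toUn C.𝔞 S.𝔫 Λ (b i k j)) :=
    fun i j k => EnΛ.rep_ofSeq _ (hb i j) k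
  have hA : ∀ j i k, InvLim.Rep (A j i : En S.𝔫) k (UnΛ.toUn C.𝔞 S.𝔫 Λ (a j k i)) :=
    fun j i k => EnΛ.rep_ofSeq _ (ha j i) k
  have hzero : (0 : Module.Dual ℂ C.𝔞) ∈ S.posPart Λ := ⟨zero_mem _, zero_mem _⟩
  have hvan : ∀ i j, D.lam i - D.lam j ∉ S.posPart Λ → ∀ H, Q H i j = 0 := fun i j hij H => by
    rw [hQ, D.Qbar_block H i j (fun h' => hij (by rw [h', sub_self]; exact hzero)), map_zero,
      zero_add]
    exact S.eq_zero_of_notMem_posPart hF hij (hP H i j).1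
  have heq : ∀ H i j, D.lam i = D.lam j → P H i j = 0 := fun H i j hij => by
    have h1 := hP H i j
    rw [hij, sub_self] at h1
    exact F.eq_zero_of_wtUnΛ_zero h1
  refine ⟨A, B, Q, _, fun i => rfl, fun H i => ?_, fun H i j => ?_, hvan, fun i j hij H H' => ?_,
    fun H i j hji => ?_, fun H i => ?_, fun j => ?_, fun j i => ?_, fun i j => ?_⟩
  · exact aToUgΛ_smul_sum F h hsmul hu' hB hlie H i (Q H i) fun k => hHb k H i
  · have h1 := (mem_nUnΛ_iff _).2 (hP H i j).2
    convert h1 using 1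
    rw [hQ]
    exact add_sub_cancel_left _ _
  -- For `λ_i = λ_j` the entry is the constant `Q̄(H)_{ij}`, otherwise it is `P(H)_{ij}`.
  · have h1 : iota (H' : Complexification 𝔤₀) * (P H i j : UEnv (Complexification 𝔤₀)) -
        (P H i j : UEnv (Complexification 𝔤₀)) * iota (H' : Complexification 𝔤₀) =
        (D.lam i - D.lam j) H' • (P H i j : UEnv (Complexification 𝔤₀)) := (hP H i j).1 H'
    by_cases hl : D.lam i = D.lam j
    · have h2 : (Q H i j : UEnv (Complexification 𝔤₀)) = algebraMap ℂ _ (D.Qbar H i j) := by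
        rw [hQ, heq H i j hl, add_zero]
        rfl
      rw [h2, hl, sub_self, LinearMap.zero_apply, zero_smul, Algebra.commutes, sub_self]
    · have h2 : (Q H i j : UEnv (Complexification 𝔤₀)) = P H i j := by
        rw [hQ, D.Qbar_block H i j hl, map_zero, zero_add]
      rw [h2, h1]
  -- Below the diagonal, `λ_i - λ_j` is `0` or, by the order of the `λ_i`, not in `𝒫⁺`.
  · by_cases hl : D.lam i = D.lam j
    · rw [hQ, heq H i j hl, D.Qbar_lower H i j hji, map_zero, zero_add]
    · refine hvan i j (fun h' => ?_) H
      exact absurd (D.lam_antitone j i hji.le) (not_le.2 (S.reLex_lt_of_sub_mem h'.2 hl))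
  · rw [hQ, heq H i i rfl, D.Qbar_diag, add_zero]
  · exact toUhat_eq_sum_mul F h hsmul hu' hB hA j fun k => hua k j
  · exact F.ofSeq_sub_mem _ (ha j i) (ha0 j i)
  · exact F.ofSeq_sub_mem _ (hb i j) (hb0 i j)
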